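/- A weighted fair division instance consists of a set $N=\{1,\dots,n\}$ of $n\ge 1$ agents, a set $M=\{1,\dots,m\}$ of indivisible chores, for each agent $i$ an additive cost function $c_i:2^M\to\mathbb{R}_{\ge 0}$, i.e. $c_i(S)=\sum_{j\in S}c_{ij}$ with $c_{ij}\ge 0$, and for each agent $i$ an entitlement $\alpha_i>0$. An allocation $x=(x_i)_{i\in N}$ is a partition of $M$ into $n$ (possibly empty) bundles. A fractional allocation is a matrix $(y_{ij})$ with $y_{ij}\in[0,1]$ and $\sum_{i\in N}y_{ij}=1$ for every $j\in M$; then $c_i(y_i)=\sum_{j\in M}y_{ij}c_{ij}$. An allocation $x$ is - wEF1 (weighted envy-free up to one chore) if for all $i,i'\in N$ with $\frac{c_i(x_i)}{\alpha_i}>\frac{c_i(x_{i'})}{\alpha_{i'}}$ there is a chore $j\in x_i$ with $\frac{c_i(x_i\setminus\{j\})}{\alpha_i}\le\frac{c_i(x_{i'})}{\alpha_{i'}}$; - PO (Pareto optimal) if there is no allocation $y$ with $c_i(y_i)\le c_i(x_i)$ for all $i\in N$ and $c_{i}(y_{i})<c_{i}(x_{i})$ for some $i\in N$; - fPO (fractionally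 Pareto optimal) if there is no fractional allocation $y$ with this property. The following hold. 1. Every weighted fair division instance has an allocation that is wEF1 and PO. 2. Every weighted fair division instance has an allocation that is wEF1 and fPO. 3. For every fixed number $n\ge 1$ of agents, there is an algorithm which, given a weighted fair division instance with $n$ agents whose costs $c_{ij}\ge 0$ and entitlements $\alpha_i>0$ are rational numbers (written in binary), computes a wEF1 and PO allocation in time polynomial in the bit length of the input. (Time is that of a random access machine with logarithmic cost.) -/

import Mathlib

namespace ChoreDivision

/-! ### Weighted fair division instances with additive costs -/

/-- A weighted fair division instance with agents `Fin n` and indivisible chores `Fin m`.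
An additive cost function `2^M → ℝ≥0` is given by its values `c i j` on single chores;
`α i` is the entitlement of agent `i`. -/
structure Instance (n m : ℕ) where
  c : Fin n → Fin m → ℝ
  c_nonneg : ∀ i j, 0 ≤ c i j
  α : Fin n → ℝ
  α_pos : ∀ i, 0 < α i

/-- An (integral) allocation, that is, a partition of the chores into `n` (possibly empty)
bundles, given by the agent `x j` that receives chore `j`. -/
abbrev Allocation (n m : ℕ) : Type := Fin m → Fin n

/-- The bundle of agent `i`. -/
def Allocation.bundle {n m : ℕ} (x : Allocation n m) (i : Fin n) : Finset (Fin m) :=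
  Finset.univ.filter fun j => x j = i

/-- A fractional allocation: `x i j ∈ [0, 1]` is the fraction of chore `j` given to agent `i`. -/
structure FracAllocation (n m : ℕ) where
  x : Fin n → Fin m → ℝ
  nonneg : ∀ i j, 0 ≤ x i j
  le_one : ∀ i j, x i j ≤ 1
  sum_eq_one : ∀ j, ∑ i, x i j = 1

namespace Instance

variable {n m : ℕ}

/-- The additive cost of agent `i` for a set of chores. -/
def cost (I : Instance n m) (i : Fin n) (S : Finset (Fin m)) : ℝ := ∑ j ∈ S, I.c i j

/-- The cost of agent `i` for her share of a fractional allocation. -/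
def fracCost (I : Instance n m) (y : FracAllocation n m) (i : Fin n) : ℝ :=
  ∑ j, y.x i j * I.c i j

/-- Agent `i` weighted envies agent `i'`. -/
def WEnvies (I : Instance n m) (x : Allocation n m) (i i' : Fin n) : Prop :=
  I.cost i (x.bundle i) / I.α i > I.cost i (x.bundle i') / I.α i'

/-- Weighted envy-freeness up to one chore. -/
def IsWEF1 (I : Instance n m) (x : Allocation n m) : Prop :=
  ∀ i i' : Fin n, I.WEnvies x i i' →
    ∃ j ∈ x.bundle i,
      I.cost i (x.bundle i \ {j}) / I.α i ≤ I.cost i (x.bundle i') / I.α i'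

/-- Pareto domination, for the vectors of the agents' costs: `d` dominates `e`. -/
def Dominates (d e : Fin n → ℝ) : Prop := (∀ i, d i ≤ e i) ∧ ∃ i, d i < e i

/-- Pareto optimality: no allocation Pareto dominates `x`. -/
def IsPO (I : Instance n m) (x : Allocation n m) : Prop :=
  ¬ ∃ y : Allocation n m,
    Dominates (fun i => I.cost i (y.bundle i)) (fun i => I.cost i (x.bundle i))

/-- Fractional Pareto optimality: no fractional allocation Pareto dominates `x`. -/
def IsFPO (I : Instance n m) (x : Allocation n m) : Prop :=
  ¬ ∃ y : FracAllocation n m,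
    Dominates (fun i => I.fracCost y i) (fun i => I.cost i (x.bundle i))

end Instance

/-! ### Polynomial time: random access machines with logarithmic (bit) cost -/

namespace RAM

/-- The state of a random access machine: registers, which a program addresses directly (so that
it uses only finitely many of them), and a memory, which it addresses through registers.
All of them hold natural numbers. -/
structure State where
  reg : ℕ → ℕ
  mem : ℕ → ℕ

/-- The elementary instructions. -/
inductive Op
  /-- `r := k` -/
  | const (r k : ℕ)
  /-- `r := a + b` -/
  | add (r a b : ℕ)
  /-- `r := max (a - b) 0` -/
  | sub (r a b : ℕ)
  /-- `r := a * b` -/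
  | mul (r a b : ℕ)
  /-- `r := ⌊a / b⌋` (and `0` if `b = 0`) -/
  | div (r a b : ℕ)
  /-- `r := mem[a]` -/
  | load (r a : ℕ)
  /-- `mem[a] := r` -/
  | store (a r : ℕ)

/-- The effect of an instruction. -/
def Op.run : Op → State → State
  | .const r k, s => { s with reg := Function.update s.reg r k }
  | .add r a b, s => { s with reg := Function.update s.reg r (s.reg a + s.reg b) }
  | .sub r a b, s => { s with reg := Function.update s.reg r (s.reg a - s.reg b) }
  | .mul r a b, s => { s with reg := Function.update s.reg r (s.reg a * s.reg b) }
  | .div r a b, s => { s with reg := Function.update s.reg r (s.reg a / s.reg b) }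
  | .load r a, s => { s with reg := Function.update s.reg r (s.mem (s.reg a)) }
  | .store a r, s => { s with mem := Function.update s.mem (s.reg a) (s.reg r) }

/-- The logarithmic cost of an instruction: one, plus the binary lengths of the numbers and of
the memory address that it handles. -/
def Op.cost : Op → State → ℕ
  | .const _ k, _ => 1 + k.size
  | .add _ a b, s => 1 + (s.reg a).size + (s.reg b).size
  | .sub _ a b, s => 1 + (s.reg a).size + (s.reg b).size
  | .mul _ a b, s => 1 + (s.reg a).size + (s.reg b).size
  | .div _ a b, s => 1 + (s.reg a).size + (s.reg b).size
  | .load _ a, s => 1 + (s.reg a).size + (s.mem (s.reg a)).size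
  | .store a r, s => 1 + (s.reg a).size + (s.reg r).size

/-- Programs: instructions, sequencing, branching and loops. -/
inductive Prog
  | op (o : Op)
  | seq (p q : Prog)
  /-- if `r ≠ 0` then `p` else `q` -/
  | cond (r : ℕ) (p q : Prog)
  /-- while `r ≠ 0` do `p` -/
  | loop (r : ℕ) (p : Prog)

/-- `Exec p s s' t`: the program `p`, started in the state `s`, halts in the state `s'`, and the
total cost of the run is `t`. Every test of a register `r` costs one plus the binary length of
its content. -/
inductive Exec : Prog → State → State → ℕ → Prop
  | op (o : Op) (s : State) : Exec (.op o) s (o.run s) (o.cost s)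
  | seq {p q : Prog} {s s' s'' : State} {t t' : ℕ} :
      Exec p s s' t → Exec q s' s'' t' → Exec (.seq p q) s s'' (t + t')
  | cond_true {r : ℕ} {p q : Prog} {s s' : State} {t : ℕ} :
      s.reg r ≠ 0 → Exec p s s' t → Exec (.cond r p q) s s' (1 + (s.reg r).size + t)
  | cond_false {r : ℕ} {p q : Prog} {s s' : State} {t : ℕ} :
      s.reg r = 0 → Exec q s s' t → Exec (.cond r p q) s s' (1 + (s.reg r).size + t)
  | loop_done {r : ℕ} {p : Prog} {s : State} :
      s.reg r = 0 → Exec (.loop r p) s s (1 + (s.reg r).size)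
  | loop_step {r : ℕ} {p : Prog} {s s' s'' : State} {t t' : ℕ} :
      s.reg r ≠ 0 → Exec p s s' t → Exec (.loop r p) s' s'' t' →
      Exec (.loop r p) s s'' (1 + (s.reg r).size + t + t')

/-- The initial state for an input word: the memory holds the word from address `0` on,
register `0` holds its length, and everything else is `0`. -/
def State.init (w : List ℕ) : State where
  reg := fun r => if r = 0 then w.length else 0
  mem := fun k => w.getD k 0

/-- The output word in a final state: register `0` holds its length, and the memory holds the
word from address `0` on. -/
def State.output (s : State) : List ℕ := (List.range (s.reg 0)).map s.mem

/-- The size of a word: the total binary length of its entries, with one unit per entry. -/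
def wordSize (w : List ℕ) : ℕ := (w.map fun a => a.size + 1).sum

/-- The search problem "given `a`, find a word `w` with `IsSol a w`", where `a` is presented as
the word `encode a`, is solvable in polynomial time: some program, on every input, halts after
time at most polynomial in the size of the input and outputs a solution. -/
def SolvableInPolyTime {A : Type} (encode : A → List ℕ) (IsSol : A → List ℕ → Prop) : Prop :=
  ∃ (P : Prog) (p : Polynomial ℕ), ∀ a : A, ∃ (s : State) (t : ℕ),
    Exec P (State.init (encode a)) s t ∧ t ≤ p.eval (wordSize (encode a)) ∧ IsSol a s.output

end RAM

/-! ### Instances as inputs of algorithms -/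

/-- A weighted fair division instance with rational data. -/
structure RatInstance (n m : ℕ) where
  c : Fin n → Fin m → ℚ≥0
  α : Fin n → ℚ≥0
  α_pos : ∀ i, 0 < α i

/-- A rational instance is an instance. -/
def RatInstance.toInstance {n m : ℕ} (I : RatInstance n m) : Instance n m where
  c := fun i j => (I.c i j : ℝ)
  c_nonneg := fun i j => NNRat.cast_nonneg (I.c i j)
  α := fun i => (I.α i : ℝ)
  α_pos := fun i => NNRat.cast_pos.2 (I.α_pos i)

/-- A nonnegative rational number, as the pair of its numerator and denominator. -/
def encodeRat (q : ℚ≥0) : List ℕ := [q.num, q.den]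

/-- An instance as a word: the number of chores, then the entitlements, then, chore by chore, the
costs of the agents for it. (The number `n` of agents is fixed.) -/
def RatInstance.encode {n : ℕ} (I : Σ m, RatInstance n m) : List ℕ :=
  [I.1] ++ (List.finRange n).flatMap (fun i => encodeRat (I.2.α i)) ++
    (List.finRange I.1).flatMap fun j =>
      (List.finRange n).flatMap fun i => encodeRat (I.2.c i j)

/-- An allocation as a word: the agent who gets chore `0`, the agent who gets chore `1`, … -/
def Allocation.encode {n m : ℕ} (x : Allocation n m) : List ℕ := List.ofFn fun j => (x j : ℕ)

end ChoreDivision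

/-!
*Existence.* Fix positive weights `w` of the agents and consider the allocations that give every
chore `j` to an agent `i` for which `w i * c i j` is minimal. Such an allocation minimizes a weighted
sum of the costs even among fractional allocations, so it is fractionally Pareto optimal
(`Instance.isFPO_of_tied`), and it remains to choose `w` such that one of them is weighted envy-free
up to one chore. Measure bundles by the loads `w i * c i (x i) / α i`. If all loads up to one chore
are at most `τ` and all loads are at least `τ`, nobody envies by more than one chore
(`envyFreeUpToOne_of_load_le`).

The weights come from Scarf's lemma on dominant sets (`exists_dominant_colorful`), applied to finer
and finer grids in the simplex of weights. In the limit there are weights `w` such that every agent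
`k` has the greatest load up to one chore, among all agents, in some minimizing allocation
(`exists_weights`). If the logarithms of the costs are linearly independent over `ℚ`, then the ties
form a forest (`exists_leaf`), which can be rooted (`exists_height`). Moving chores down the forest
then leads to a minimizing allocation that is balanced around a common `τ` (`exists_balanced`).
General positive costs are limits of independent ones (`exists_linearIndependent_add_pow`), and
chores that cost nothing to some agent go to such an agent.

*Algorithm.* The perturbation of the costs can be chosen such that the limit allocation separates any
two agents by the ratio of their costs, with ties broken by the index (`Separates`). Hence the
allocation of the chores that cost something to everyone is determined by one threshold chore for
each pair of agents (`exists_envyFree`). For a fixed number `n` of agents there are only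
`(m + 1) ^ (n * n)` guesses of all thresholds. For each of them, weighted envy-freeness up to one
chore is tested directly, and the existence of suitable weights `w` by the inequalities for closed
walks through `n` agents (`exists_weights_of_cycle_test'`), of which there are `m ^ n`.
Some guess passes both tests (`bestGuess_spec`), and every guess that does is a solution
(`search_spec`).

*Running time.* The search consists of arithmetic and of iterated sums and products with
polynomially many terms. It is written as a `RAM.Term` (`RAM.exists_term_answer`), and terms compile
to programs whose time is polynomial (`RAM.Term.correct`, `RAM.Term.isPoly_bound`). The value of the
term encodes the allocation as a number in base `n`, whose digits are the output.
-/

open scoped NNReal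

namespace ChoreDivision

/-! ### Scarf's combinatorial fixed point lemma -/

section Scarf

set_option linter.unusedSectionVars false

/-- A map of a finite set onto a set with one element less identifies exactly one pair, and the two
elements of that pair are the only ones that can be left out without losing surjectivity. -/
theorem exists_unique_collision {A B : Type*} [DecidableEq A] [DecidableEq B] {s : Finset A}
    {t : Finset B} {f : A → B} (himg : s.image f = t) (hcard : s.card = t.card + 1) :
    ∃ p ∈ s, ∃ q ∈ s, p ≠ q ∧ f p = f q ∧
      (∀ x ∈ s, (s.erase x).image f = t ↔ x = p ∨ x = q) ∧
      (∀ x ∈ s, ∀ y ∈ s, f x = f y → x ≠ y → (x = p ∧ y = q) ∨ (x = q ∧ y = p)) := by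
  obtain ⟨p, hp, q, hq, hpq, hf⟩ := Finset.exists_ne_map_eq_of_card_lt_of_maps_to
    (t := t) (f := f) (s := s) (by omega) (fun x hx => by
      rw [← himg]; exact Finset.mem_coe.2 (Finset.mem_image_of_mem f hx))
  have himg_p : ∀ p ∈ s, ∀ q ∈ s, p ≠ q → f p = f q → (s.erase p).image f = t := by
    intro p hp q hq hpq hf
    rw [← himg]
    apply Finset.Subset.antisymm (Finset.image_subset_image (Finset.erase_subset _ _))
    intro y hy
    obtain ⟨x, hx, rfl⟩ := Finset.mem_image.1 hy
    by_cases hxp : x = p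
    · subst hxp
      exact Finset.mem_image.2 ⟨q, Finset.mem_erase.2 ⟨hpq.symm, hq⟩, hf.symm⟩
    · exact Finset.mem_image_of_mem f (Finset.mem_erase.2 ⟨hxp, hx⟩)
  have hinj : ∀ p ∈ s, ∀ q ∈ s, p ≠ q → f p = f q → Set.InjOn f (s.erase p) := by
    intro p hp q hq hpq hf
    apply Finset.card_image_iff.1
    rw [himg_p p hp q hq hpq hf, Finset.card_erase_of_mem hp, hcard]
    simp
  have hcol : ∀ x ∈ s, ∀ y ∈ s, f x = f y → x ≠ y → (x = p ∧ y = q) ∨ (x = q ∧ y = p) := by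
    intro x hx y hy hxy hne
    have h1 : x = p ∨ y = p := by
      by_contra! hcon
      exact hne (hinj p hp q hq hpq hf (Finset.mem_coe.2 (Finset.mem_erase.2 ⟨hcon.1, hx⟩))
        (Finset.mem_coe.2 (Finset.mem_erase.2 ⟨hcon.2, hy⟩)) hxy)
    have h2 : x = q ∨ y = q := by
      by_contra! hcon
      exact hne (hinj q hq p hp hpq.symm hf.symm
        (Finset.mem_coe.2 (Finset.mem_erase.2 ⟨hcon.1, hx⟩))
        (Finset.mem_coe.2 (Finset.mem_erase.2 ⟨hcon.2, hy⟩)) hxy)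
    grind
  refine ⟨p, hp, q, hq, hpq, hf, fun x hx => ⟨fun h => ?_, ?_⟩, hcol⟩
  · have hfx : f x ∈ (s.erase x).image f := by
      rw [h, ← himg]; exact Finset.mem_image_of_mem f hx
    obtain ⟨y, hy, hyx⟩ := Finset.mem_image.1 hfx
    rw [Finset.mem_erase] at hy
    rcases hcol x hx y hy.2 hyx.symm hy.1.symm with h | h
    · exact Or.inl h.1
    · exact Or.inr h.1
  · rintro (rfl | rfl)
    · exact himg_p x hp q hq hpq hf
    · exact himg_p x hq p hp hpq.symm hf.symm

variable {Y I : Type*} [Fintype Y] [DecidableEq Y] [Fintype I] [DecidableEq I]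

/-- `S` is dominant for the linear orders given by the rank functions `r i`: no element is above
the `r i`-minimum of `S` for all `i` at once. -/
def Dominant (r : I → Y → ℕ) (S : Finset Y) : Prop := ∀ y, ∃ i, ∀ s ∈ S, r i y ≤ r i s

theorem Dominant.mono {r : I → Y → ℕ} {S T : Finset Y} (h : Dominant r T) (hST : S ⊆ T) :
    Dominant r S := fun y => (h y).imp fun _ hi s hs => hi s (hST hs)

/-- The elements that are above the minimum of `D` in all orders except that of `a`; here `μ i` is
the `r i`-minimum of `D`. -/
def aboveExcept (r : I → Y → ℕ) (μ : I → Y) (a : I) : Finset Y :=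
  Finset.univ.filter fun z => ∀ i, i ≠ a → r i (μ i) < r i z

/-- `x` is the `r a`-maximum of the elements above the minimum of `D` in all orders but `a`. -/
def IsReplacement (r : I → Y → ℕ) (μ : I → Y) (a : I) (x : Y) : Prop :=
  x ∈ aboveExcept r μ a ∧ ∀ z ∈ aboveExcept r μ a, r a z ≤ r a x

theorem mem_aboveExcept {r : I → Y → ℕ} {μ : I → Y} {a : I} {z : Y} :
    z ∈ aboveExcept r μ a ↔ ∀ i, i ≠ a → r i (μ i) < r i z := by
  simp [aboveExcept]

theorem exists_isReplacement {r : I → Y → ℕ} {μ : I → Y} {a : I} {z : Y}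
    (hz : z ∈ aboveExcept r μ a) : ∃ x, IsReplacement r μ a x := by
  obtain ⟨x, hx, hmax⟩ := Finset.exists_max_image (aboveExcept r μ a) (r a) ⟨z, hz⟩
  exact ⟨x, hx, hmax⟩

variable {r : I → Y → ℕ} {D : Finset Y} {μ : I → Y}

theorem IsReplacement.unique (hr : ∀ i, Function.Injective (r i)) {a : I} {x y : Y}
    (hx : IsReplacement r μ a x) (hy : IsReplacement r μ a y) : x = y :=
  hr a (le_antisymm (hy.2 x hx.1) (hx.2 y hy.1))

theorem IsReplacement.ne (hD : Dominant r D) (hμ : ∀ i, μ i ∈ D) {a b : I} (hab : a ≠ b) {x y : Y}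
    (hx : IsReplacement r μ a x) (hy : IsReplacement r μ b y) : x ≠ y := by
  rintro rfl
  obtain ⟨i, hi⟩ := hD x
  by_cases hia : i = a
  · exact absurd (hi _ (hμ i)) (not_le.2 (mem_aboveExcept.1 hy.1 i (hia ▸ hab)))
  · exact absurd (hi _ (hμ i)) (not_le.2 (mem_aboveExcept.1 hx.1 i hia))

theorem IsReplacement.notMem (hr : ∀ i, Function.Injective (r i)) (hD : Dominant r D)
    (hμ : ∀ i, μ i ∈ D) (hmin : ∀ i, ∀ s ∈ D, r i (μ i) ≤ r i s) {a b : I} (hab : a ≠ b)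
    (hμab : μ a = μ b) {x : Y} (hx : IsReplacement r μ a x) : x ∉ D := by
  intro hxD
  obtain ⟨i, hi⟩ := hD x
  have hia : i = a := by
    by_contra hia
    exact absurd (hi _ (hμ i)) (not_le.2 (mem_aboveExcept.1 hx.1 i hia))
  have hxi : x = μ i := hr i (le_antisymm (hi _ (hμ i)) (hmin i x hxD))
  have := mem_aboveExcept.1 hx.1 b hab.symm
  rw [hxi, hia, hμab] at this
  exact lt_irrefl _ this

/-- Every element of a dominant set is the minimum for some order. -/
theorem Dominant.exists_min (hr : ∀ i, Function.Injective (r i)) (hD : Dominant r D)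
    (hμ : ∀ i, μ i ∈ D) (hmin : ∀ i, ∀ s ∈ D, r i (μ i) ≤ r i s) {s : Y} (hs : s ∈ D) :
    ∃ i, μ i = s := by
  obtain ⟨i, hi⟩ := hD s
  exact ⟨i, hr i (le_antisymm (hmin i s hs) (hi _ (hμ i)))⟩

theorem IsReplacement.dominant_insert (hD : Dominant r D)
    (hμ : ∀ i, μ i ∈ D) (hmin : ∀ i, ∀ s ∈ D, r i (μ i) ≤ r i s) {a : I} {x : Y}
    (hx : IsReplacement r μ a x) : Dominant r (insert x D) := by
  intro y
  by_cases hy : y ∈ aboveExcept r μ a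
  · obtain ⟨i, hi⟩ := hD y
    have hia : i = a := by
      by_contra hia
      exact absurd (hi _ (hμ i)) (not_le.2 (mem_aboveExcept.1 hy i hia))
    subst hia
    refine ⟨i, fun s hs => ?_⟩
    rcases Finset.mem_insert.1 hs with rfl | hs
    · exact hx.2 y hy
    · exact hi s hs
  · rw [mem_aboveExcept] at hy
    push Not at hy
    obtain ⟨i, hia, hi⟩ := hy
    refine ⟨i, fun s hs => ?_⟩
    rcases Finset.mem_insert.1 hs with rfl | hs
    · exact hi.trans (mem_aboveExcept.1 hx.1 i hia).le
    · exact hi.trans (hmin i s hs)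

/-- If a dominant set `D` has one element less than there are orders, so that exactly two orders
`a`, `b` have the same minimum, then the dominant sets `insert x D` arise by replacing the minimum
of `D` for `a` or for `b`. -/
theorem dominant_insert_iff (hr : ∀ i, Function.Injective (r i)) (hD : Dominant r D)
    (hμ : ∀ i, μ i ∈ D) (hmin : ∀ i, ∀ s ∈ D, r i (μ i) ≤ r i s) {a b : I}
    (hcol : ∀ x y, μ x = μ y → x ≠ y → (x = a ∧ y = b) ∨ (x = b ∧ y = a)) {x : Y} (hx : x ∉ D) :
    Dominant r (insert x D) ↔ IsReplacement r μ a x ∨ IsReplacement r μ b x := by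
  constructor
  · intro hdom
    have hlt : ∀ i, ∀ s ∈ D, r i x ≤ r i s → r i x < r i s := fun i s hs h =>
      lt_of_le_of_ne h fun h' => hx (hr i h' ▸ hs)
    have hgt : ∀ i, ∀ s ∈ D, r i s ≤ r i x → r i s < r i x := fun i s hs h =>
      lt_of_le_of_ne h fun h' => hx (hr i h' ▸ hs)
    -- every element of `D` remains a minimum after the insertion of `x`
    have hkeep : ∀ d ∈ D, ∃ i, μ i = d ∧ r i d < r i x := by
      intro d hd
      obtain ⟨i, hi⟩ := hdom d
      have h1 : μ i = d := hr i (le_antisymm (hmin i d hd) (hi _ (Finset.mem_insert_of_mem (hμ i))))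
      exact ⟨i, h1, hgt i d hd (hi x (Finset.mem_insert_self _ _))⟩
    have main : ∀ a b, (∀ x y, μ x = μ y → x ≠ y → (x = a ∧ y = b) ∨ (x = b ∧ y = a)) →
        (∀ s ∈ insert x D, r a x ≤ r a s) → IsReplacement r μ a x := by
      intro a b hcol ha
      refine ⟨mem_aboveExcept.2 fun i hia => ?_, fun z hz => ?_⟩
      · obtain ⟨i', hi', hlt'⟩ := hkeep (μ i) (hμ i)
        by_cases hii : i' = i
        · rwa [hii] at hlt'
        · exfalso
          have : i' = a := by
            rcases hcol i' i hi' hii with h | h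
            · exact h.1
            · exact absurd h.2 hia
          subst this
          exact absurd (ha _ (Finset.mem_insert_of_mem (hμ i))) (not_le.2 hlt')
      · obtain ⟨i, hi⟩ := hdom z
        have : i = a := by
          by_contra hia
          exact absurd (hi _ (Finset.mem_insert_of_mem (hμ i)))
            (not_le.2 (mem_aboveExcept.1 hz i hia))
        subst this
        exact hi x (Finset.mem_insert_self _ _)
    obtain ⟨i, hi⟩ := hdom x
    have hi' := hlt i _ (hμ i) (hi _ (Finset.mem_insert_of_mem (hμ i)))
    obtain ⟨i', hii, hlt'⟩ := hkeep (μ i) (hμ i)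
    have hne : i ≠ i' := by
      rintro rfl
      exact lt_asymm hi' hlt'
    rcases hcol i i' hii.symm hne with h | h
    · exact Or.inl (main a b hcol (h.1 ▸ hi))
    · exact Or.inr (main b a (fun x y h1 h2 => (hcol x y h1 h2).symm) (h.1 ▸ hi))
  · rintro (h | h)
    · exact h.dominant_insert hD hμ hmin
    · exact h.dominant_insert hD hμ hmin

/-- Scarf's lemma. The slack element `sl i` is the smallest one for `r i`, and larger than all
non-slack elements for the other orders; it has the color `i`. Then some dominant set has all
colors. -/
theorem exists_dominant_colorful (r : I → Y → ℕ) (hr : ∀ i, Function.Injective (r i)) (sl : I → Y)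
    (hsl : ∀ i y, r i (sl i) ≤ r i y)
    (hsl' : ∀ i k y, k ≠ i → y ∉ Set.range sl → r i y < r i (sl k))
    (C : Y → I) (hC : ∀ i, C (sl i) = i) (i0 : I) :
    ∃ S : Finset Y, Dominant r S ∧ ∀ i, ∃ s ∈ S, C s = i := by
  classical
  have hslinj : Function.Injective sl := fun i k h => by rw [← hC i, h, hC]
  by_cases hsub : ∀ i, i = i0
  · obtain ⟨x, -, hx⟩ := Finset.exists_max_image Finset.univ (r i0) ⟨sl i0, Finset.mem_univ _⟩
    refine ⟨{x}, fun y => ⟨i0, fun s hs => ?_⟩, fun i => ⟨x, by simp, ?_⟩⟩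
    · rw [Finset.mem_singleton.1 hs]; exact hx y (Finset.mem_univ _)
    · rw [hsub i, hsub (C x)]
  push Not at hsub
  obtain ⟨i1, hi1⟩ := hsub
  by_contra hno
  push Not at hno
  set n := Fintype.card I with hn
  have hn2 : 2 ≤ n := by
    have : Finset.card ({i1, i0} : Finset I) ≤ n := Finset.card_le_univ _
    rwa [Finset.card_pair hi1] at this
  set T : Finset I := Finset.univ.erase i0 with hT
  have hTcard : T.card + 1 = n := by
    rw [hT, Finset.card_erase_of_mem (Finset.mem_univ _), Finset.card_univ]; omega
  let rooms : Finset (Finset Y) := Finset.univ.filter fun S => Dominant r S ∧ S.card = n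
  let doors : Finset (Finset Y) := Finset.univ.filter fun S =>
    Dominant r S ∧ S.card + 1 = n ∧ S.image C = T
  have hdouble := Finset.sum_card_bipartiteAbove_eq_sum_card_bipartiteBelow
    (s := rooms) (t := doors) (fun S D => D ⊆ S)
  -- a room has an even number of doors, as it does not have all colors
  have hroom : ∀ S ∈ rooms, Even (doors.bipartiteAbove (fun S D => D ⊆ S) S).card := by
    intro S hS
    obtain ⟨-, hdom, hcard⟩ := Finset.mem_filter.1 hS
    by_cases hd : doors.bipartiteAbove (fun S D => D ⊆ S) S = ∅
    · simp [hd]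
    obtain ⟨D, hDm⟩ := Finset.nonempty_iff_ne_empty.2 hd
    obtain ⟨hDd, hDS⟩ := (Finset.mem_bipartiteAbove _).1 hDm
    obtain ⟨-, hDdom, hDcard, hDC⟩ := Finset.mem_filter.1 hDd
    have himg : S.image C = T := by
      apply Finset.Subset.antisymm
      · intro i hi
        refine Finset.mem_erase.2 ⟨?_, Finset.mem_univ _⟩
        rintro rfl
        obtain ⟨k, hk⟩ := hno S hdom
        by_cases hki : k = i
        · subst hki
          obtain ⟨s, hs, hsk⟩ := Finset.mem_image.1 hi
          exact hk s hs hsk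
        · have : k ∈ D.image C := by rw [hDC]; exact Finset.mem_erase.2 ⟨hki, Finset.mem_univ _⟩
          obtain ⟨s, hs, hsk⟩ := Finset.mem_image.1 this
          exact hk s (hDS hs) hsk
      · rw [← hDC]; exact Finset.image_subset_image hDS
    obtain ⟨p, hp, q, hq, hpq, -, hiff, -⟩ := exists_unique_collision himg (by omega)
    have : doors.bipartiteAbove (fun S D => D ⊆ S) S = {S.erase p, S.erase q} := by
      ext E
      rw [Finset.mem_bipartiteAbove, Finset.mem_filter, Finset.mem_insert, Finset.mem_singleton]
      constructor
      · rintro ⟨⟨-, -, hEcard, hEC⟩, hES⟩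
        obtain ⟨x, hxE, rfl⟩ := Finset.exists_eq_insert_iff.2 ⟨hES, by omega⟩
        have hEx : (insert x E).erase x = E := Finset.erase_insert hxE
        rcases (hiff x (Finset.mem_insert_self _ _)).1 (by rw [hEx]; exact hEC) with h | h
        · left; rw [← h, hEx]
        · right; rw [← h, hEx]
      · have : ∀ x ∈ S, (S.erase x).image C = T → (S.erase x ∈ Finset.univ ∧
            Dominant r (S.erase x) ∧ (S.erase x).card + 1 = n ∧ (S.erase x).image C = T) ∧
            S.erase x ⊆ S := fun x hx h => ⟨⟨Finset.mem_univ _,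
              hdom.mono (Finset.erase_subset _ _), by
                rw [Finset.card_erase_of_mem hx]; omega, h⟩, Finset.erase_subset _ _⟩
        rintro (rfl | rfl)
        · exact this p hp ((hiff p hp).2 (Or.inl rfl))
        · exact this q hq ((hiff q hq).2 (Or.inr rfl))
    rw [this, Finset.card_pair]
    · exact even_two
    · intro h
      have : p ∈ S.erase q := Finset.mem_erase.2 ⟨hpq, hp⟩
      rw [← h] at this
      exact Finset.notMem_erase _ _ this
  -- the rooms behind a door
  have hdoor : ∀ D ∈ doors, ∃ (μ : I → Y) (a b : I), a ≠ b ∧ μ a = μ b ∧ (∀ i, μ i ∈ D) ∧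
      (∀ i, ∀ s ∈ D, r i (μ i) ≤ r i s) ∧
      (∀ x y, μ x = μ y → x ≠ y → (x = a ∧ y = b) ∨ (x = b ∧ y = a)) ∧
      ∀ S, S ∈ rooms.bipartiteBelow (fun S D => D ⊆ S) D ↔
        ∃ x, (IsReplacement r μ a x ∨ IsReplacement r μ b x) ∧ S = insert x D := by
    intro D hDd
    obtain ⟨-, hDdom, hDcard, hDC⟩ := Finset.mem_filter.1 hDd
    have hDne : D.Nonempty := Finset.card_pos.1 (by omega)
    choose μ hμ hmin using fun i => Finset.exists_min_image D (r i) hDne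
    have himg : (Finset.univ : Finset I).image μ = D := by
      ext s
      simp only [Finset.mem_image, Finset.mem_univ, true_and]
      exact ⟨fun ⟨i, hi⟩ => hi ▸ hμ i, fun hs => hDdom.exists_min hr hμ hmin hs⟩
    obtain ⟨a, -, b, -, hab, hμab, -, hcol⟩ :=
      exists_unique_collision himg (by rw [Finset.card_univ]; omega)
    have hcol' := fun x y => hcol x (Finset.mem_univ _) y (Finset.mem_univ _)
    refine ⟨μ, a, b, hab, hμab, hμ, hmin, hcol', fun S => ?_⟩
    rw [Finset.mem_bipartiteBelow, Finset.mem_filter]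
    constructor
    · rintro ⟨⟨-, hdom, hcard⟩, hDS⟩
      obtain ⟨x, hxD, rfl⟩ := Finset.exists_eq_insert_iff.2 ⟨hDS, by omega⟩
      exact ⟨x, (dominant_insert_iff hr hDdom hμ hmin hcol' hxD).1 hdom, rfl⟩
    · rintro ⟨x, hx, rfl⟩
      have hxD : x ∉ D := by
        rcases hx with hx | hx
        · exact hx.notMem hr hDdom hμ hmin hab hμab
        · exact hx.notMem hr hDdom hμ hmin hab.symm hμab.symm
      exact ⟨⟨Finset.mem_univ _, (dominant_insert_iff hr hDdom hμ hmin hcol' hxD).2 hx,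
        by rw [Finset.card_insert_of_notMem hxD]; omega⟩, Finset.subset_insert _ _⟩
  set D0 : Finset Y := T.image sl with hD0
  have hinsert : ∀ D ∈ doors, ∀ x y, x ∉ D → insert x D = insert y D → x = y := by
    intro D _ x y hx h
    have : x ∈ insert y D := h ▸ Finset.mem_insert_self x D
    exact (Finset.mem_insert.1 this).resolve_right hx
  have hslmem : ∀ i, sl i ∈ D0 ↔ i ≠ i0 := by
    intro i
    rw [hD0, Finset.mem_image]
    constructor
    · rintro ⟨k, hk, hki⟩
      rw [← hslinj hki]; exact (Finset.mem_erase.1 hk).1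
    · exact fun h => ⟨i, Finset.mem_erase.2 ⟨h, Finset.mem_univ _⟩, rfl⟩
  have hD0mem : D0 ∈ doors := by
    refine Finset.mem_filter.2 ⟨Finset.mem_univ _, fun y => ?_, ?_, ?_⟩
    · by_cases hy : y ∈ Set.range sl
      · obtain ⟨i, rfl⟩ := hy
        exact ⟨i, fun s _ => hsl i s⟩
      · refine ⟨i0, fun s hs => ?_⟩
        obtain ⟨k, hk, rfl⟩ := Finset.mem_image.1 hs
        exact (hsl' i0 k y (Finset.mem_erase.1 hk).1 hy).le
    · rw [hD0, Finset.card_image_of_injective _ hslinj]; exact hTcard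
    · rw [hD0, Finset.image_image]
      have : C ∘ sl = id := funext hC
      rw [this, Finset.image_id]
  have hD0card : Odd (rooms.bipartiteBelow (fun S D => D ⊆ S) D0).card := by
    obtain ⟨μ, a, b, hab, hμab, hμ, hmin, hcol, hiff⟩ := hdoor D0 hD0mem
    have hμsl : ∀ i, i ≠ i0 → μ i = sl i := fun i hi =>
      hr i (le_antisymm (hmin i _ ((hslmem i).2 hi)) (hsl i _))
    obtain ⟨k, hk, hk0⟩ := Finset.mem_image.1 (hμ i0)
    have hk := (Finset.mem_erase.1 hk).1
    have hM : sl i0 ∈ aboveExcept r μ i0 := mem_aboveExcept.2 fun i hi => by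
      rw [hμsl i hi]
      exact lt_of_le_of_ne (hsl i _) fun h => hi (hslinj (hr i h))
    have hM' : ∀ x, ¬ IsReplacement r μ k x := by
      intro x hx
      have hx' := mem_aboveExcept.1 hx.1
      by_cases hxr : x ∈ Set.range sl
      · obtain ⟨q, rfl⟩ := hxr
        by_cases hqk : q = k
        · subst hqk
          have := hx' i0 hk.symm
          rw [← hk0] at this
          exact lt_irrefl _ this
        · exact absurd (hx' q hqk) (not_lt.2 (hsl q _))
      · have := hx' i0 hk.symm
        rw [← hk0] at this
        exact lt_asymm this (hsl' i0 k x hk hxr)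
    obtain ⟨x, hx⟩ := exists_isReplacement hM
    have hiff' : ∀ S, S ∈ rooms.bipartiteBelow (fun S D => D ⊆ S) D0 ↔ S = insert x D0 := by
      intro S
      rw [hiff]
      have hpair := hcol i0 k (by rw [← hk0, hμsl k hk]) hk.symm
      constructor
      · rintro ⟨y, hy, rfl⟩
        have : IsReplacement r μ i0 y := by
          rcases hpair with ⟨h1, h2⟩ | ⟨h1, h2⟩
          · rw [← h1, ← h2] at hy
            exact hy.resolve_right (hM' y)
          · rw [← h1, ← h2] at hy
            exact hy.resolve_left (hM' y)
        rw [this.unique hr hx]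
      · rintro rfl
        refine ⟨x, ?_, rfl⟩
        rcases hpair with ⟨h1, h2⟩ | ⟨h1, h2⟩
        · rw [← h1]; exact Or.inl hx
        · rw [← h1]; exact Or.inr hx
    have : rooms.bipartiteBelow (fun S D => D ⊆ S) D0 = {insert x D0} := by
      ext S; rw [hiff', Finset.mem_singleton]
    rw [this, Finset.card_singleton]
    exact odd_one
  have hDcard : ∀ D ∈ doors.erase D0,
      Even (rooms.bipartiteBelow (fun S D => D ⊆ S) D).card := by
    intro D hD
    obtain ⟨hne, hDd⟩ := Finset.mem_erase.1 hD
    obtain ⟨-, hDdom, -, hDC⟩ := Finset.mem_filter.1 hDd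
    obtain ⟨μ, a, b, hab, hμab, hμ, hmin, -, hiff⟩ := hdoor D hDd
    obtain ⟨x0, hx0, hx0'⟩ : ∃ x ∈ D, x ∉ Set.range sl := by
      by_contra! hcon
      apply hne
      rw [hD0, ← hDC, Finset.image_image]
      ext y
      rw [Finset.mem_image]
      constructor
      · intro hy
        obtain ⟨i, rfl⟩ := hcon y hy
        exact ⟨sl i, hy, by simp [hC]⟩
      · rintro ⟨z, hz, rfl⟩
        obtain ⟨i, rfl⟩ := hcon z hz
        simpa [hC] using hz
    have hM : ∀ a, sl a ∈ aboveExcept r μ a := fun a => mem_aboveExcept.2 fun i hi =>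
      (hmin i x0 hx0).trans_lt (hsl' i a x0 hi.symm hx0')
    obtain ⟨x, hx⟩ := exists_isReplacement (hM a)
    obtain ⟨y, hy⟩ := exists_isReplacement (hM b)
    have : rooms.bipartiteBelow (fun S D => D ⊆ S) D = {insert x D, insert y D} := by
      ext S
      rw [hiff, Finset.mem_insert, Finset.mem_singleton]
      constructor
      · rintro ⟨z, hz | hz, rfl⟩
        · left; rw [hz.unique hr hx]
        · right; rw [hz.unique hr hy]
      · rintro (rfl | rfl)
        · exact ⟨x, Or.inl hx, rfl⟩
        · exact ⟨y, Or.inr hy, rfl⟩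
    rw [this, Finset.card_pair]
    · exact even_two
    · exact fun h => hx.ne hDdom hμ hab hy
        (hinsert D hDd x y (hx.notMem hr hDdom hμ hmin hab hμab) h)
  have heven := Finset.even_sum _ hroom
  rw [hdouble, ← Finset.add_sum_erase _ _ hD0mem] at heven
  exact absurd heven (Nat.not_even_iff_odd.2 (hD0card.add_even (Finset.even_sum _ hDcard)))

end Scarf

/-! ### Balancing an allocation along a forest of ties -/

section Balance

set_option linter.unusedSectionVars false

variable {I M : Type*} [Fintype I] [DecidableEq I] [Fintype M] [DecidableEq M]

/-- The chores that `x` assigns to `i`. -/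
def share (x : M → I) (i : I) : Finset M := Finset.univ.filter fun j => x j = i

/-- The load of a set of chores with weights `v`. -/
def load (v : M → ℝ≥0) (B : Finset M) : ℝ≥0 := ∑ j ∈ B, v j

/-- The load of a set of chores without its heaviest element. -/
def loadUpToOne (v : M → ℝ≥0) (B : Finset M) : ℝ≥0 := load v B - B.sup v

theorem mem_share {x : M → I} {i : I} {j : M} : j ∈ share x i ↔ x j = i := by simp [share]

theorem load_mono (v : M → ℝ≥0) {B C : Finset M} (h : B ⊆ C) : load v B ≤ load v C :=
  Finset.sum_le_sum_of_subset h

theorem loadUpToOne_le (v : M → ℝ≥0) (B : Finset M) (j : M) :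
    loadUpToOne v B ≤ load v (B.erase j) := by
  rw [loadUpToOne, tsub_le_iff_right]
  by_cases hj : j ∈ B
  · rw [load, ← Finset.sum_erase_add _ _ hj]
    exact add_le_add le_rfl (Finset.le_sup hj)
  · rw [Finset.erase_eq_of_notMem hj]
    exact le_self_add

theorem loadUpToOne_empty (v : M → ℝ≥0) : loadUpToOne v ∅ = 0 := by
  simp [loadUpToOne, load]

theorem exists_loadUpToOne_eq (v : M → ℝ≥0) {B : Finset M} (hB : B.Nonempty) :
    ∃ j ∈ B, loadUpToOne v B = load v (B.erase j) := by
  obtain ⟨j, hj, hsup⟩ := Finset.exists_mem_eq_sup B hB v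
  refine ⟨j, hj, ?_⟩
  rw [loadUpToOne, hsup, load, ← Finset.sum_erase_add _ _ hj, add_tsub_cancel_right, load]

theorem loadUpToOne_mono (v : M → ℝ≥0) {B C : Finset M} (h : B ⊆ C) :
    loadUpToOne v B ≤ loadUpToOne v C := by
  rcases C.eq_empty_or_nonempty with rfl | hC
  · rw [Finset.subset_empty.1 h]
  · obtain ⟨j, -, hj⟩ := exists_loadUpToOne_eq v hC
    rw [hj]
    exact (loadUpToOne_le v B j).trans (load_mono v (Finset.erase_subset_erase j h))

theorem share_update (x : M → I) (s : M) (l : I) :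
    share (Function.update x s l) l = insert s (share x l) := by
  ext j
  by_cases h : j = s
  · subst h; simp [mem_share]
  · simp [mem_share, h]

theorem share_update_subset (x : M → I) (s : M) {l i : I} (hi : i ≠ l) :
    share (Function.update x s l) i ⊆ share x i := by
  intro j hj
  rw [mem_share] at hj ⊢
  by_cases h : j = s
  · subst h
    rw [Function.update_self] at hj
    exact absurd hj.symm hi
  · rwa [Function.update_of_ne h] at hj

/-- Let `T i j` say that chore `j` may be given to agent `i`, and suppose that a height `h` makes
the bipartite graph `T` a rooted forest: each agent has at most one chore that may also go to an
agent who is not higher. Suppose that some admissible allocation has all loads up to one chore at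
most `τ` and that each agent reaches `τ` up to one chore in some admissible allocation. Then one
admissible allocation has all loads up to one chore at most `τ` and all loads at least `τ`.

An agent whose load is below `τ` can take over any chore and still respects the upper bound. If she
always takes it from a higher agent, the process terminates. It cannot stop with an agent below `τ`
who holds all chores shared with higher agents only: she could get at most one more chore. -/
theorem exists_balanced (T : I → M → Prop) (v : I → M → ℝ≥0) (h : I → ℕ)
    (hT : ∀ l s s', (T l s ∧ ∃ k, k ≠ l ∧ T k s ∧ h k ≤ h l) →
      (T l s' ∧ ∃ k, k ≠ l ∧ T k s' ∧ h k ≤ h l) → s = s')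
    (τ : ℝ≥0) (z : M → I) (hz : ∀ j, T (z j) j)
    (hzτ : ∀ i, loadUpToOne (v i) (share z i) ≤ τ)
    (hy : ∀ i, ∃ y : M → I, (∀ j, T (y j) j) ∧ τ ≤ loadUpToOne (v i) (share y i)) :
    ∃ x : M → I, (∀ j, T (x j) j) ∧ (∀ i, loadUpToOne (v i) (share x i) ≤ τ) ∧
      ∀ i, τ ≤ load (v i) (share x i) := by
  classical
  obtain ⟨x, hx, hmin⟩ := Finset.exists_min_image
    (Finset.univ.filter fun x : M → I => (∀ j, T (x j) j) ∧
      ∀ i, loadUpToOne (v i) (share x i) ≤ τ) (fun x => ∑ j, h (x j))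
    ⟨z, by simp [hz, hzτ]⟩
  obtain ⟨-, hxT, hxτ⟩ := Finset.mem_filter.1 hx
  refine ⟨x, hxT, hxτ, fun l => ?_⟩
  by_contra! hl
  by_cases hs : ∃ s, T l s ∧ x s ≠ l ∧ ∀ k, k ≠ l → T k s → h l < h k
  · obtain ⟨s, hls, hxs, hk⟩ := hs
    have hlt := hk _ hxs (hxT s)
    refine absurd (hmin (Function.update x s l) (Finset.mem_filter.2 ⟨Finset.mem_univ _, ?_, ?_⟩))
      (not_le.2 ?_)
    · intro j
      by_cases hj : j = s
      · subst hj; simpa using hls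
      · simpa [hj] using hxT j
    · intro i
      by_cases hi : i = l
      · subst hi
        rw [share_update]
        refine (loadUpToOne_le _ _ s).trans (le_trans (load_mono _ ?_) hl.le)
        rw [Finset.erase_insert_eq_erase]
        exact Finset.erase_subset _ _
      · exact (loadUpToOne_mono _ (share_update_subset x s hi)).trans (hxτ i)
    · refine Finset.sum_lt_sum (fun j _ => ?_) ⟨s, Finset.mem_univ _, by simpa using hlt⟩
      by_cases hj : j = s
      · subst hj; simpa using hlt.le
      · simp [hj]
  · push Not at hs
    obtain ⟨y, hyT, hyτ⟩ := hy l
    -- all chores of `l` in `y` but one are chores of `l` in `x`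
    have hsub : ∃ s, (share y l).erase s ⊆ share x l := by
      by_cases hne : ∃ s ∈ share y l, x s ≠ l
      · obtain ⟨s, hs1, hs2⟩ := hne
        refine ⟨s, fun j hj => ?_⟩
        obtain ⟨hjs, hj⟩ := Finset.mem_erase.1 hj
        rw [mem_share] at hj hs1 ⊢
        by_contra hjx
        have hTj : T l j := hj ▸ hyT j
        have hTs : T l s := hs1 ▸ hyT s
        exact hjs (hT l j s ⟨hTj, hs j hTj hjx⟩ ⟨hTs, hs s hTs hs2⟩)
      · push Not at hne
        by_cases hyl : (share y l).Nonempty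
        · obtain ⟨s, -⟩ := hyl
          exact ⟨s, fun j hj => mem_share.2 (hne j (Finset.mem_of_mem_erase hj))⟩
        · rw [Finset.not_nonempty_iff_eq_empty.1 hyl, loadUpToOne_empty] at hyτ
          exact absurd (hl.trans_le hyτ) not_lt_zero
    obtain ⟨s, hs⟩ := hsub
    exact absurd ((hyτ.trans (loadUpToOne_le _ _ s)).trans (load_mono _ hs)) (not_le.2 hl)

/-- A bipartite graph that is a forest, in the sense that each nonempty set `A` of agents contains
one who shares at most one chore with the others, has a height function as in `exists_balanced`. -/
theorem exists_height (T : I → M → Prop)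
    (hleaf : ∀ A : Finset I, A.Nonempty → ∃ l ∈ A, ∀ s s',
      (T l s ∧ ∃ k ∈ A, k ≠ l ∧ T k s) → (T l s' ∧ ∃ k ∈ A, k ≠ l ∧ T k s') → s = s') :
    ∃ h : I → ℕ, ∀ l s s', (T l s ∧ ∃ k, k ≠ l ∧ T k s ∧ h k ≤ h l) →
      (T l s' ∧ ∃ k, k ≠ l ∧ T k s' ∧ h k ≤ h l) → s = s' := by
  have key : ∀ A : Finset I, ∃ h : I → ℕ, ∀ l ∈ A, ∀ s s',
      (T l s ∧ ∃ k ∈ A, k ≠ l ∧ T k s ∧ h k ≤ h l) →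
      (T l s' ∧ ∃ k ∈ A, k ≠ l ∧ T k s' ∧ h k ≤ h l) → s = s' := by
    intro A
    induction A using Finset.strongInduction with
    | H A ih =>
    rcases A.eq_empty_or_nonempty with rfl | hA
    · exact ⟨fun _ => 0, by simp⟩
    obtain ⟨l, hl, hls⟩ := hleaf A hA
    obtain ⟨h, hh⟩ := ih (A.erase l) (Finset.erase_ssubset hl)
    refine ⟨Function.update h l (A.sup h + 1), fun i hi s s' hs hs' => ?_⟩
    by_cases hil : i = l
    · subst hil
      exact hls s s' ⟨hs.1, hs.2.imp fun k hk => ⟨hk.1, hk.2.1, hk.2.2.1⟩⟩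
        ⟨hs'.1, hs'.2.imp fun k hk => ⟨hk.1, hk.2.1, hk.2.2.1⟩⟩
    · have : ∀ s, (T i s ∧ ∃ k ∈ A, k ≠ i ∧ T k s ∧
          Function.update h l (A.sup h + 1) k ≤ Function.update h l (A.sup h + 1) i) →
          T i s ∧ ∃ k ∈ A.erase l, k ≠ i ∧ T k s ∧ h k ≤ h i := by
        rintro s ⟨h1, k, hk, hki, hks, hle⟩
        rw [Function.update_of_ne hil] at hle
        have hkl : k ≠ l := by
          rintro rfl
          rw [Function.update_self] at hle
          have := Finset.le_sup (f := h) hi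
          omega
        rw [Function.update_of_ne hkl] at hle
        exact ⟨h1, k, Finset.mem_erase.2 ⟨hkl, hk⟩, hki, hks, hle⟩
      exact hh i (Finset.mem_erase.2 ⟨hil, hi⟩) s s' (this s hs) (this s' hs')
  obtain ⟨h, hh⟩ := key Finset.univ
  exact ⟨h, fun l s s' hs hs' => hh l (Finset.mem_univ _) s s' (by simpa using hs)
    (by simpa using hs')⟩

/-- Agent `i` attains the minimal weighted cost of chore `j`. -/
def Tied (c : I → M → ℝ≥0) (w : I → ℝ≥0) (i : I) (j : M) : Prop := ∀ k, w i * c i j ≤ w k * c k j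

/-- If the logarithms of the costs are linearly independent over `ℚ`, then the ties for weights `w`
form a forest. Otherwise some agents and chores would span at least as many ties as there are
agents and chores in total; but the logarithm of the cost of a tie is the difference of a number
attached to the chore and one attached to the agent. -/
theorem exists_leaf (c : I → M → ℝ≥0) (hc : ∀ i j, 0 < c i j)
    (hlin : LinearIndependent ℚ fun p : I × M => Real.log (c p.1 p.2))
    (w : I → ℝ≥0) (hw : ∀ i, 0 < w i) (A : Finset I) (hA : A.Nonempty) :
    ∃ l ∈ A, ∀ s s', (Tied c w l s ∧ ∃ k ∈ A, k ≠ l ∧ Tied c w k s) →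
      (Tied c w l s' ∧ ∃ k ∈ A, k ≠ l ∧ Tied c w k s') → s = s' := by
  classical
  by_contra! hcon
  let E : Finset (I × M) := Finset.univ.filter fun p =>
    p.1 ∈ A ∧ Tied c w p.1 p.2 ∧ ∃ k ∈ A, k ≠ p.1 ∧ Tied c w k p.2
  let S : Finset M := E.image Prod.snd
  have hE : ∀ p, p ∈ E ↔ p.1 ∈ A ∧ Tied c w p.1 p.2 ∧ ∃ k ∈ A, k ≠ p.1 ∧ Tied c w k p.2 := by
    intro p; simp [E]
  have hEA : 2 * A.card ≤ E.card := by
    refine Finset.mul_card_image_le_card_of_maps_to (f := Prod.fst) (fun p hp => ((hE p).1 hp).1) 2 ?_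
    intro l hl
    obtain ⟨s, s', hs, hs', hne⟩ := hcon l hl
    rw [Nat.succ_le_iff, Finset.one_lt_card]
    exact ⟨(l, s), Finset.mem_filter.2 ⟨(hE _).2 ⟨hl, hs.1, hs.2⟩, rfl⟩,
      (l, s'), Finset.mem_filter.2 ⟨(hE _).2 ⟨hl, hs'.1, hs'.2⟩, rfl⟩, fun h => hne (by simpa using h)⟩
  have hES : 2 * S.card ≤ E.card := by
    refine Finset.mul_card_image_le_card_of_maps_to (f := Prod.snd)
      (fun p hp => Finset.mem_image_of_mem _ hp) 2 ?_
    intro s hs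
    obtain ⟨p, hp, rfl⟩ := Finset.mem_image.1 hs
    obtain ⟨h1, h2, k, hk, hkp, hks⟩ := (hE p).1 hp
    rw [Nat.succ_le_iff, Finset.one_lt_card]
    exact ⟨p, Finset.mem_filter.2 ⟨hp, rfl⟩, (k, p.2),
      Finset.mem_filter.2 ⟨(hE _).2 ⟨hk, hks, p.1, h1, hkp.symm, h2⟩, rfl⟩,
      fun h => hkp (by rw [h])⟩
  obtain ⟨l0, hl0⟩ := hA
  -- normalize the logarithms of the weights so that the one of `l0` vanishes
  let u : I → ℝ := fun l => Real.log (w l) - Real.log (w l0)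
  let q : M → ℝ := fun s => Real.log ((⨅ l, w l * c l s : ℝ≥0) : ℝ) - Real.log (w l0)
  let V : Finset ℝ := (A.erase l0).image u ∪ S.image q
  have hV : V.card < E.card := by
    have h1 : V.card ≤ (A.erase l0).card + S.card := (Finset.card_union_le _ _).trans
      (add_le_add Finset.card_image_le Finset.card_image_le)
    have h2 := Finset.card_erase_add_one hl0
    omega
  have hspan : ∀ p ∈ E, Real.log (c p.1 p.2) ∈ Submodule.span ℚ (V : Set ℝ) := by
    intro p hp
    obtain ⟨h1, h2, -⟩ := (hE p).1 hp
    have hinf : (⨅ l, w l * c l p.2) = w p.1 * c p.1 p.2 := by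
      have : Nonempty I := ⟨l0⟩
      exact le_antisymm (ciInf_le (OrderBot.bddBelow _) p.1) (le_ciInf h2)
    have hlog : Real.log (c p.1 p.2) = q p.2 - u p.1 := by
      simp only [q, u, hinf, NNReal.coe_mul]
      rw [Real.log_mul (by exact_mod_cast (hw p.1).ne') (by exact_mod_cast (hc p.1 p.2).ne')]
      ring
    rw [hlog]
    refine Submodule.sub_mem _ (Submodule.subset_span ?_) ?_
    · exact Finset.mem_coe.2 (Finset.mem_union_right _
        (Finset.mem_image_of_mem _ (Finset.mem_image_of_mem _ hp)))
    · by_cases hpl : p.1 = l0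
      · have : u p.1 = 0 := by simp [u, hpl]
        rw [this]; exact Submodule.zero_mem _
      · exact Submodule.subset_span (Finset.mem_coe.2 (Finset.mem_union_left _
          (Finset.mem_image_of_mem _ (Finset.mem_erase.2 ⟨hpl, h1⟩))))
  have hlin' : LinearIndependent ℚ fun p : E => Real.log (c p.1.1 p.1.2) :=
    hlin.comp (fun p : E => p.1) Subtype.val_injective
  have := linearIndependent_le_span' _ hlin' (V : Set ℝ) (by
    rintro _ ⟨p, rfl⟩
    exact hspan p.1 p.2)
  simp only [Cardinal.mk_coe_finset, Finset.coe_sort_coe, Fintype.card_coe, Nat.cast_le] at this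
  omega

end Balance

/-! ### Weights for which every agent can be the one with the largest load -/

section Weights

set_option linter.unusedSectionVars false

open Filter Topology

variable {I M : Type*} [Fintype I] [DecidableEq I] [Fintype M] [DecidableEq M]

/-- A discrete version of the Knaster-Kuratowski-Mazurkiewicz lemma: in every coloring of the
integer points of the simplex of side length `N`, all the colors of some set `T` occur within
distance `card I` of a point of the face spanned by `T`. -/
theorem exists_colorful_box [Nonempty I] (N : ℕ) (C : (I → ℕ) → I) :
    ∃ (T : Finset I) (m : I → ℕ) (y : I → I → ℕ), T.Nonempty ∧ (∀ k, k ∉ T → m k = 0) ∧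
      ∀ i ∈ T, ∑ k, y i k = N ∧ C (y i) = i ∧
        ∀ k, m k ≤ y i k ∧ y i k ≤ m k + Fintype.card I := by
  classical
  let X := Finset.piAntidiag (Finset.univ : Finset I) N
  have hX : ∀ a : I → ℕ, a ∈ X ↔ ∑ i, a i = N := by simp [X]
  let Y := X ⊕ I
  let e := Fintype.equivFin Y
  let z : I → Y → ℕ := fun i => Sum.elim (fun a => a.1 i + 1) fun k => if k = i then 0 else N + 2
  -- ties between coordinates are broken by an arbitrary numbering of the points
  let r : I → Y → ℕ := fun i y => z i y * Fintype.card Y + e y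
  have hrlt : ∀ i y y', z i y < z i y' → r i y < r i y' := by
    intro i y y' h
    have h1 := (e y).2
    have h2 : (z i y + 1) * Fintype.card Y ≤ z i y' * Fintype.card Y := Nat.mul_le_mul_right _ h
    simp only [r]
    rw [add_mul] at h2
    omega
  have hr : ∀ i, Function.Injective (r i) := by
    intro i y y' h
    have hz : z i y = z i y' := by
      rcases lt_trichotomy (z i y) (z i y') with h' | h' | h'
      · exact absurd h (hrlt i _ _ h').ne
      · exact h'
      · exact absurd h (hrlt i _ _ h').ne'
    simp only [r, hz, add_right_inj] at h
    exact e.injective (Fin.ext h)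
  have hXle : ∀ a ∈ X, ∀ i, a i ≤ N := fun a ha i => by
    rw [← (hX a).1 ha]; exact Finset.single_le_sum (fun _ _ => Nat.zero_le _) (Finset.mem_univ i)
  have hsl : ∀ i y, r i (Sum.inr i) ≤ r i y := by
    intro i y
    by_cases hy : y = Sum.inr i
    · rw [hy]
    · refine (hrlt i _ _ ?_).le
      rcases y with a | k
      · simp [z]
      · have : k ≠ i := fun h => hy (h ▸ rfl)
        simp [z, this]
  obtain ⟨i0⟩ := ‹Nonempty I›
  obtain ⟨S, hdom, hcol⟩ := exists_dominant_colorful r hr Sum.inr hsl (by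
      rintro i k (a | q) hk hy
      · refine hrlt i _ _ ?_
        have := hXle a.1 a.2 i
        simp only [z, Sum.elim_inl, Sum.elim_inr, hk, if_false]
        omega
      · exact absurd ⟨q, rfl⟩ hy)
    (Sum.elim (fun a => C a.1) id) (fun i => rfl) i0
  let T : Finset I := Finset.univ.filter fun i => Sum.inr i ∉ S
  have hT : ∀ i, i ∈ T ↔ Sum.inr i ∉ S := by simp [T]
  have hdomX : ∀ x ∈ X, ∃ i ∈ T, ∀ a (ha : a ∈ X), Sum.inl ⟨a, ha⟩ ∈ S → x i ≤ a i := by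
    intro x hx
    obtain ⟨i, hi⟩ := hdom (Sum.inl ⟨x, hx⟩)
    refine ⟨i, (hT i).2 fun hmem => ?_, fun a ha haS => ?_⟩
    · exact absurd (hi _ hmem) (not_le.2 (hrlt i _ _ (by simp [z])))
    · by_contra! hlt
      exact absurd (hi _ haS) (not_le.2 (hrlt i _ _ (by simpa [z] using hlt)))
  have hy : ∀ i, ∃ a, i ∈ T → ∃ ha : a ∈ X, Sum.inl ⟨a, ha⟩ ∈ S ∧ C a = i := by
    intro i
    by_cases hi : i ∈ T
    · obtain ⟨s | k, hs, hsi⟩ := hcol i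
      · exact ⟨s.1, fun _ => ⟨s.2, hs, hsi⟩⟩
      · have : k = i := hsi
        exact absurd (this ▸ hs) ((hT i).1 hi)
    · exact ⟨0, fun h => absurd h hi⟩
  choose y hy using hy
  have hTne : T.Nonempty := by
    obtain ⟨i, hi, -⟩ := hdomX (Pi.single i0 N) ((hX _).2 (by simp))
    exact ⟨i, hi⟩
  obtain ⟨t0, ht0⟩ := hTne
  let A : Finset (I → ℕ) := X.filter fun a => ∃ ha : a ∈ X, Sum.inl ⟨a, ha⟩ ∈ S
  have hA : ∀ a, a ∈ A ↔ ∃ ha : a ∈ X, Sum.inl ⟨a, ha⟩ ∈ S := fun a => by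
    simp only [A, Finset.mem_filter]
    exact ⟨fun h => h.2, fun h => ⟨h.1, h⟩⟩
  have hAne : A.Nonempty := ⟨y t0, (hA _).2 ((hy t0 ht0).imp fun _ h => h.1)⟩
  choose b hbA hb using fun i => Finset.exists_min_image A (fun a => a i) hAne
  let m : I → ℕ := fun i => if i ∈ T then b i i else 0
  have hmle : ∀ a ∈ A, ∀ k, m k ≤ a k := by
    intro a ha k
    by_cases hk : k ∈ T
    · simpa [m, hk] using hb k a ha
    · simp [m, hk]
  have hsum : N + 1 ≤ ∑ i, m i + Fintype.card I := by
    by_contra! hlt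
    have hlt' : ∑ i, (m i + 1) ≤ N := by
      rw [Finset.sum_add_distrib, Finset.sum_const, Finset.card_univ, smul_eq_mul, mul_one]; omega
    obtain ⟨i, hi, hle⟩ := hdomX (fun i => m i + 1 + if i = t0 then N - ∑ i, (m i + 1) else 0)
      ((hX _).2 (by
        rw [Finset.sum_add_distrib, Finset.sum_ite_eq' Finset.univ t0]
        simp only [Finset.mem_univ, if_true]; omega))
    obtain ⟨hbX, hbS⟩ := (hA _).1 (hbA i)
    have := hle _ hbX hbS
    simp only [m, hi, if_true] at this
    omega
  refine ⟨T, m, y, ⟨t0, ht0⟩, fun k hk => by simp [m, hk], fun i hi => ?_⟩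
  obtain ⟨hyX, hyS, hyC⟩ := hy i hi
  have hyA : y i ∈ A := (hA _).2 ⟨hyX, hyS⟩
  refine ⟨(hX _).1 hyX, hyC, fun k => ⟨hmle _ hyA k, ?_⟩⟩
  have h1 := (hX _).1 hyX
  have h2 := Finset.add_sum_erase Finset.univ (y i) (Finset.mem_univ k)
  have h3 := Finset.add_sum_erase Finset.univ m (Finset.mem_univ k)
  have h4 := Finset.sum_le_sum fun k' (_ : k' ∈ Finset.univ.erase k) => hmle _ hyA k'
  omega

/-- The load vector of agent `i`, for weights `w` and entitlements `α`. -/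
noncomputable def wLoad (c : I → M → ℝ≥0) (α w : I → ℝ≥0) (i : I) (j : M) : ℝ≥0 :=
  w i * c i j / α i

theorem continuous_loadUpToOne_wLoad (c : I → M → ℝ≥0) (α : I → ℝ≥0) (i : I) (B : Finset M) :
    Continuous fun w : I → ℝ≥0 => loadUpToOne (wLoad c α w i) B := by
  have h : ∀ j, Continuous fun w : I → ℝ≥0 => wLoad c α w i j := fun j => by
    unfold wLoad
    exact ((continuous_apply i).mul continuous_const).div_const _
  unfold loadUpToOne load
  exact (continuous_finsetSum _ fun j _ => h j).sub (Continuous.finset_sup_apply fun j _ => h j)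

/-- A function into a finite type is eventually constant along an ultrafilter. -/
theorem eventually_eq_of_finite {A F : Type*} [Finite F] (U : Ultrafilter A) (f : A → F) :
    ∃ v, ∀ᶠ a in U, f a = v := by
  have := (Ultrafilter.eventually_exists_iff (f := U) (P := fun v a => f a = v)).1
    (Eventually.of_forall fun a => ⟨f a, rfl⟩)
  exact this

/-- There are positive weights for which each agent has the largest load up to one chore, and some
chore, in some allocation along the ties. -/
theorem exists_weights [Nonempty I] [Nonempty M] (c : I → M → ℝ≥0) (hc : ∀ i j, 0 < c i j)
    (α : I → ℝ≥0) :
    ∃ w : I → ℝ≥0, (∀ i, 0 < w i) ∧ ∀ i, ∃ y : M → I, (∀ j, Tied c w (y j) j) ∧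
      (share y i).Nonempty ∧ ∀ k, loadUpToOne (wLoad c α w k) (share y k) ≤
        loadUpToOne (wLoad c α w i) (share y i) := by
  classical
  have hlabel : ∀ w : I → ℝ≥0, ∃ (y : M → I) (i : I), (∀ j, Tied c w (y j) j) ∧
      (share y i).Nonempty ∧ ∀ k, loadUpToOne (wLoad c α w k) (share y k) ≤
        loadUpToOne (wLoad c α w i) (share y i) := by
    intro w
    choose y hy using fun j => Finite.exists_min fun i => w i * c i j
    obtain ⟨j0⟩ := ‹Nonempty M›
    obtain ⟨i, hi, hmax⟩ := Finset.exists_max_image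
      (Finset.univ.filter fun i => (share y i).Nonempty)
      (fun i => loadUpToOne (wLoad c α w i) (share y i))
      ⟨y j0, Finset.mem_filter.2 ⟨Finset.mem_univ _, j0, mem_share.2 rfl⟩⟩
    refine ⟨y, i, hy, (Finset.mem_filter.1 hi).2, fun k => ?_⟩
    by_cases hk : (share y k).Nonempty
    · exact hmax k (Finset.mem_filter.2 ⟨Finset.mem_univ _, hk⟩)
    · rw [Finset.not_nonempty_iff_eq_empty.1 hk, loadUpToOne_empty]
      exact zero_le
  choose x l hx hne hmax using hlabel
  let n := Fintype.card I
  let W : ℕ → (I → ℕ) → I → ℝ≥0 := fun N a k => ((a k : ℝ≥0) + 1) / (N + n)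
  choose T m y hT hm hy using fun N => exists_colorful_box N fun a => l (W N a)
  let U : Ultrafilter ℕ := Filter.hyperfilter ℕ
  have hU : (U : Filter ℕ) ≤ atTop := by
    rw [← Nat.cofinite_eq_atTop]; exact Filter.hyperfilter_le_cofinite
  obtain ⟨⟨T', X⟩, hconst⟩ := eventually_eq_of_finite U
    fun N => (T N, fun i => x (W N (y N i)))
  have hTN : ∀ N, (T N, fun i => x (W N (y N i))) = (T', X) → T N = T' := fun N hN =>
    (Prod.ext_iff.1 hN).1
  have hn : 0 < n := Fintype.card_pos
  have hb : ∀ N k, (m N k : ℝ≥0) / (N + n) ∈ Set.Icc (0 : ℝ≥0) 1 := by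
    intro N k
    refine ⟨zero_le, div_le_one_of_le₀ ?_ zero_le⟩
    obtain ⟨t, ht⟩ := hT N
    obtain ⟨h1, -, h2⟩ := hy N t ht
    have h3 : y N t k ≤ N :=
      (Finset.single_le_sum (fun _ _ => Nat.zero_le _) (Finset.mem_univ k)).trans h1.le
    exact_mod_cast ((h2 k).1.trans h3).trans (Nat.le_add_right _ _)
  have hlim : ∀ k, ∃ a : ℝ≥0, Tendsto (fun N : ℕ => (m N k : ℝ≥0) / (N + n)) U (𝓝 a) := by
    intro k
    obtain ⟨a, -, ha⟩ := isCompact_Icc.ultrafilter_le_nhds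
      (U.map fun N : ℕ => (m N k : ℝ≥0) / (N + n)) (by
        rw [le_principal_iff]
        exact Filter.mem_map.2 (Filter.univ_mem' fun N => hb N k))
    exact ⟨a, ha⟩
  choose w hw using hlim
  have hinv : Tendsto (fun N : ℕ => ((n : ℝ≥0) + 1) / (N + n)) U (𝓝 0) := by
    refine Tendsto.mono_left ?_ hU
    refine NNReal.tendsto_coe.1 ?_
    push_cast
    exact tendsto_const_nhds.div_atTop
      (tendsto_atTop_add_const_right _ _ tendsto_natCast_atTop_atTop)
  have hWlim : ∀ i ∈ T', Tendsto (fun N => W N (y N i)) U (𝓝 w) := by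
    intro i hi
    rw [tendsto_pi_nhds]
    intro k
    have hup : Tendsto (fun N : ℕ => (m N k : ℝ≥0) / (N + n) + ((n : ℝ≥0) + 1) / (N + n)) U
        (𝓝 (w k)) := by simpa using (hw k).add hinv
    refine tendsto_of_tendsto_of_tendsto_of_le_of_le' (hw k) hup ?_ ?_
    · filter_upwards [hconst] with N hN
      have h := (hy N i (hTN N hN ▸ hi)).2.2 k
      simp only [W]
      gcongr
      exact_mod_cast h.1.trans (Nat.le_succ _)
    · filter_upwards [hconst] with N hN
      have h := (hy N i (hTN N hN ▸ hi)).2.2 k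
      simp only [W]
      have h' : (y N i k : ℝ≥0) + 1 ≤ m N k + (n + 1) := by
        rw [← add_assoc]
        exact add_le_add (by exact_mod_cast h.2) le_rfl
      rw [← add_div]
      gcongr
  obtain ⟨N0, hN0⟩ := hconst.exists
  obtain ⟨t, ht⟩ := hT N0
  rw [hTN N0 hN0] at ht
  have hsum : ∑ k, w k = 1 := by
    refine tendsto_nhds_unique (tendsto_finsetSum Finset.univ
      fun k _ => tendsto_pi_nhds.1 (hWlim t ht) k) ?_
    refine Tendsto.congr' ?_ tendsto_const_nhds
    filter_upwards [hconst] with N hN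
    have h := (hy N t (hTN N hN ▸ ht)).1
    simp only [W]
    rw [← Finset.sum_div, Finset.sum_add_distrib]
    have h1 : ∑ k, (y N t k : ℝ≥0) = N := by exact_mod_cast h
    have h2 : (N : ℝ≥0) + n ≠ 0 := by
      have : (0 : ℝ≥0) < n := by exact_mod_cast hn
      positivity
    rw [h1, Finset.sum_const, Finset.card_univ, nsmul_eq_mul, mul_one, div_self h2]
  have hw0 : ∀ k, k ∉ T' → w k = 0 := by
    intro k hk
    refine tendsto_nhds_unique (hw k) (Tendsto.congr' ?_ tendsto_const_nhds)
    filter_upwards [hconst] with N hN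
    rw [hm N k (hTN N hN ▸ hk)]
    simp
  have hX : ∀ i ∈ T', (∀ j, Tied c w (X i j) j) ∧ (share (X i) i).Nonempty ∧
      ∀ k, loadUpToOne (wLoad c α w k) (share (X i) k) ≤
        loadUpToOne (wLoad c α w i) (share (X i) i) := by
    intro i hi
    have hev : ∀ᶠ N in U, x (W N (y N i)) = X i ∧ l (W N (y N i)) = i := by
      filter_upwards [hconst] with N hN
      exact ⟨congrFun (Prod.ext_iff.1 hN).2 i,
        (hy N i (hTN N hN ▸ hi)).2.1⟩
    refine ⟨fun j k => ?_, ?_, fun k => ?_⟩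
    · refine le_of_tendsto_of_tendsto
        ((tendsto_pi_nhds.1 (hWlim i hi) (X i j)).mul_const (c (X i j) j))
        ((tendsto_pi_nhds.1 (hWlim i hi) k).mul_const (c k j)) ?_
      filter_upwards [hev] with N hN
      have := hx (W N (y N i)) j k
      rwa [hN.1] at this
    · obtain ⟨N, h1, h2⟩ := hev.exists
      have := hne (W N (y N i))
      rwa [h1, h2] at this
    · refine le_of_tendsto_of_tendsto
        (((continuous_loadUpToOne_wLoad c α k (share (X i) k)).tendsto w).comp (hWlim i hi))
        (((continuous_loadUpToOne_wLoad c α i (share (X i) i)).tendsto w).comp (hWlim i hi)) ?_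
      filter_upwards [hev] with N hN
      have := hmax (W N (y N i)) k
      rwa [hN.1, hN.2] at this
  -- an agent of positive weight gets nothing if some weight vanishes
  have hpos : ∀ k, 0 < w k := by
    intro k
    by_contra! hk
    obtain ⟨i, hi⟩ : ∃ i, w i ≠ 0 := by
      by_contra! hcon
      simp [hcon] at hsum
    obtain ⟨h1, ⟨j, hj⟩, -⟩ := hX i (by by_contra h; exact hi (hw0 i h))
    have := h1 j k
    rw [mem_share.1 hj, le_antisymm hk zero_le, zero_mul] at this
    exact (mul_pos (pos_iff_ne_zero.2 hi) (hc i j)).not_ge this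
  exact ⟨w, hpos, fun i => ⟨X i, hX i (by by_contra h; exact (hpos i).ne' (hw0 i h))⟩⟩

end Weights

/-! ### Existence for positive costs -/

section Existence

set_option linter.unusedSectionVars false

open Filter Topology

variable {I M : Type*} [Fintype I] [DecidableEq I] [Fintype M] [DecidableEq M]

/-- Weighted envy-freeness up to one chore, in a form that is closed under limits of the costs. -/
def EnvyFreeUpToOne (c : I → M → ℝ≥0) (α : I → ℝ≥0) (x : M → I) : Prop :=
  ∀ i k, (share x i).Nonempty → ∃ j ∈ share x i,
    load (c i) ((share x i).erase j) / α i ≤ load (c i) (share x k) / α k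

theorem load_wLoad (c : I → M → ℝ≥0) (α w : I → ℝ≥0) (i : I) (B : Finset M) :
    load (wLoad c α w i) B = w i * (load (c i) B / α i) := by
  simp only [load, wLoad]
  rw [← Finset.sum_div, ← Finset.mul_sum, mul_div_assoc]

theorem envyFreeUpToOne_of_load_le {c : I → M → ℝ≥0} {α w : I → ℝ≥0} (hw : ∀ i, 0 < w i)
    {x : M → I} (hx : ∀ j, Tied c w (x j) j) {τ : ℝ≥0}
    (hle : ∀ i, loadUpToOne (wLoad c α w i) (share x i) ≤ τ)
    (hge : ∀ i, τ ≤ load (wLoad c α w i) (share x i)) : EnvyFreeUpToOne c α x := by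
  intro i k hi
  obtain ⟨j, hj, hji⟩ := exists_loadUpToOne_eq (wLoad c α w i) hi
  refine ⟨j, hj, ?_⟩
  have h1 := (hji.symm.le.trans (hle i)).trans (hge k)
  have h2 : load (wLoad c α w k) (share x k) ≤ w i * (load (c i) (share x k) / α k) := by
    simp only [load, wLoad]
    rw [← mul_div_assoc, Finset.mul_sum, Finset.sum_div]
    refine Finset.sum_le_sum fun l hl => ?_
    have := hx l i
    rw [mem_share.1 hl] at this
    gcongr
  rw [load_wLoad] at h1
  exact le_of_mul_le_mul_left (h1.trans h2) (hw i)

/-- Existence for generic costs, where the ties form a forest. That every agent is tied to some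
chore bounds the ratios of the weights. -/
theorem exists_envyFree_of_linearIndependent [Nonempty I] [Nonempty M] (c : I → M → ℝ≥0)
    (hc : ∀ i j, 0 < c i j) (hlin : LinearIndependent ℚ fun p : I × M => Real.log (c p.1 p.2))
    (α : I → ℝ≥0) :
    ∃ (x : M → I) (w : I → ℝ≥0), (∀ i, 0 < w i) ∧ (∀ i, ∃ j, Tied c w i j) ∧
      (∀ j, Tied c w (x j) j) ∧ EnvyFreeUpToOne c α x := by
  classical
  obtain ⟨w, hw, hy⟩ := exists_weights c hc α
  obtain ⟨h, hh⟩ := exists_height (Tied c w) (exists_leaf c hc hlin w hw)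
  obtain ⟨i0⟩ := ‹Nonempty I›
  obtain ⟨y0, hy0, -⟩ := hy i0
  -- the smallest possible maximum of the loads up to one chore
  obtain ⟨z, hz, hmin⟩ := Finset.exists_min_image
    (Finset.univ.filter fun x : M → I => ∀ j, Tied c w (x j) j)
    (fun x => Finset.univ.sup fun i => loadUpToOne (wLoad c α w i) (share x i))
    ⟨y0, by simpa using hy0⟩
  obtain ⟨x, hx, hle, hge⟩ := exists_balanced (Tied c w) (wLoad c α w) h hh
    (Finset.univ.sup fun i => loadUpToOne (wLoad c α w i) (share z i)) z
    (Finset.mem_filter.1 hz).2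
    (fun i => Finset.le_sup (f := fun i => loadUpToOne (wLoad c α w i) (share z i))
      (Finset.mem_univ i))
    (fun i => by
      obtain ⟨y, hyT, -, hmax⟩ := hy i
      exact ⟨y, hyT, (hmin y (by simpa using hyT)).trans (Finset.sup_le fun k _ => hmax k)⟩)
  refine ⟨x, w, hw, fun i => ?_, hx, envyFreeUpToOne_of_load_le hw hx hle hge⟩
  obtain ⟨y, hyT, ⟨j, hj⟩, -⟩ := hy i
  exact ⟨j, mem_share.1 hj ▸ hyT j⟩

open Polynomial in
/-- Adding distinct powers of a suitable small number makes any numbers linearly independent. -/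
theorem exists_linearIndependent_add_pow {P : Type*} [Fintype P] (L : P → ℝ) (e : P → ℕ)
    (he : Function.Injective e) (he1 : ∀ p, 1 ≤ e p) {δ : ℝ} (hδ : 0 < δ) :
    ∃ t ∈ Set.Ioo 0 δ, LinearIndependent ℚ fun p => L p + t ^ e p := by
  classical
  let q : (P → ℚ) → ℝ[X] := fun g => ∑ p, C (g p : ℝ) * (C (L p) + X ^ e p)
  have hq : ∀ g, g ≠ 0 → q g ≠ 0 := by
    intro g hg h0
    obtain ⟨p, hp⟩ := Function.ne_iff.1 hg
    have : (q g).coeff (e p) = g p := by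
      simp only [q, finsetSum_coeff, coeff_C_mul, coeff_add, coeff_X_pow]
      rw [Finset.sum_eq_single p]
      · have := he1 p
        rw [coeff_C_of_ne_zero (by omega)]
        simp
      · intro p' _ hp'
        have h1 := he1 p
        rw [coeff_C_of_ne_zero (by omega), if_neg fun h => hp' (he h.symm)]
        simp
      · simp
    rw [h0, coeff_zero] at this
    exact hp (by exact_mod_cast this.symm)
  let B : Set ℝ := ⋃ g : {g : P → ℚ // g ≠ 0}, {t | (q g.1).eval t = 0}
  have hB : B.Countable := Set.countable_iUnion fun g => by
    refine Set.Finite.countable (Set.Finite.subset (q g.1).roots.toFinset.finite_toSet ?_)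
    intro t ht
    simpa [hq g.1 g.2, IsRoot.def] using ht
  obtain ⟨t, ht, htB⟩ : ∃ t ∈ Set.Ioo (0 : ℝ) δ, t ∉ B := by
    by_contra! hcon
    exact hδ.not_ge (Cardinal.Real.Ioo_countable_iff.1 (hB.mono hcon))
  refine ⟨t, ht, Fintype.linearIndependent_iff.2 fun g hg => ?_⟩
  by_contra! hcon
  refine htB (Set.mem_iUnion.2 ⟨⟨g, fun h => ?_⟩, ?_⟩)
  · obtain ⟨p, hp⟩ := hcon
    exact hp (congrFun h p)
  · simp only [Set.mem_ofPred_eq, q, eval_finsetSum, eval_mul, eval_add, eval_C, eval_pow, eval_X]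
    rw [← hg]
    exact Finset.sum_congr rfl fun p _ => by rw [Rat.smul_def]

/-- Distinct rows and columns: the four corners of a rectangle are independent. -/
theorem add_ne_add_of_linearIndependent {L : I × M → ℝ} (hlin : LinearIndependent ℚ L) {i k : I}
    (hik : i ≠ k) {j j' : M} (hj : j ≠ j') : L (i, j) + L (k, j') ≠ L (k, j) + L (i, j') := by
  intro h
  have := @hlin (Finsupp.single (i, j) 1 + Finsupp.single (k, j') 1)
    (Finsupp.single (k, j) 1 + Finsupp.single (i, j') 1) (by simpa using h)
  have h2 := DFunLike.congr_fun this (i, j)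
  simp [hik.symm, hj.symm] at h2

variable {n : ℕ}

/-- The allocation separates the chores of two agents `i < k` by the ratio of their costs, where
equal ratios are ordered by the numbers `ρ` of the chores. -/
def Separates (c : Fin n → M → ℝ≥0) (ρ : M → ℕ) (x : M → Fin n) : Prop :=
  ∀ i k, i < k → ∀ j j', x j = i → x j' = k → c k j' * c i j < c k j * c i j' ∨
    (c k j' * c i j = c k j * c i j' ∧ ρ j' < ρ j)

/-- The exponents of the perturbation. The leading term of a perturbed ratio of the costs of two
agents is the one of the agent with the larger index. -/
def perturbExp (n R : ℕ) (ρ : M → ℕ) (p : Fin n × M) : ℕ := n * R - (p.1 * R + ρ p.2)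

theorem perturbExp_add {R : ℕ} {ρ : M → ℕ} (hR : ∀ j, ρ j < R) (p : Fin n × M) :
    perturbExp n R ρ p + (p.1 * R + ρ p.2) = n * R ∧ 1 ≤ perturbExp n R ρ p := by
  have h1 := hR p.2
  have h2 : ((p.1 : ℕ) + 1) * R ≤ n * R := Nat.mul_le_mul_right _ p.1.2
  rw [add_mul] at h2
  unfold perturbExp
  omega

theorem perturbExp_injective {R : ℕ} {ρ : M → ℕ} (hρ : Function.Injective ρ) (hR : ∀ j, ρ j < R) :
    Function.Injective (perturbExp n R ρ) := by
  rintro ⟨i, j⟩ ⟨k, l⟩ h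
  have h1 := perturbExp_add hR (i, j)
  have h2 := perturbExp_add hR (k, l)
  have h3 : (i : ℕ) * R + ρ j = k * R + ρ l := by
    simp only at h1 h2 h
    omega
  have hi : (i : ℕ) = k := by
    have := congrArg (· / R) h3
    simpa [Nat.add_div_of_dvd_right, Nat.div_eq_of_lt (hR _), (Nat.zero_le _).trans_lt (hR j)]
      using this
  rw [hi] at h3
  exact Prod.ext (Fin.ext hi) (hρ (Nat.add_left_cancel h3))

theorem pow_perturbExp_lt {R : ℕ} {ρ : M → ℕ} (hR : ∀ j, ρ j < R) {t : ℝ} (ht : 0 < t)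
    (ht' : t < 1 / 4) {i k : Fin n} (hik : i < k) {j j' : M} (hj : ρ j' < ρ j) :
    t ^ perturbExp n R ρ (i, j) + t ^ perturbExp n R ρ (k, j') <
      t ^ perturbExp n R ρ (k, j) + t ^ perturbExp n R ρ (i, j') := by
  have h1 := perturbExp_add hR (i, j)
  have h2 := perturbExp_add hR (k, j)
  have h3 := perturbExp_add hR (k, j')
  have hR' := hR j
  have h4 : ((i : ℕ) + 1) * R ≤ k * R := Nat.mul_le_mul_right _ hik
  rw [add_mul] at h4
  simp only at h1 h2 h3
  have hle : ∀ b, perturbExp n R ρ (k, j) + 1 ≤ b → t ^ b ≤ t ^ perturbExp n R ρ (k, j) / 4 := by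
    intro b hb
    refine (pow_le_pow_of_le_one ht.le (by linarith) hb).trans ?_
    rw [pow_succ]
    have := pow_pos ht (perturbExp n R ρ (k, j))
    nlinarith
  have h5 := hle (perturbExp n R ρ (i, j)) (by omega)
  have h6 := hle (perturbExp n R ρ (k, j')) (by omega)
  have h7 := pow_pos ht (perturbExp n R ρ (k, j))
  have h8 := pow_pos ht (perturbExp n R ρ (i, j'))
  linarith

/-- Existence for positive costs. The allocation is a limit of allocations for perturbed costs, and
the perturbation is chosen such that, moreover, the bundles are separated with a fixed rule for
breaking ties; this makes the allocation accessible to an enumeration of polynomial length. -/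
theorem exists_envyFree_of_pos [NeZero n] (c : Fin n → M → ℝ≥0) (hc : ∀ i j, 0 < c i j)
    (α : Fin n → ℝ≥0) (ρ : M → ℕ) (hρ : Function.Injective ρ) :
    ∃ x : M → Fin n, EnvyFreeUpToOne c α x ∧
      (∃ w : Fin n → ℝ≥0, (∀ i, 0 < w i) ∧ ∀ j, Tied c w (x j) j) ∧ Separates c ρ x := by
  classical
  rcases isEmpty_or_nonempty M with hM | hM
  · refine ⟨fun _ => 0, fun i k ⟨j, _⟩ => (hM.false j).elim,
      ⟨fun _ => 1, fun _ => one_pos, fun j => (hM.false j).elim⟩, fun i k _ j => (hM.false j).elim⟩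
  obtain ⟨R, hR⟩ : ∃ R, ∀ j, ρ j < R :=
    ⟨Finset.univ.sup ρ + 1, fun j => Nat.lt_succ_of_le (Finset.le_sup (Finset.mem_univ j))⟩
  let e := perturbExp n R ρ
  have he1 : ∀ p, 1 ≤ e p := fun p => (perturbExp_add hR p).2
  choose t ht htlin using fun N : ℕ => exists_linearIndependent_add_pow
    (fun p : Fin n × M => Real.log (c p.1 p.2)) e (perturbExp_injective hρ hR) he1
    (show (0 : ℝ) < 1 / (N + 4) by positivity)
  have ht4 : ∀ N, t N < 1 / 4 := fun N => (ht N).2.trans_le <| by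
    apply one_div_le_one_div_of_le (by norm_num); linarith [(Nat.cast_nonneg N : (0 : ℝ) ≤ N)]
  let c' : ℕ → Fin n → M → ℝ≥0 := fun N i j => c i j * (Real.exp (t N ^ e (i, j))).toNNReal
  have hc' : ∀ N i j, 0 < c' N i j := fun N i j =>
    mul_pos (hc i j) (Real.toNNReal_pos.2 (Real.exp_pos _))
  have hlog : ∀ N i j, Real.log (c' N i j) = Real.log (c i j) + t N ^ e (i, j) := by
    intro N i j
    simp only [c', NNReal.coe_mul, Real.coe_toNNReal _ (Real.exp_pos _).le]
    rw [Real.log_mul (by exact_mod_cast (hc i j).ne') (Real.exp_pos _).ne', Real.log_exp]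
  choose x w hw htied hx hef using fun N => exists_envyFree_of_linearIndependent (c' N) (hc' N)
    (by simpa only [hlog] using htlin N) α
  have htlim : Tendsto t atTop (𝓝 0) :=
    squeeze_zero (fun N => (ht N).1.le) (fun N => (ht N).2.le)
      (tendsto_const_nhds.div_atTop
        (tendsto_atTop_add_const_right _ _ tendsto_natCast_atTop_atTop))
  let U : Ultrafilter ℕ := Filter.hyperfilter ℕ
  have hU : (U : Filter ℕ) ≤ atTop := by
    rw [← Nat.cofinite_eq_atTop]; exact Filter.hyperfilter_le_cofinite
  have htpow : ∀ p, Tendsto (fun N => t N ^ e p) U (𝓝 0) := fun p => by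
    have := (htlim.mono_left hU).pow (e p)
    rwa [zero_pow (by have := he1 p; omega)] at this
  have hclim : ∀ i j, Tendsto (fun N => c' N i j) U (𝓝 (c i j)) := by
    intro i j
    have h1 : Tendsto (fun N => (Real.exp (t N ^ e (i, j))).toNNReal) U (𝓝 1) := by
      have := (continuous_real_toNNReal.tendsto _).comp
        ((Real.continuous_exp.tendsto _).comp (htpow (i, j)))
      simpa [Function.comp_def] using this
    simpa using (tendsto_const_nhds (x := c i j)).mul h1
  obtain ⟨X, hX⟩ := eventually_eq_of_finite U x
  -- the normalized weights stay in a compact subset of the positive numbers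
  let B : ℝ≥0 := ∑ j, ∑ i, ∑ k, c k j * 3 / c i j
  have hcle : ∀ N i j, c i j ≤ c' N i j ∧ c' N i j ≤ c i j * 3 := by
    intro N i j
    have h0 := pow_nonneg (ht N).1.le (e (i, j))
    have h1 : t N ^ e (i, j) ≤ 1 := pow_le_one₀ (ht N).1.le (by linarith [ht4 N])
    constructor
    · refine le_mul_of_one_le_right' ?_
      rw [← Real.toNNReal_one]
      exact Real.toNNReal_le_toNNReal (Real.one_le_exp h0)
    · refine mul_le_mul_right ?_ _
      refine Real.toNNReal_le_iff_le_coe.2 ?_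
      have := Real.exp_one_lt_d9
      have h2 := Real.exp_le_exp.2 h1
      push_cast
      linarith
  have hwB : ∀ N i k, w N i ≤ w N k * B := by
    intro N i k
    obtain ⟨j, hj⟩ := htied N i
    have hB : c k j * 3 / c i j ≤ B := by
      refine le_trans ?_ (Finset.single_le_sum (f := fun j => ∑ i, ∑ k, c k j * 3 / c i j)
        (fun _ _ => zero_le) (Finset.mem_univ j))
      refine le_trans ?_ (Finset.single_le_sum (f := fun i => ∑ k, c k j * 3 / c i j)
        (fun _ _ => zero_le) (Finset.mem_univ i))
      exact Finset.single_le_sum (f := fun k => c k j * 3 / c i j)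
        (fun _ _ => zero_le) (Finset.mem_univ k)
    calc w N i = w N i * c i j / c i j := by rw [mul_div_cancel_right₀ _ (hc i j).ne']
      _ ≤ w N k * (c k j * 3) / c i j := by
        refine div_le_div_of_nonneg_right ?_ zero_le
        exact (mul_le_mul_right (hcle N i j).1 _).trans ((hj k).trans
          (mul_le_mul_right (hcle N k j).2 _))
      _ = w N k * (c k j * 3 / c i j) := by rw [mul_div_assoc]
      _ ≤ w N k * B := mul_le_mul_right hB _
  have hBpos : 0 < B := by
    by_contra! h
    have := hwB 0 0 0
    rw [le_antisymm h zero_le, mul_zero] at this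
    exact (hw 0 0).not_ge this
  have hwlim : ∀ i, ∃ a : ℝ≥0, a ∈ Set.Icc B⁻¹ B ∧
      Tendsto (fun N => w N i / w N 0) U (𝓝 a) := by
    intro i
    obtain ⟨a, h1, ha⟩ := isCompact_Icc.ultrafilter_le_nhds (U.map fun N => w N i / w N 0)
      (s := Set.Icc B⁻¹ B) (by
        rw [le_principal_iff]
        refine Filter.mem_map.2 (Filter.univ_mem' fun N => ⟨?_, ?_⟩)
        · rw [le_div_iff₀ (hw N 0), inv_mul_le_iff₀ hBpos, mul_comm]
          exact hwB N 0 i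
        · rw [div_le_iff₀ (hw N 0), mul_comm]
          exact hwB N i 0)
    exact ⟨a, h1, ha⟩
  choose w' hw'B hw' using hwlim
  refine ⟨X, fun i k hi => ?_, ⟨w', fun i => (inv_pos.2 hBpos).trans_le (hw'B i).1, fun j k => ?_⟩,
    fun i k hik j j' hj hj' => ?_⟩
  · have hev : ∀ᶠ N in (U : Filter ℕ), ∃ j, j ∈ share X i ∧
        load (c' N i) ((share X i).erase j) / α i ≤ load (c' N i) (share X k) / α k := by
      filter_upwards [hX] with N hN
      have := hef N i k
      rw [hN] at this
      exact this hi
    obtain ⟨j, hj⟩ := Ultrafilter.eventually_exists_iff.1 hev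
    obtain ⟨N, hN⟩ := hj.exists
    have hl : ∀ B' : Finset M, Tendsto (fun N => load (c' N i) B') U (𝓝 (load (c i) B')) :=
      fun B' => tendsto_finsetSum _ fun j _ => hclim i j
    exact ⟨j, hN.1, le_of_tendsto_of_tendsto ((hl _).div_const _) ((hl _).div_const _)
      (hj.mono fun _ h => h.2)⟩
  · refine le_of_tendsto_of_tendsto ((hw' (X j)).mul (hclim (X j) j)) ((hw' k).mul (hclim k j)) ?_
    filter_upwards [hX] with N hN
    have := hx N j k
    rw [hN] at this
    rw [div_mul_eq_mul_div, div_mul_eq_mul_div]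
    gcongr
  · -- the inequality of the logarithms of the perturbed ratios
    have hne : j ≠ j' := by
      rintro rfl
      exact hik.ne (hj.symm.trans hj')
    have hlt : ∀ᶠ N in (U : Filter ℕ),
        (Real.log (c i j) + t N ^ e (i, j)) + (Real.log (c k j') + t N ^ e (k, j')) <
        (Real.log (c k j) + t N ^ e (k, j)) + (Real.log (c i j') + t N ^ e (i, j')) := by
      filter_upwards [hX] with N hN
      refine lt_of_le_of_ne ?_ (add_ne_add_of_linearIndependent (htlin N) hik.ne hne)
      rw [← hlog, ← hlog, ← hlog, ← hlog, ← Real.log_mul, ← Real.log_mul]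
      · refine Real.log_le_log (mul_pos (hc' N _ _) (hc' N _ _)) ?_
        have h1 := hx N j k
        have h2 := hx N j' i
        rw [hN, hj] at h1
        rw [hN, hj'] at h2
        have h3 := mul_le_mul' h1 h2
        have h4 : (w N i * w N k) * (c' N i j * c' N k j') ≤
            (w N i * w N k) * (c' N k j * c' N i j') := by
          calc _ = w N i * c' N i j * (w N k * c' N k j') := by ring
            _ ≤ _ := h3
            _ = _ := by ring
        exact_mod_cast le_of_mul_le_mul_left h4 (mul_pos (hw N i) (hw N k))
      all_goals exact_mod_cast (hc' N _ _).ne'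
    have hle : Real.log (c i j) + Real.log (c k j') ≤ Real.log (c k j) + Real.log (c i j') := by
      have hl : ∀ i j, Tendsto (fun N => Real.log (c i j) + t N ^ e (i, j)) U
          (𝓝 (Real.log (c i j))) := fun i j => by
        simpa using tendsto_const_nhds.add (htpow (i, j))
      exact le_of_tendsto_of_tendsto ((hl i j).add (hl k j')) ((hl k j).add (hl i j'))
        (hlt.mono fun _ h => h.le)
    have hlog' : ∀ a b : ℝ≥0, 0 < a → 0 < b → Real.log a + Real.log b = Real.log (a * b : ℝ≥0) :=
      fun a b ha hb => by
        rw [NNReal.coe_mul, Real.log_mul (by exact_mod_cast ha.ne') (by exact_mod_cast hb.ne')]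
    rcases hle.lt_or_eq with h | h
    · left
      rw [hlog' _ _ (hc _ _) (hc _ _), hlog' _ _ (hc _ _) (hc _ _)] at h
      have := (Real.log_lt_log_iff (NNReal.coe_pos.2 (mul_pos (hc i j) (hc k j')))
        (NNReal.coe_pos.2 (mul_pos (hc k j) (hc i j')))).1 h
      rw [mul_comm (c k j')]
      exact_mod_cast this
    · right
      have h' := h
      rw [hlog' _ _ (hc _ _) (hc _ _), hlog' _ _ (hc _ _) (hc _ _)] at h'
      have := Real.log_injOn_pos (Set.mem_Ioi.2 (NNReal.coe_pos.2 (mul_pos (hc i j) (hc k j'))))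
        (Set.mem_Ioi.2 (NNReal.coe_pos.2 (mul_pos (hc k j) (hc i j')))) h'
      refine ⟨by rw [mul_comm (c k j')]; exact_mod_cast this, ?_⟩
      by_contra! hρj
      obtain ⟨N, hN⟩ := hlt.exists
      have := pow_perturbExp_lt hR (ht N).1 (ht4 N) hik
        (lt_of_le_of_ne hρj fun h => hne (hρ h))
      simp only [e] at hN
      linarith

end Existence

/-! ### Chores that cost nothing to some agent, and efficiency -/

section Efficiency

set_option linter.unusedSectionVars false

variable {M : Type*} [Fintype M] [DecidableEq M] {n m : ℕ}

theorem load_subtype (v : M → ℝ≥0) (p : M → Prop) [DecidablePred p] (B : Finset M) :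
    load (fun j : {j // p j} => v j) (B.subtype p) = load v (B.filter p) := by
  simp only [load]
  exact Finset.sum_subtype_eq_sum_filter v

/-- For arbitrary costs, the chores that cost nothing to some agent are given to such agents. -/
theorem exists_envyFree [NeZero n] (c : Fin n → Fin m → ℝ≥0) (α : Fin n → ℝ≥0) :
    ∃ x₀ : Fin m → Fin n,
      (∀ i k, i < k → ∀ j j', (∀ i, 0 < c i j) → (∀ i, 0 < c i j') → x₀ j = i → x₀ j' = k →
        c k j' * c i j < c k j * c i j' ∨ (c k j' * c i j = c k j * c i j' ∧ j' < j)) ∧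
      ∀ x : Fin m → Fin n, (∀ j, (∀ i, 0 < c i j) → x j = x₀ j) →
        (∀ j, (∃ i, c i j = 0) → c (x j) j = 0) →
        EnvyFreeUpToOne c α x ∧
          ∃ w : Fin n → ℝ≥0, (∀ i, 0 < w i) ∧ ∀ j, Tied c w (x j) j := by
  classical
  obtain ⟨y, hef, ⟨w, hw, htied⟩, hsep⟩ := exists_envyFree_of_pos
    (fun i (j : {j : Fin m // ∀ i, 0 < c i j}) => c i j) (fun i j => j.2 i) α
    (fun j => (j.1 : ℕ)) (fun j j' h => Subtype.ext (Fin.ext h))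
  refine ⟨fun j => if h : ∀ i, 0 < c i j then y ⟨j, h⟩ else 0, ?_, fun x hx hx0 => ⟨?_, w, hw, ?_⟩⟩
  · intro i k hik j j' hj hj' h1 h2
    simp only [hj, hj', implies_true, dif_pos] at h1 h2
    exact hsep i k hik ⟨j, hj⟩ ⟨j', hj'⟩ h1 h2
  · have hxy : ∀ j (h : ∀ i, 0 < c i j), x j = y ⟨j, h⟩ := fun j h => (hx j h).trans (dif_pos h)
    have hshare : ∀ i, share y i = (share x i).subtype fun j => ∀ i, 0 < c i j := by
      intro i
      ext ⟨j, hj⟩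
      rw [Finset.mem_subtype, mem_share, mem_share, hxy j hj]
    -- zero-cost chores do not contribute to the cost of a bundle for its owner
    have hown : ∀ i, ∀ B ⊆ share x i, load (c i) B =
        load (c i) (B.filter fun j => ∀ i, 0 < c i j) := by
      intro i B hB
      refine (Finset.sum_subset (Finset.filter_subset _ _) fun j hj hj' => ?_).symm
      have h1 : ¬ ∀ i, 0 < c i j := fun h => hj' (Finset.mem_filter.2 ⟨hj, h⟩)
      push Not at h1
      have := hx0 j (h1.imp fun _ h => le_antisymm h zero_le)
      rwa [mem_share.1 (hB hj)] at this
    intro i k hi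
    by_cases hyi : (share y i).Nonempty
    · obtain ⟨⟨j, hj⟩, hjs, hle⟩ := hef i k hyi
      refine ⟨j, ?_, ?_⟩
      · rw [hshare, Finset.mem_subtype] at hjs
        exact hjs
      · have h1 : (share y i).erase ⟨j, hj⟩ =
            ((share x i).erase j).subtype fun j => ∀ i, 0 < c i j := by
          ext ⟨l, hl⟩
          simp [hshare]
        rw [h1, load_subtype (c i), hshare, load_subtype (c i),
          ← hown i _ (Finset.erase_subset _ _)] at hle
        exact hle.trans (div_le_div_of_nonneg_right (load_mono _ (Finset.filter_subset _ _)) zero_le)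
    · obtain ⟨j, hj⟩ := hi
      refine ⟨j, hj, ?_⟩
      have h1 : (share x i).filter (fun j => ∀ i, 0 < c i j) = ∅ := by
        ext l
        simp only [Finset.mem_filter, Finset.notMem_empty, iff_false]
        rintro ⟨h1, h2⟩
        exact hyi ⟨⟨l, h2⟩, by rw [hshare, Finset.mem_subtype]; exact h1⟩
      have h2 : load (c i) ((share x i).erase j) = 0 := by
        refine le_antisymm ((load_mono _ (Finset.erase_subset _ _)).trans ?_) zero_le
        rw [hown i _ subset_rfl, h1]
        simp [load]
      rw [h2, zero_div]
      exact zero_le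
  · intro j k
    by_cases h : ∀ i, 0 < c i j
    · have := htied ⟨j, h⟩ k
      rwa [← (hx j h).trans (dif_pos h)] at this
    · push Not at h
      rw [hx0 j (h.imp fun _ h => le_antisymm h zero_le), mul_zero]
      exact zero_le

namespace Instance

/-- The costs as nonnegative real numbers. -/
def costNN (I : Instance n m) (i : Fin n) (j : Fin m) : ℝ≥0 := ⟨I.c i j, I.c_nonneg i j⟩

/-- The entitlements as nonnegative real numbers. -/
def entNN (I : Instance n m) (i : Fin n) : ℝ≥0 := ⟨I.α i, (I.α_pos i).le⟩

theorem coe_load (I : Instance n m) (i : Fin n) (B : Finset (Fin m)) :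
    (load (I.costNN i) B : ℝ) = I.cost i B := by
  simp only [load, cost, NNReal.coe_sum]
  rfl

theorem isWEF1_of_envyFree (I : Instance n m) {x : Allocation n m}
    (h : EnvyFreeUpToOne I.costNN I.entNN x) : I.IsWEF1 x := by
  intro i k henvy
  have hne : (share x i).Nonempty := by
    by_contra hne
    have h0 : x.bundle i = ∅ := Finset.not_nonempty_iff_eq_empty.1 hne
    have h1 : 0 ≤ I.cost i (x.bundle k) / I.α k :=
      div_nonneg (Finset.sum_nonneg fun j _ => I.c_nonneg i j) (I.α_pos k).le
    unfold WEnvies at henvy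
    rw [h0] at henvy
    simp only [cost, Finset.sum_empty, zero_div] at henvy h1
    exact henvy.not_ge h1
  obtain ⟨j, hj, hle⟩ := h i k hne
  refine ⟨j, hj, ?_⟩
  rw [Finset.sdiff_singleton_eq_erase, ← coe_load, ← coe_load]
  exact_mod_cast hle

/-- An allocation that minimizes a positively weighted sum of costs chore by chore is efficient. -/
theorem isFPO_of_tied (I : Instance n m) {x : Allocation n m} {w : Fin n → ℝ≥0}
    (hw : ∀ i, 0 < w i) (hx : ∀ j, Tied I.costNN w (x j) j) : I.IsFPO x := by
  rintro ⟨y, hle, i0, hlt⟩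
  have hx' : ∀ j k, (w (x j) : ℝ) * I.c (x j) j ≤ w k * I.c k j := fun j k => by
    exact_mod_cast hx j k
  have h1 : ∑ i, (w i : ℝ) * I.fracCost y i < ∑ i, (w i : ℝ) * I.cost i (x.bundle i) :=
    Finset.sum_lt_sum (fun i _ => mul_le_mul_of_nonneg_left (hle i) (w i).2)
      ⟨i0, Finset.mem_univ _, mul_lt_mul_of_pos_left hlt (NNReal.coe_pos.2 (hw i0))⟩
  have h2 : ∑ i, (w i : ℝ) * I.cost i (x.bundle i) = ∑ j, (w (x j) : ℝ) * I.c (x j) j := by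
    rw [← Finset.sum_fiberwise_of_maps_to (s := Finset.univ) (t := Finset.univ) (g := x)
      (fun _ _ => Finset.mem_univ _)]
    refine Finset.sum_congr rfl fun i _ => ?_
    rw [cost, Finset.mul_sum]
    refine Finset.sum_congr rfl fun j hj => ?_
    rw [(Finset.mem_filter.1 hj).2]
  have h3 : ∑ j, (w (x j) : ℝ) * I.c (x j) j ≤ ∑ i, (w i : ℝ) * I.fracCost y i := by
    simp only [fracCost, Finset.mul_sum]
    rw [Finset.sum_comm]
    refine Finset.sum_le_sum fun j _ => ?_
    calc (w (x j) : ℝ) * I.c (x j) j = ∑ i, y.x i j * ((w (x j) : ℝ) * I.c (x j) j) := by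
          rw [← Finset.sum_mul, y.sum_eq_one, one_mul]
      _ ≤ ∑ i, (w i : ℝ) * (y.x i j * I.c i j) := by
          refine Finset.sum_le_sum fun i _ => ?_
          rw [mul_left_comm (w i : ℝ)]
          exact mul_le_mul_of_nonneg_left (hx' j i) (y.nonneg i j)
  linarith

theorem IsFPO.isPO {I : Instance n m} {x : Allocation n m} (h : I.IsFPO x) : I.IsPO x := by
  rintro ⟨y, hy⟩
  refine h ⟨⟨fun i j => if y j = i then 1 else 0, fun i j => by split_ifs <;> norm_num,
    fun i j => by split_ifs <;> norm_num, fun j => by simp⟩, ?_⟩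
  have : ∀ i, I.fracCost ⟨fun i j => if y j = i then 1 else 0,
      fun i j => by split_ifs <;> norm_num, fun i j => by split_ifs <;> norm_num,
      fun j => by simp⟩ i = I.cost i (y.bundle i) := by
    intro i
    simp [fracCost, cost, Allocation.bundle, Finset.sum_filter]
  simpa only [this] using hy

theorem exists_isWEF1_isFPO (hn : 1 ≤ n) (I : Instance n m) :
    ∃ x : Allocation n m, I.IsWEF1 x ∧ I.IsFPO x := by
  classical
  have : NeZero n := ⟨by omega⟩
  obtain ⟨x₀, -, h⟩ := exists_envyFree I.costNN I.entNN
  obtain ⟨hef, w, hw, hx⟩ := h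
    (fun j => if hj : ∃ i, I.costNN i j = 0 then hj.choose else x₀ j)
    (fun j hj => by rw [dif_neg]; rintro ⟨i, hi⟩; exact (hj i).ne' hi)
    (fun j hj => by rw [dif_pos hj]; exact hj.choose_spec)
  exact ⟨_, I.isWEF1_of_envyFree hef, I.isFPO_of_tied hw hx⟩

end Instance

/-! ### The cycle test for efficiency -/

/-- The total of `a (x j) j - a (next) j` along a walk, where the list of chores is read backwards
from the agent `k` at which the walk ends. -/
def walkWeight (a : Fin n → M → ℝ) (x : M → Fin n) : List M → Fin n → ℝ
  | [], _ => 0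
  | j :: l, k => a (x j) j - a k j + walkWeight a x l (x j)

theorem walkWeight_append (a : Fin n → M → ℝ) (x : M → Fin n) (l l' : List M) (j : M) (k : Fin n) :
    walkWeight a x (l ++ j :: l') k = walkWeight a x (l ++ [j]) k + walkWeight a x l' (x j) := by
  induction l generalizing k with
  | nil => simp [walkWeight]
  | cons b l ih =>
    simp only [List.cons_append, walkWeight]
    rw [ih]
    ring

theorem walkWeight_replicate (a : Fin n → M → ℝ) (x : M → Fin n) (r : ℕ) (j : M) :
    walkWeight a x (List.replicate r j) (x j) = 0 := by
  induction r with
  | zero => rfl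
  | succ r ih => simp [List.replicate_succ, walkWeight, ih]

theorem walkWeight_ofFn (a : Fin n → M → ℝ) (x : M → Fin n) (p : ℕ) (J : Fin (p + 1) → M)
    (k : Fin n) : walkWeight a x (List.ofFn J) k =
      ∑ t, a (x (J t)) (J t) - a k (J 0) - ∑ t : Fin p, a (x (J t.castSucc)) (J t.succ) := by
  induction p generalizing k with
  | zero => simp [walkWeight]
  | succ p ih =>
    rw [List.ofFn_succ, walkWeight, ih, Fin.sum_univ_succ (n := p + 1),
      Fin.sum_univ_succ (n := p) (f := fun t => a (x (J t.castSucc)) (J t.succ))]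
    simp only [Fin.castSucc_zero, ← Fin.succ_castSucc]
    ring

/-- If no cycle of at most `n` chores can be rotated with a gain, measured by the product of the
costs, then `x` minimizes a weighted sum of the costs chore by chore. The weights come from longest
walks. A closed walk through fewer than `n` chores is covered by repeating its last chore. -/
theorem exists_weights_of_cycle_test {n : ℕ} [NeZero n] (c : Fin n → M → ℝ≥0)
    (hc : ∀ i j, 0 < c i j) (x : M → Fin n)
    (hcyc : ∀ J : Fin n → M, ∏ t, c (x (J t)) (J t) ≤ ∏ t, c (x (J t)) (J (t + 1))) :
    ∃ w : Fin n → ℝ≥0, (∀ i, 0 < w i) ∧ ∀ j, Tied c w (x j) j := by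
  obtain ⟨p, rfl⟩ := Nat.exists_eq_succ_of_ne_zero (NeZero.ne n)
  let a : Fin (p + 1) → M → ℝ := fun i j => Real.log (c i j)
  have hlist : ∀ (l : List M) (j : M), ((l ++ [j]).map x).Nodup →
      walkWeight a x (l ++ [j]) (x j) ≤ 0 := by
    intro l j hnd
    have hlen : l.length + 1 ≤ p + 1 := by
      have := hnd.length_le_card
      simpa using this
    let L := l ++ j :: List.replicate (p - l.length) j
    have hL : L.length = p + 1 := by simp [L]; omega
    have hLw : walkWeight a x L (x j) = walkWeight a x (l ++ [j]) (x j) := by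
      rw [walkWeight_append, walkWeight_replicate, add_zero]
    let J : Fin (p + 1) → M := fun t => L.get (t.cast hL.symm)
    have hJ : List.ofFn J = L := by
      apply List.ext_get
      · simp [hL]
      · intro t h1 h2
        simp only [J, List.get_ofFn]
        rfl
    have hlast : J (Fin.last p) = j := by
      simp only [J, List.get_eq_getElem, L, Fin.val_cast, Fin.val_last]
      rw [List.getElem_append_right (by omega), List.getElem_cons]
      split_ifs
      · rfl
      · simp
    have h := hcyc J
    have hpos : ∀ f g : Fin (p + 1) → Fin (p + 1) × M, ∏ t, c (f t).1 (f t).2 ≤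
        ∏ t, c (g t).1 (g t).2 → ∑ t, a (f t).1 (f t).2 ≤ ∑ t, a (g t).1 (g t).2 := by
      intro f g h
      simp only [a]
      rw [← Real.log_prod fun t _ => by exact_mod_cast (hc _ _).ne',
        ← Real.log_prod fun t _ => by exact_mod_cast (hc _ _).ne']
      refine Real.log_le_log (Finset.prod_pos fun t _ => by exact_mod_cast hc _ _) ?_
      exact_mod_cast h
    have h' := hpos (fun t => (x (J t), J t)) (fun t => (x (J t), J (t + 1))) h
    simp only at h'
    rw [Fin.sum_univ_castSucc (f := fun t => a (x (J t)) (J (t + 1)))] at h'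
    simp only [Fin.coeSucc_eq_succ, Fin.last_add_one] at h'
    rw [← hLw, ← hJ, walkWeight_ofFn, ← hlast]
    linarith
  have hfin : Finite {l : List M // (l.map x).Nodup} :=
    Finite.of_injective (β := {l : List M // l.Nodup}) (fun l => ⟨l.1, l.2.of_map⟩)
      fun l l' h => Subtype.ext (by simpa using h)
  have : Nonempty {l : List M // (l.map x).Nodup} := ⟨⟨[], by simp⟩⟩
  choose best hbest using fun k => Finite.exists_max
    fun l : {l : List M // (l.map x).Nodup} => walkWeight a x l.1 k
  let U : Fin (p + 1) → ℝ := fun k => walkWeight a x (best k).1 k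
  have hU : ∀ j k, U (x j) + a (x j) j ≤ U k + a k j := by
    intro j k
    obtain ⟨l, hl, hjl, hwl⟩ : ∃ l : List M, (l.map x).Nodup ∧ x j ∉ l.map x ∧
        U (x j) ≤ walkWeight a x l (x j) := by
      by_cases hj : x j ∈ (best (x j)).1.map x
      · obtain ⟨j', hj', hxj⟩ := List.mem_map.1 hj
        obtain ⟨l1, l2, hl⟩ := List.append_of_mem hj'
        have hnd := (best (x j)).2
        rw [hl] at hnd
        have hnd1 : ((l1 ++ [j']).map x).Nodup := by
          refine hnd.sublist (List.Sublist.map _ ?_)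
          exact List.Sublist.append_left (by simp) _
        have hnd2 : ((j' :: l2).map x).Nodup :=
          hnd.sublist (List.Sublist.map _ (List.sublist_append_right _ _))
        rw [List.map_cons, List.nodup_cons, hxj] at hnd2
        refine ⟨l2, hnd2.2, hnd2.1, ?_⟩
        have h1 := hlist l1 j' hnd1
        simp only [U]
        rw [hl, walkWeight_append]
        rw [hxj] at h1 ⊢
        linarith
      · exact ⟨(best (x j)).1, (best (x j)).2, hj, le_rfl⟩
    have h2 := hbest k ⟨j :: l, by rw [List.map_cons, List.nodup_cons]; exact ⟨hjl, hl⟩⟩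
    simp only [walkWeight] at h2
    simp only [U] at hwl ⊢
    linarith
  refine ⟨fun k => (Real.exp (U k)).toNNReal, fun k => Real.toNNReal_pos.2 (Real.exp_pos _),
    fun j k => ?_⟩
  rw [← NNReal.coe_le_coe]
  push_cast
  rw [Real.coe_toNNReal _ (Real.exp_pos _).le, Real.coe_toNNReal _ (Real.exp_pos _).le]
  have h := Real.exp_le_exp.2 (hU j k)
  rwa [Real.exp_add, Real.exp_add, Real.exp_log (by exact_mod_cast hc _ _),
    Real.exp_log (by exact_mod_cast hc _ _)] at h

/-- The cycle test, in the presence of chores that cost nothing to their owners. -/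
theorem exists_weights_of_cycle_test' [NeZero n] (c : Fin n → Fin m → ℝ≥0) (x : Fin m → Fin n)
    (hx0 : ∀ j, (∃ i, c i j = 0) → c (x j) j = 0)
    (hcyc : ∀ J : Fin n → Fin m, ∏ t, c (x (J t)) (J t) ≤ ∏ t, c (x (J t)) (J (t + 1))) :
    ∃ w : Fin n → ℝ≥0, (∀ i, 0 < w i) ∧ ∀ j, Tied c w (x j) j := by
  classical
  obtain ⟨w, hw, h⟩ := exists_weights_of_cycle_test
    (fun i (j : {j : Fin m // ∀ i, 0 < c i j}) => c i j) (fun i j => j.2 i) (fun j => x j)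
    (fun J => hcyc fun t => (J t).1)
  refine ⟨w, hw, fun j k => ?_⟩
  by_cases hj : ∀ i, 0 < c i j
  · exact h ⟨j, hj⟩ k
  · push Not at hj
    rw [hx0 j (hj.imp fun _ h => le_antisymm h zero_le), mul_zero]
    exact zero_le

theorem cycle_test_of_weights [NeZero n] (c : Fin n → Fin m → ℝ≥0) (x : Fin m → Fin n)
    {w : Fin n → ℝ≥0} (hw : ∀ i, 0 < w i) (hx : ∀ j, Tied c w (x j) j) (J : Fin n → Fin m) :
    ∏ t, c (x (J t)) (J t) ≤ ∏ t, c (x (J t)) (J (t + 1)) := by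
  have h := Finset.prod_le_prod' fun t (_ : t ∈ Finset.univ) => hx (J (t + 1)) (x (J t))
  have h1 := Equiv.prod_comp (Equiv.addRight (1 : Fin n)) fun t => w (x (J t))
  have h2 := Equiv.prod_comp (Equiv.addRight (1 : Fin n)) fun t => c (x (J t)) (J t)
  simp only [Equiv.coe_addRight] at h1 h2
  rw [Finset.prod_mul_distrib, Finset.prod_mul_distrib, h1, h2] at h
  exact le_of_mul_le_mul_left h (Finset.prod_pos fun t _ => hw _)

end Efficiency

/-! ### A term language that compiles to random access machines -/

namespace RAM

/-- The binary arithmetic operations of the machine. -/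
inductive BinOp
  | add
  | sub
  | mul
  | div

/-- The value of an arithmetic operation. -/
def BinOp.eval : BinOp → ℕ → ℕ → ℕ
  | .add, a, b => a + b
  | .sub, a, b => a - b
  | .mul, a, b => a * b
  | .div, a, b => a / b

/-- The machine instruction for an arithmetic operation. -/
def BinOp.op : BinOp → ℕ → ℕ → ℕ → Op
  | .add, r, a, b => .add r a b
  | .sub, r, a, b => .sub r a b
  | .mul, r, a, b => .mul r a b
  | .div, r, a, b => .div r a b

theorem BinOp.run_op (o : BinOp) (r a b : ℕ) (s : State) : (o.op r a b).run s =
    { s with reg := Function.update s.reg r (o.eval (s.reg a) (s.reg b)) } := by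
  cases o <;> rfl

theorem BinOp.cost_op (o : BinOp) (r a b : ℕ) (s : State) :
    (o.op r a b).cost s = 1 + (s.reg a).size + (s.reg b).size := by
  cases o <;> rfl

theorem size_le_self (a : ℕ) : a.size ≤ a := Nat.size_le.2 Nat.lt_two_pow_self

theorem size_mul_le (a b : ℕ) : (a * b).size ≤ a.size + b.size := by
  rw [Nat.size_le, pow_add]
  exact Nat.mul_lt_mul'' (Nat.lt_size_self a) (Nat.lt_size_self b)

theorem BinOp.size_eval_le (o : BinOp) (a b : ℕ) : (o.eval a b).size ≤ a.size + b.size + 1 := by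
  cases o
  · have ha := Nat.lt_size_self a
    have hb := Nat.lt_size_self b
    have h1 : 2 ^ a.size ≤ 2 ^ (a.size + b.size) := Nat.pow_le_pow_right (by norm_num) (by omega)
    have h2 : 2 ^ b.size ≤ 2 ^ (a.size + b.size) := Nat.pow_le_pow_right (by norm_num) (by omega)
    simp only [eval]
    rw [Nat.size_le, pow_succ]
    omega
  · exact (Nat.size_le_size (Nat.sub_le a b)).trans (by omega)
  · exact (size_mul_le a b).trans (by omega)
  · exact (Nat.size_le_size (Nat.div_le_self a b)).trans (by omega)

/-- Arithmetic terms over an input memory and variables. The term `fold o z v a c k e` starts from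
`z` and applies `o · e` once for each value of the variable `v` below `(a * m + c) ^ k`, where `m` is
the first entry of the input. As the number of rounds is polynomial in `m` by construction, all
terms are evaluated in polynomial time. -/
inductive Term
  | const (k : ℕ)
  | var (v : ℕ)
  | input (e : Term)
  | bin (o : BinOp) (e f : Term)
  | fold (o : BinOp) (z v a c k : ℕ) (e : Term)

/-- The value of a term for the input memory `d`. -/
def Term.eval (d : ℕ → ℕ) : Term → (ℕ → ℕ) → ℕ
  | .const k, _ => k
  | .var v, ρ => ρ v
  | .input e, ρ => d (e.eval d ρ)
  | .bin o e f, ρ => o.eval (e.eval d ρ) (f.eval d ρ)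
  | .fold o z v a c k e, ρ => Nat.rec z (fun i y => o.eval y (e.eval d (Function.update ρ v i)))
      ((a * d 0 + c) ^ k)

/-- The program that executes a list of instructions before `P`. -/
def Prog.after : List Op → Prog → Prog
  | [], P => P
  | o :: l, P => .seq (.op o) (Prog.after l P)

/-- The effect of a list of instructions. -/
def runOps : List Op → State → State
  | [], s => s
  | o :: l, s => runOps l (o.run s)

/-- The cost of a list of instructions. -/
def costOps : List Op → State → ℕ
  | [], _ => 0
  | o :: l, s => o.cost s + costOps l (o.run s)

theorem Exec.after {P : Prog} {s' : State} {t : ℕ} (l : List Op) {s : State}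
    (h : Exec P (runOps l s) s' t) : Exec (Prog.after l P) s s' (costOps l s + t) := by
  induction l generalizing s with
  | nil => simpa [Prog.after, costOps, runOps] using h
  | cons o l ih => simpa [Prog.after, costOps, add_assoc] using Exec.seq (Exec.op o s) (ih h)

theorem runOps_append (l l' : List Op) (s : State) :
    runOps (l ++ l') s = runOps l' (runOps l s) := by
  induction l generalizing s with
  | nil => rfl
  | cons o l ih => exact ih _

theorem costOps_append (l l' : List Op) (s : State) :
    costOps (l ++ l') s = costOps l s + costOps l' (runOps l s) := by
  induction l generalizing s with
  | nil => simp [costOps, runOps]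
  | cons o l ih => simp [costOps, runOps, ih, add_assoc]

/-- Variable `v` lives in register `2 * v`; the odd registers are temporary. The program leaves the
value in register `2 * t + 1` and uses temporary registers from there on only. A fold saves the
outer value of its variable in register `2 * t + 3` and counts down in register `2 * t + 5`. -/
def Term.compile : Term → ℕ → Prog
  | .const k, t => .op (.const (2 * t + 1) k)
  | .var v, t => Prog.after [.const (2 * t + 1) 0] (.op (.add (2 * t + 1) (2 * v) (2 * t + 1)))
  | .input e, t => .seq (e.compile t) (.op (.load (2 * t + 1) (2 * t + 1)))
  | .bin o e f, t => .seq (e.compile t) (.seq (f.compile (t + 1))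
      (.op (o.op (2 * t + 1) (2 * t + 1) (2 * t + 3))))
  | .fold o z v a c k e, t =>
      Prog.after ([.const (2 * t + 7) 0, .load (2 * t + 7) (2 * t + 7), .const (2 * t + 5) a,
          .mul (2 * t + 7) (2 * t + 7) (2 * t + 5), .const (2 * t + 5) c,
          .add (2 * t + 7) (2 * t + 7) (2 * t + 5), .const (2 * t + 5) 1] ++
          (List.replicate k (.mul (2 * t + 5) (2 * t + 5) (2 * t + 7)) ++
        [.const (2 * t + 3) 0, .add (2 * t + 3) (2 * v) (2 * t + 3), .const (2 * v) 0,
          .const (2 * t + 1) z]))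
        (.seq (.loop (2 * t + 5) (.seq (e.compile (t + 3))
          (Prog.after [o.op (2 * t + 1) (2 * t + 1) (2 * t + 7), .const (2 * t + 7) 1,
            .add (2 * v) (2 * v) (2 * t + 7)] (.op (.sub (2 * t + 5) (2 * t + 5) (2 * t + 7))))))
        (Prog.after [.const (2 * t + 7) 0] (.op (.add (2 * v) (2 * t + 3) (2 * t + 7)))))

/-- A bound for the running time and for the binary length of the value of a term, if all entries of
the memory and all variables have binary length at most `B` and the first entry is at most `B`. -/
def Term.bound : Term → ℕ → ℕ
  | .const k, _ => 1 + k.size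
  | .var _, B => B + 2
  | .input e, B => e.bound B + (1 + e.bound B + B)
  | .bin _ e f, B => e.bound B + (f.bound B + (1 + e.bound B + f.bound B))
  | .fold _ z _ a c k e, B =>
      let N := (a * B + c + 1) ^ k
      let b := e.bound (B + N)
      (12 + 4 * B + 3 * a.size + 2 * c.size + k * (1 + N + (a * B + c)) + z.size) +
        (N * (9 + 2 * b + 3 * N + z.size + N * (b + 1)) + 1 + (B + 2))

/-- A function is polynomial if it is the evaluation of a polynomial. -/
def IsPoly (f : ℕ → ℕ) : Prop := ∃ p : Polynomial ℕ, ∀ x, f x = p.eval x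

theorem IsPoly.const (k : ℕ) : IsPoly fun _ => k := ⟨Polynomial.C k, fun x => by simp⟩

theorem IsPoly.id : IsPoly fun x => x := ⟨Polynomial.X, fun x => by simp⟩

theorem IsPoly.add {f g : ℕ → ℕ} (hf : IsPoly f) (hg : IsPoly g) : IsPoly fun x => f x + g x := by
  obtain ⟨p, hp⟩ := hf
  obtain ⟨q, hq⟩ := hg
  exact ⟨p + q, fun x => by simp [hp, hq]⟩

theorem IsPoly.mul {f g : ℕ → ℕ} (hf : IsPoly f) (hg : IsPoly g) : IsPoly fun x => f x * g x := by
  obtain ⟨p, hp⟩ := hf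
  obtain ⟨q, hq⟩ := hg
  exact ⟨p * q, fun x => by simp [hp, hq]⟩

theorem IsPoly.pow {f : ℕ → ℕ} (hf : IsPoly f) (k : ℕ) : IsPoly fun x => f x ^ k := by
  obtain ⟨p, hp⟩ := hf
  exact ⟨p ^ k, fun x => by simp [hp]⟩

theorem IsPoly.comp {f g : ℕ → ℕ} (hf : IsPoly f) (hg : IsPoly g) : IsPoly fun x => f (g x) := by
  obtain ⟨p, hp⟩ := hf
  obtain ⟨q, hq⟩ := hg
  exact ⟨p.comp q, fun x => by simp [hp, hq]⟩

theorem Term.isPoly_bound (e : Term) : IsPoly e.bound := by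
  induction e with
  | const k => exact .const _
  | var v => exact .add .id (.const _)
  | input e ih => exact .add ih (.add (.add (.const _) ih) .id)
  | bin o e f ihe ihf => exact .add ihe (.add ihf (.add (.add (.const _) ihe) ihf))
  | fold o z v a c k e ih =>
    have hX : IsPoly fun B => a * B + c := .add (.mul (.const _) .id) (.const _)
    have hN : IsPoly fun B => (a * B + c + 1) ^ k := .pow (.add hX (.const _)) k
    have hb : IsPoly fun B => e.bound (B + (a * B + c + 1) ^ k) := .comp ih (.add .id hN)
    have h1 : IsPoly fun B => 12 + 4 * B + 3 * a.size + 2 * c.size +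
        k * (1 + (a * B + c + 1) ^ k + (a * B + c)) + z.size :=
      .add (.add (.add (.add (.add (.const _) (.mul (.const _) .id)) (.const _)) (.const _))
        (.mul (.const _) (.add (.add (.const _) hN) hX))) (.const _)
    have h2 : IsPoly fun B => 9 + 2 * e.bound (B + (a * B + c + 1) ^ k) +
        3 * (a * B + c + 1) ^ k + z.size + (a * B + c + 1) ^ k *
          (e.bound (B + (a * B + c + 1) ^ k) + 1) :=
      .add (.add (.add (.add (.const _) (.mul (.const _) hb)) (.mul (.const _) hN)) (.const _))
        (.mul hN (.add hb (.const _)))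
    exact .add h1 (.add (.add (.mul hN h2) (.const _)) (.add .id (.const _)))

/-- The specification of the compiled program of a term. -/
def Term.Correct (e : Term) (d : ℕ → ℕ) (B t : ℕ) : Prop :=
  ∀ s : State, s.mem = d → (∀ v, (s.reg (2 * v)).size ≤ B) →
    (e.eval d fun v => s.reg (2 * v)).size ≤ e.bound B ∧
    ∃ (s' : State) (τ : ℕ), Exec (e.compile t) s s' τ ∧ τ ≤ e.bound B ∧ s'.mem = d ∧
      s'.reg (2 * t + 1) = e.eval d (fun v => s.reg (2 * v)) ∧
      ∀ r, (r % 2 = 0 ∨ r < 2 * t + 1) → s'.reg r = s.reg r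

theorem runOps_replicate_mul (r x k : ℕ) (hrx : x ≠ r) (s : State) :
    (runOps (List.replicate k (.mul r r x)) s).mem = s.mem ∧
    (runOps (List.replicate k (.mul r r x)) s).reg r = s.reg r * s.reg x ^ k ∧
    ∀ q, q ≠ r → (runOps (List.replicate k (.mul r r x)) s).reg q = s.reg q := by
  induction k generalizing s with
  | zero => simp [runOps]
  | succ k ih =>
    obtain ⟨h1, h2, h3⟩ := ih ((Op.mul r r x).run s)
    refine ⟨h1, ?_, fun q hq => ?_⟩
    · rw [List.replicate_succ, runOps, h2]
      simp [Op.run, hrx, pow_succ']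
      ring
    · rw [List.replicate_succ, runOps, h3 q hq]
      simp [Op.run, hq]

theorem costOps_replicate_mul (r x k N : ℕ) (hrx : x ≠ r) (s : State)
    (hN : ∀ i < k, s.reg r * s.reg x ^ i ≤ N) :
    costOps (List.replicate k (.mul r r x)) s ≤ k * (1 + N + s.reg x) := by
  induction k generalizing s with
  | zero => simp [costOps]
  | succ k ih =>
    have h1 := ih ((Op.mul r r x).run s) (fun i hi => by
      have := hN (i + 1) (by omega)
      simp only [Op.run, Function.update_self, Function.update_of_ne hrx]
      rwa [mul_assoc, ← pow_succ'])
    have h2 := hN 0 (by omega)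
    have h3 := size_le_self (s.reg r)
    have h4 := size_le_self (s.reg x)
    rw [List.replicate_succ, costOps]
    simp only [Op.run, Function.update_of_ne hrx] at h1
    simp only [Op.cost, Op.run]
    simp only [pow_zero, mul_one] at h2
    rw [add_mul]
    omega

end RAM

/-! ### Correctness and running time of compiled terms -/

namespace RAM

/-- The loop of a compiled fold, when `r` of its `L` rounds are left. The value grows by at most
`e.bound B + 1` bits per round, which keeps the time polynomial even for products. -/
theorem exec_fold_loop (e : Term) (o : BinOp) (t v z L : ℕ) {d : ℕ → ℕ} {B : ℕ}
    (he : e.Correct d B (t + 3)) (ρ : ℕ → ℕ) (hρ : ∀ u, (ρ u).size ≤ B) (hL : L ≤ B) (F : ℕ → ℕ)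
    (hF : ∀ i, F (i + 1) = o.eval (F i) (e.eval d (Function.update ρ v i))) (r : ℕ) (hr : r ≤ L)
    (s : State) (hmem : s.mem = d) (hR : s.reg (2 * t + 5) = r) (hV : s.reg (2 * v) = L - r)
    (hT : s.reg (2 * t + 1) = F (L - r)) (henv : ∀ u, u ≠ v → s.reg (2 * u) = ρ u)
    (hsize : (F (L - r)).size ≤ z.size + (L - r) * (e.bound B + 1)) :
    ∃ (s' : State) (τ : ℕ), Exec (.loop (2 * t + 5) (.seq (e.compile (t + 3))
          (Prog.after [o.op (2 * t + 1) (2 * t + 1) (2 * t + 7), .const (2 * t + 7) 1,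
            .add (2 * v) (2 * v) (2 * t + 7)] (.op (.sub (2 * t + 5) (2 * t + 5) (2 * t + 7))))))
          s s' τ ∧
      τ ≤ r * (9 + 2 * e.bound B + 3 * L + z.size + L * (e.bound B + 1)) + 1 ∧ s'.mem = d ∧
      s'.reg (2 * t + 1) = F L ∧ (F L).size ≤ z.size + L * (e.bound B + 1) ∧
      ∀ q, q ≠ 2 * v → (q % 2 = 0 ∨ q < 2 * t + 1 ∨ q = 2 * t + 3) → s'.reg q = s.reg q := by
  induction r generalizing s with
  | zero =>
    refine ⟨s, _, Exec.loop_done hR, ?_, hmem, by simpa using hT, by simpa using hsize,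
      fun _ _ _ => rfl⟩
    rw [hR]; simp
  | succ r ih =>
    have henv' : (fun u => s.reg (2 * u)) = Function.update ρ v (L - (r + 1)) := by
      funext u
      by_cases hu : u = v
      · subst hu; rw [hV, Function.update_self]
      · rw [henv u hu, Function.update_of_ne hu]
    obtain ⟨hb, s1, τ1, hex1, hτ1, hmem1, hX1, hreg1⟩ := he s hmem (fun u => by
      have h : s.reg (2 * u) = _ := congrFun henv' u
      rw [h]
      by_cases hu : u = v
      · subst hu
        rw [Function.update_self]
        exact (size_le_self _).trans (by omega)
      · rw [Function.update_of_ne hu]; exact hρ u)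
    rw [henv'] at hb hX1
    have hX1' : s1.reg (2 * t + 7) = e.eval d (Function.update ρ v (L - (r + 1))) := hX1
    have hT1 : s1.reg (2 * t + 1) = F (L - (r + 1)) := by rw [hreg1 _ (Or.inr (by omega)), hT]
    have hR1 : s1.reg (2 * t + 5) = r + 1 := by rw [hreg1 _ (Or.inr (by omega)), hR]
    have hV1 : s1.reg (2 * v) = L - (r + 1) := by rw [hreg1 _ (Or.inl (by omega)), hV]
    have hFs := hF (L - (r + 1))
    have hLr : L - (r + 1) + 1 = L - r := by omega
    rw [hLr] at hFs
    have hne1 : 2 * v ≠ 2 * t + 1 := by omega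
    have hne5 : 2 * v ≠ 2 * t + 5 := by omega
    have hne7 : 2 * v ≠ 2 * t + 7 := by omega
    let l : List Op := [o.op (2 * t + 1) (2 * t + 1) (2 * t + 7), .const (2 * t + 7) 1,
      .add (2 * v) (2 * v) (2 * t + 7)]
    let s2 : State := (Op.sub (2 * t + 5) (2 * t + 5) (2 * t + 7)).run (runOps l s1)
    have hs2 : s2 = ⟨Function.update (Function.update (Function.update
        (Function.update s1.reg (2 * t + 1) (F (L - r))) (2 * t + 7) 1) (2 * v) (L - r))
        (2 * t + 5) r, s1.mem⟩ := by
      simp only [s2, l, runOps, BinOp.run_op, hX1', hT1, ← hFs]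
      simp only [Op.run]
      congr 1
      simp [hne7.symm, hne5.symm, hne7, hne1, hR1, hV1, hLr]
    have hex2 : Exec (Prog.after l (.op (.sub (2 * t + 5) (2 * t + 5) (2 * t + 7)))) s1 s2 _ :=
      Exec.after l (Exec.op _ _)
    have hcost : costOps l s1 + (Op.sub (2 * t + 5) (2 * t + 5) (2 * t + 7)).cost (runOps l s1) ≤
        8 + z.size + L * (e.bound B + 1) + e.bound B + 2 * L := by
      have h1 : (F (L - (r + 1))).size ≤ z.size + L * (e.bound B + 1) :=
        hsize.trans (Nat.add_le_add_left (Nat.mul_le_mul_right _ (by omega)) _)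
      have h2 := size_le_self (L - (r + 1))
      have h3 := size_le_self (r + 1)
      have h4 : Nat.size 1 = 1 := rfl
      simp only [l, runOps, costOps, BinOp.run_op, BinOp.cost_op, hX1', hT1]
      simp only [Op.run, Op.cost]
      simp [hne7.symm, hne5.symm, hne7, hne1, hR1, hV1]
      omega
    obtain ⟨s', τ2, hex3, hτ2, hmem', hT', hsz', hreg'⟩ := ih (by omega) s2
      (by rw [hs2]; exact hmem1) (by rw [hs2]; simp)
      (by rw [hs2]; simp [hne5])
      (by rw [hs2]; simp [hne1.symm])
      (fun u hu => by
        have h1 : 2 * u ≠ 2 * t + 5 := by omega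
        have h2 : 2 * u ≠ 2 * v := by omega
        have h3 : 2 * u ≠ 2 * t + 7 := by omega
        have h4 : 2 * u ≠ 2 * t + 1 := by omega
        rw [hs2]
        simp only [Function.update_of_ne h1, Function.update_of_ne h2, Function.update_of_ne h3,
          Function.update_of_ne h4]
        rw [hreg1 _ (Or.inl (by omega)), henv u hu])
      (by
        rw [hFs]
        refine (o.size_eval_le _ _).trans ?_
        have : L - r = (L - (r + 1)) + 1 := hLr.symm
        rw [this, add_mul]
        omega)
    refine ⟨s', _, Exec.loop_step (by omega) (Exec.seq hex1 hex2) hex3, ?_, hmem', hT', hsz',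
      fun q hq hq' => ?_⟩
    · have h3 := size_le_self (r + 1)
      rw [hR, add_mul]
      omega
    · have h1 : q ≠ 2 * t + 5 := by omega
      have h3 : q ≠ 2 * t + 7 := by omega
      rw [hreg' q hq hq', hs2]
      by_cases h4 : q = 2 * t + 1
      · omega
      · simp only [Function.update_of_ne h1, Function.update_of_ne hq, Function.update_of_ne h3,
          Function.update_of_ne h4]
        exact hreg1 q (by omega)

/-- Compiled terms compute their values within the time bound. -/
theorem Term.correct (e : Term) {d : ℕ → ℕ} {B : ℕ} (hd : ∀ k, (d k).size ≤ B) (hd0 : d 0 ≤ B)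
    (t : ℕ) : e.Correct d B t := by
  induction e generalizing B t with
  | const k =>
    intro s hmem henv
    refine ⟨by simp [eval, bound], _, _, Exec.op _ s, ?_, hmem, ?_, fun r hr => ?_⟩
    · simp [Op.cost, bound]
    · simp [Op.run, eval]
    · simp [Op.run, show r ≠ 2 * t + 1 by omega]
  | var v =>
    intro s hmem henv
    have hne : 2 * v ≠ 2 * t + 1 := by omega
    refine ⟨(henv v).trans (by simp [bound]), _, _, Exec.after _ (Exec.op _ _), ?_, hmem, ?_,
      fun r hr => ?_⟩
    · have := henv v
      simp [costOps, runOps, Op.cost, Op.run, bound, hne]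
      omega
    · simp [Op.run, runOps, eval, hne]
    · simp [Op.run, runOps, show r ≠ 2 * t + 1 by omega]
  | input e ih =>
    intro s hmem henv
    obtain ⟨hb, s1, τ1, hex1, hτ1, hmem1, hval1, hreg1⟩ := ih hd hd0 t s hmem henv
    have hdb := hd (e.eval d fun v => s.reg (2 * v))
    refine ⟨hdb.trans (by simp only [bound]; omega), _, _,
      Exec.seq hex1 (Exec.op _ _), ?_, hmem1, ?_, fun r hr => ?_⟩
    · simp only [Op.cost, bound, hval1, hmem1]; omega
    · simp [Op.run, eval, hval1, hmem1]
    · simp only [Op.run, Function.update_of_ne (show r ≠ 2 * t + 1 by omega)]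
      exact hreg1 r hr
  | bin o e f ihe ihf =>
    intro s hmem henv
    obtain ⟨hb, s1, τ1, hex1, hτ1, hmem1, hval1, hreg1⟩ := ihe hd hd0 t s hmem henv
    have henv1 : (fun v => s1.reg (2 * v)) = fun v => s.reg (2 * v) :=
      funext fun v => hreg1 _ (Or.inl (by omega))
    obtain ⟨hb', s2, τ2, hex2, hτ2, hmem2, hval2, hreg2⟩ := ihf hd hd0 (t + 1) s1 hmem1
      fun v => by
        have h : s1.reg (2 * v) = _ := congrFun henv1 v
        rw [h]; exact henv v
    rw [henv1] at hb' hval2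
    have hval1' : s2.reg (2 * t + 1) = e.eval d fun v => s.reg (2 * v) := by
      rw [hreg2 _ (Or.inr (by omega)), hval1]
    have hval2' : s2.reg (2 * t + 3) = f.eval d fun v => s.reg (2 * v) := hval2
    refine ⟨(o.size_eval_le _ _).trans (by simp only [bound]; omega), _, _,
      Exec.seq hex1 (Exec.seq hex2 (Exec.op _ _)), ?_, ?_, ?_, fun r hr => ?_⟩
    · simp only [BinOp.cost_op, bound, hval1', hval2']; omega
    · simpa [BinOp.run_op] using hmem2
    · simp [BinOp.run_op, eval, hval1', hval2']
    · simp only [BinOp.run_op, Function.update_of_ne (show r ≠ 2 * t + 1 by omega)]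
      rw [hreg2 r (by omega), hreg1 r hr]
  | fold o z v a c k e ih =>
    intro s hmem henv
    set L : ℕ := (a * d 0 + c) ^ k with hLdef
    set N : ℕ := (a * B + c + 1) ^ k with hN
    have hmul : a * d 0 ≤ a * B := Nat.mul_le_mul_left a hd0
    have hLN : L ≤ N := Nat.pow_le_pow_left (by omega) k
    have hN1 : 1 ≤ N := Nat.one_le_pow _ _ (by omega)
    have hpow : ∀ i < k, 1 * (a * d 0 + c) ^ i ≤ N := fun i hi => by
      rw [one_mul]
      exact (Nat.pow_le_pow_left (by omega) i).trans (Nat.pow_le_pow_right (by omega) hi.le)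
    have he : e.Correct d (B + N) (t + 3) :=
      ih (fun k => (hd k).trans (by omega)) (by omega) (t + 3)
    have hne1 : 2 * v ≠ 2 * t + 1 := by omega
    have hne3 : 2 * v ≠ 2 * t + 3 := by omega
    have hne5 : 2 * v ≠ 2 * t + 5 := by omega
    have hne7 : 2 * v ≠ 2 * t + 7 := by omega
    -- the three blocks of instructions before the loop
    let l1 : List Op := [.const (2 * t + 7) 0, .load (2 * t + 7) (2 * t + 7), .const (2 * t + 5) a,
      .mul (2 * t + 7) (2 * t + 7) (2 * t + 5), .const (2 * t + 5) c,
      .add (2 * t + 7) (2 * t + 7) (2 * t + 5), .const (2 * t + 5) 1]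
    let l2 : List Op := List.replicate k (.mul (2 * t + 5) (2 * t + 5) (2 * t + 7))
    let l3 : List Op := [.const (2 * t + 3) 0, .add (2 * t + 3) (2 * v) (2 * t + 3),
      .const (2 * v) 0, .const (2 * t + 1) z]
    let s1 := runOps l1 s
    have hs1 : s1.mem = d ∧ s1.reg (2 * t + 7) = a * d 0 + c ∧ s1.reg (2 * t + 5) = 1 ∧
        ∀ q, q ≠ 2 * t + 5 → q ≠ 2 * t + 7 → s1.reg q = s.reg q := by
      refine ⟨hmem, ?_, ?_, fun q h5 h7 => ?_⟩
      · simp [s1, l1, runOps, Op.run, hmem, mul_comm]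
      · simp [s1, l1, runOps, Op.run]
      · simp [s1, l1, runOps, Op.run, h5, h7]
    have hc1 : costOps l1 s ≤ 8 + 3 * B + 3 * a.size + 2 * c.size := by
      have h1 := hd 0
      have h2 := size_mul_le (d 0) a
      have h4 : Nat.size 1 = 1 := rfl
      simp [l1, costOps, Op.run, Op.cost, hmem]
      omega
    obtain ⟨hs2m, hs2R, hs2q⟩ := runOps_replicate_mul (2 * t + 5) (2 * t + 7) k (by omega) s1
    have hc2 := costOps_replicate_mul (2 * t + 5) (2 * t + 7) k N (by omega) s1
      (by rw [hs1.2.1, hs1.2.2.1]; exact hpow)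
    rw [hs1.2.1] at hs2R hc2
    change costOps l2 s1 ≤ _ at hc2
    rw [hs1.2.2.1, one_mul] at hs2R
    let s2 := runOps l2 s1
    let s3 := runOps l3 s2
    have hs2v : ∀ u, s2.reg (2 * u) = s.reg (2 * u) := fun u => by
      have h5 : 2 * u ≠ 2 * t + 5 := by omega
      have h7 : 2 * u ≠ 2 * t + 7 := by omega
      exact (hs2q _ h5).trans (hs1.2.2.2 _ h5 h7)
    have hc3 : costOps l3 s2 ≤ 4 + B + z.size := by
      have h1 := hs2v v
      have h2 := henv v
      simp [l3, costOps, Op.run, Op.cost, hne3, h1]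
      omega
    have hs3 : s3.mem = d ∧ s3.reg (2 * t + 5) = L ∧ s3.reg (2 * v) = 0 ∧
        s3.reg (2 * t + 1) = z ∧ s3.reg (2 * t + 3) = s.reg (2 * v) ∧
        ∀ q, q ≠ 2 * v → (q % 2 = 0 ∨ q < 2 * t + 1) → s3.reg q = s.reg q := by
      refine ⟨hs2m.trans hs1.1, ?_, ?_, ?_, ?_, fun q hq hq' => ?_⟩
      · have : s3.reg (2 * t + 5) = s2.reg (2 * t + 5) := by
          simp [s3, l3, runOps, Op.run, hne5.symm]
        rw [this]; exact hs2R
      · simp [s3, l3, runOps, Op.run, hne1]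
      · simp [s3, l3, runOps, Op.run]
      · simp [s3, l3, runOps, Op.run, hne3.symm, hne3, hs2v]
      · have h1 : q ≠ 2 * t + 1 := by omega
        have h3 : q ≠ 2 * t + 3 := by omega
        have h5 : q ≠ 2 * t + 5 := by omega
        have h7 : q ≠ 2 * t + 7 := by omega
        have : s3.reg q = s2.reg q := by simp [s3, l3, runOps, Op.run, h1, h3, hq]
        rw [this]
        exact (hs2q _ h5).trans (hs1.2.2.2 _ h5 h7)
    let ρ : ℕ → ℕ := fun u => s.reg (2 * u)
    let F : ℕ → ℕ := fun n => Nat.rec z (fun i y => o.eval y (e.eval d (Function.update ρ v i))) n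
    obtain ⟨s4, τ4, hex4, hτ4, hmem4, hT4, hsz4, hreg4⟩ := exec_fold_loop e o t v z L he ρ
      (fun u => (henv u).trans (by omega)) (by omega) F (fun i => rfl) L le_rfl s3 hs3.1
      hs3.2.1 (by rw [hs3.2.2.1]; omega) (by rw [hs3.2.2.2.1, Nat.sub_self]; rfl)
      (fun u hu => hs3.2.2.2.2.2 _ (by omega) (Or.inl (by omega)))
      (by simp [F])
    have hS4 : s4.reg (2 * t + 3) = s.reg (2 * v) := by
      rw [hreg4 _ hne3.symm (Or.inr (Or.inr rfl)), hs3.2.2.2.2.1]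
    have hpost : Exec (Prog.after [.const (2 * t + 7) 0]
        (.op (.add (2 * v) (2 * t + 3) (2 * t + 7)))) s4 _ _ := Exec.after _ (Exec.op _ _)
    have hpre : runOps (l1 ++ (l2 ++ l3)) s = s3 := by rw [runOps_append, runOps_append]
    have hcpre : costOps (l1 ++ (l2 ++ l3)) s =
        costOps l1 s + (costOps l2 s1 + costOps l3 s2) := by
      rw [costOps_append, costOps_append]
    have hmono : L * (e.bound (B + N) + 1) ≤ N * (e.bound (B + N) + 1) :=
      Nat.mul_le_mul_right _ hLN
    have hloop : L * (9 + 2 * e.bound (B + N) + 3 * L + z.size + L * (e.bound (B + N) + 1)) ≤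
        N * (9 + 2 * e.bound (B + N) + 3 * N + z.size + N * (e.bound (B + N) + 1)) :=
      Nat.mul_le_mul hLN (by omega)
    refine ⟨?_, _, _, Exec.after (l1 ++ (l2 ++ l3)) (by
      rw [hpre]; exact Exec.seq hex4 hpost), ?_, ?_, ?_, fun r hr => ?_⟩
    · refine hsz4.trans ?_
      have h1 : N * (e.bound (B + N) + 1) ≤
          N * (9 + 2 * e.bound (B + N) + 3 * N + z.size + N * (e.bound (B + N) + 1)) :=
        Nat.mul_le_mul_left _ (by omega)
      simp only [bound, ← hN]
      omega
    · have hk : k * (1 + N + (a * d 0 + c)) ≤ k * (1 + N + (a * B + c)) :=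
        Nat.mul_le_mul_left _ (by omega)
      have hv := henv v
      have hpc : costOps [.const (2 * t + 7) 0] s4 +
          (Op.add (2 * v) (2 * t + 3) (2 * t + 7)).cost (runOps [.const (2 * t + 7) 0] s4) ≤
          B + 2 := by
        simp [costOps, runOps, Op.cost, Op.run, hS4]
        omega
      rw [hcpre]
      simp only [bound, ← hN]
      omega
    · exact hmem4
    · simp only [runOps, Op.run, Function.update_of_ne hne1.symm,
        Function.update_of_ne (show 2 * t + 1 ≠ 2 * t + 7 by omega), hT4]
      rfl
    · by_cases hrv : r = 2 * v
      · subst hrv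
        simp [runOps, Op.run, hS4]
      · simp only [runOps, Op.run, Function.update_of_ne hrv,
          Function.update_of_ne (show r ≠ 2 * t + 7 by omega)]
        rw [hreg4 r hrv (by omega), hs3.2.2.2.2.2 r hrv hr]

end RAM

/-! ### Functions and predicates that terms express -/

namespace RAM

/-- A context in which terms are evaluated: each `γ : Γ` provides an input and the values of the
variables below `depth`. -/
structure Ctx (Γ : Type) where
  depth : ℕ
  env : Γ → ℕ → ℕ
  inp : Γ → ℕ → ℕ

/-- The context with one more variable, whose value is the second component. -/
@[reducible] def Ctx.ext {Γ : Type} (C : Ctx Γ) : Ctx (Γ × ℕ) where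
  depth := C.depth + 1
  env p := Function.update (C.env p.1) C.depth p.2
  inp p := C.inp p.1

/-- The function `f` is the value of some term in the context `C`, whatever the values of the
variables that `C` leaves free. -/
def Expressible {Γ : Type} (C : Ctx Γ) (f : Γ → ℕ) : Prop :=
  ∃ e : Term, ∀ γ ρ, (∀ v < C.depth, ρ v = C.env γ v) → e.eval (C.inp γ) ρ = f γ

open Classical in
/-- The indicator function of the predicate `P` is expressible. -/
def Decides {Γ : Type} (C : Ctx Γ) (P : Γ → Prop) : Prop :=
  Expressible C fun γ => if P γ then 1 else 0

/-- The possible numbers of rounds of a fold. -/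
def IsLimit {Γ : Type} (C : Ctx Γ) (L : Γ → ℕ) : Prop :=
  ∃ a c k, ∀ γ, L γ = (a * C.inp γ 0 + c) ^ k

section Closure

variable {Γ : Type} {C : Ctx Γ} {f g h L : Γ → ℕ} {P Q : Γ → Prop}

theorem IsLimit.const (k : ℕ) : IsLimit C fun _ => k := ⟨0, k, 1, fun γ => by simp⟩

theorem IsLimit.length : IsLimit C fun γ => C.inp γ 0 := ⟨1, 0, 1, fun γ => by simp⟩

theorem IsLimit.length_pow (k : ℕ) : IsLimit C fun γ => C.inp γ 0 ^ k :=
  ⟨1, 0, k, fun γ => by simp⟩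

theorem IsLimit.succ_length_pow (k : ℕ) : IsLimit C fun γ => (C.inp γ 0 + 1) ^ k :=
  ⟨1, 1, k, fun γ => by simp⟩

theorem IsLimit.weaken (hL : IsLimit C L) : IsLimit C.ext fun p => L p.1 := by
  obtain ⟨a, c, k, h⟩ := hL
  exact ⟨a, c, k, fun p => h p.1⟩

theorem Expressible.const (k : ℕ) : Expressible C fun _ => k := ⟨.const k, fun _ _ _ => rfl⟩

theorem Expressible.last : Expressible C.ext fun p => p.2 :=
  ⟨.var C.depth, fun p ρ hρ => by
    rw [Term.eval, hρ _ (Nat.lt_succ_self _)]; simp⟩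

theorem Expressible.weaken (hf : Expressible C f) : Expressible C.ext fun p => f p.1 := by
  obtain ⟨e, he⟩ := hf
  refine ⟨e, fun p ρ hρ => he p.1 ρ fun v hv => ?_⟩
  rw [hρ v (Nat.lt_succ_of_lt hv)]
  exact Function.update_of_ne hv.ne _ _

theorem Expressible.input (hf : Expressible C f) : Expressible C fun γ => C.inp γ (f γ) := by
  obtain ⟨e, he⟩ := hf
  exact ⟨.input e, fun γ ρ hρ => by rw [Term.eval, he γ ρ hρ]⟩

theorem Expressible.bin (o : BinOp) (hf : Expressible C f) (hg : Expressible C g) :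
    Expressible C fun γ => o.eval (f γ) (g γ) := by
  obtain ⟨e, he⟩ := hf
  obtain ⟨e', he'⟩ := hg
  exact ⟨.bin o e e', fun γ ρ hρ => by rw [Term.eval, he γ ρ hρ, he' γ ρ hρ]⟩

theorem Expressible.add (hf : Expressible C f) (hg : Expressible C g) :
    Expressible C fun γ => f γ + g γ := .bin .add hf hg

theorem Expressible.sub (hf : Expressible C f) (hg : Expressible C g) :
    Expressible C fun γ => f γ - g γ := .bin .sub hf hg

theorem Expressible.mul (hf : Expressible C f) (hg : Expressible C g) :
    Expressible C fun γ => f γ * g γ := .bin .mul hf hg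

theorem Expressible.div (hf : Expressible C f) (hg : Expressible C g) :
    Expressible C fun γ => f γ / g γ := .bin .div hf hg

theorem Expressible.congr (hf : Expressible C f) (hfg : ∀ γ, g γ = f γ) : Expressible C g := by
  rwa [show g = f from funext hfg]

theorem Expressible.mod (hf : Expressible C f) (hg : Expressible C g) :
    Expressible C fun γ => f γ % g γ :=
  (hf.sub (hg.mul (hf.div hg))).congr fun _ => Nat.mod_def _ _

theorem Expressible.fold (o : BinOp) (z : ℕ) {F : Γ → ℕ → ℕ} (hL : IsLimit C L)
    (hF : Expressible C.ext fun p => F p.1 p.2) :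
    Expressible C fun γ => Nat.rec z (fun i y => o.eval y (F γ i)) (L γ) := by
  obtain ⟨a, c, k, hk⟩ := hL
  obtain ⟨e, he⟩ := hF
  refine ⟨.fold o z C.depth a c k e, fun γ ρ hρ => ?_⟩
  have h : ∀ i, e.eval (C.inp γ) (Function.update ρ C.depth i) = F γ i := fun i =>
    he (γ, i) _ fun v hv => by
      rcases (Nat.lt_succ_iff_lt_or_eq.1 hv) with hv | rfl
      · simp [Function.update_of_ne hv.ne, hρ v hv]
      · simp
  simp only [Term.eval, h, hk]

theorem Expressible.sum {F : Γ → ℕ → ℕ} (hL : IsLimit C L)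
    (hF : Expressible C.ext fun p => F p.1 p.2) :
    Expressible C fun γ => ∑ i ∈ Finset.range (L γ), F γ i :=
  (Expressible.fold .add 0 hL hF).congr fun γ => by
    induction L γ with
    | zero => rfl
    | succ k ih => rw [Finset.sum_range_succ, ih]; rfl

theorem Expressible.prod {F : Γ → ℕ → ℕ} (hL : IsLimit C L)
    (hF : Expressible C.ext fun p => F p.1 p.2) :
    Expressible C fun γ => ∏ i ∈ Finset.range (L γ), F γ i :=
  (Expressible.fold .mul 1 hL hF).congr fun γ => by
    induction L γ with
    | zero => rfl
    | succ k ih => rw [Finset.prod_range_succ, ih]; rfl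

theorem Decides.congr (hP : Decides C P) (hPQ : ∀ γ, Q γ ↔ P γ) : Decides C Q := by
  rwa [show Q = P from funext fun γ => propext (hPQ γ)]

theorem Expressible.le (hf : Expressible C f) (hg : Expressible C g) :
    Decides C fun γ => f γ ≤ g γ :=
  Expressible.congr ((Expressible.const 1).sub (hf.sub hg)) fun γ => by split_ifs <;> omega

theorem Decides.not (hP : Decides C P) : Decides C fun γ => ¬P γ :=
  Expressible.congr ((Expressible.const 1).sub hP) fun γ => by split_ifs <;> simp_all

theorem Decides.and (hP : Decides C P) (hQ : Decides C Q) : Decides C fun γ => P γ ∧ Q γ :=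
  Expressible.congr (Expressible.mul hP hQ) fun γ => by
    by_cases h1 : P γ <;> by_cases h2 : Q γ <;> simp [h1, h2]

theorem Decides.or (hP : Decides C P) (hQ : Decides C Q) : Decides C fun γ => P γ ∨ Q γ :=
  (hP.not.and hQ.not).not.congr fun γ => by tauto

theorem Decides.imp (hP : Decides C P) (hQ : Decides C Q) : Decides C fun γ => P γ → Q γ :=
  (hP.and hQ.not).not.congr fun γ => by tauto

theorem Expressible.lt (hf : Expressible C f) (hg : Expressible C g) :
    Decides C fun γ => f γ < g γ :=
  (hg.le hf).not.congr fun γ => by omega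

theorem Expressible.eq (hf : Expressible C f) (hg : Expressible C g) :
    Decides C fun γ => f γ = g γ :=
  ((hf.le hg).and (hg.le hf)).congr fun γ => by omega

theorem Expressible.ite {_ : ∀ γ, Decidable (P γ)} (hP : Decides C P) (hf : Expressible C f)
    (hg : Expressible C g) : Expressible C fun γ => if P γ then f γ else g γ :=
  ((Expressible.mul hP hf).add (Expressible.mul hP.not hg)).congr fun γ => by
    by_cases h : P γ <;> simp [h]

theorem Decides.forall_lt {R : Γ → ℕ → Prop} (hL : IsLimit C L)
    (hR : Decides C.ext fun p => R p.1 p.2) : Decides C fun γ => ∀ i < L γ, R γ i :=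
  Expressible.congr (Expressible.prod (F := fun γ i => @ite _ (R γ i) (Classical.dec _) 1 0) hL hR)
    fun γ => by
      classical
      by_cases h : ∀ i < L γ, R γ i
      · rw [if_pos h]
        exact (Finset.prod_eq_one fun i hi => if_pos (h i (Finset.mem_range.1 hi))).symm
      · rw [if_neg h]
        push Not at h
        obtain ⟨i, hi, hR⟩ := h
        exact (Finset.prod_eq_zero (Finset.mem_range.2 hi) (if_neg hR)).symm

theorem Decides.exists_lt {R : Γ → ℕ → Prop} (hL : IsLimit C L)
    (hR : Decides C.ext fun p => R p.1 p.2) : Decides C fun γ => ∃ i < L γ, R γ i :=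
  (Decides.forall_lt (R := fun γ i => ¬R γ i) hL hR.not).not.congr fun γ => by
    push Not
    rfl

end Closure

end RAM

/-! ### The algorithm as a search over guesses -/

section Search

open Classical in
/-- The least `i < R` with `P i`, or `R` if there is none. -/
noncomputable def firstBelow (R : ℕ) (P : ℕ → Prop) : ℕ :=
  ∑ i ∈ Finset.range R, if ∀ i' < R, i' ≤ i → ¬P i' then 1 else 0

/-- The digit at position `q < K` of the number `g` in base `b`. The power `b ^ q` is written as a
product with a number of factors that does not depend on `q`. -/
def digit (b K q g : ℕ) : ℕ := g / (∏ l ∈ Finset.range K, if l < q then b else 1) % b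

/-- Whether the guess `g` leaves chore `j` to agent `i` rather than to agent `k`, where `i < k`. The
digits of `g` are the threshold chores of the pairs of agents: `j` goes to `i` if the ratio of the
costs of `k` and `i` for `j` is at least that for the threshold chore. Ties are broken by the index,
and the threshold `m` leaves nothing to `i`. -/
def Prefers (n m : ℕ) (S : ℕ → ℕ → ℕ) (g i k j : ℕ) : Prop :=
  digit (m + 1) (n * n) (i * n + k) g < m ∧
    (S k (digit (m + 1) (n * n) (i * n + k) g) * S i j <
        S k j * S i (digit (m + 1) (n * n) (i * n + k) g) ∨
      S k (digit (m + 1) (n * n) (i * n + k) g) * S i j =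
        S k j * S i (digit (m + 1) (n * n) (i * n + k) g) ∧
      digit (m + 1) (n * n) (i * n + k) g ≤ j)

/-- The guess `g` allows giving chore `j` to agent `i`. -/
def Admissible (n m : ℕ) (S : ℕ → ℕ → ℕ) (g j i : ℕ) : Prop :=
  S i j = 0 ∨ ((∀ k < n, S k j ≠ 0) ∧
    ∀ k < n, (i < k → Prefers n m S g i k j) ∧ (k < i → ¬Prefers n m S g k i j))

/-- The agent who receives chore `j` for the guess `g`. The remainder makes this an agent even if the
guess allows nobody. -/
noncomputable def owner (n m : ℕ) (S : ℕ → ℕ → ℕ) (g j : ℕ) : ℕ :=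
  firstBelow n (Admissible n m S g j) % n

/-- The cost of agent `i` for the chores of agent `k`. -/
noncomputable def bundleCost (n m : ℕ) (S : ℕ → ℕ → ℕ) (g i k : ℕ) : ℕ :=
  ∑ l ∈ Finset.range m, if owner n m S g l = k then S i l else 0

/-- The cost of agent `i` for her own chores other than `j`. -/
noncomputable def costWithout (n m : ℕ) (S : ℕ → ℕ → ℕ) (g i j : ℕ) : ℕ :=
  ∑ l ∈ Finset.range m, if owner n m S g l = i ∧ l ≠ j then S i l else 0

/-- The allocation of the guess `g` is weighted envy-free up to one chore; the entitlement of agent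
`i` is `p i / q i`. -/
def FairTest (n m : ℕ) (S : ℕ → ℕ → ℕ) (p q : ℕ → ℕ) (g : ℕ) : Prop :=
  ∀ i < n, ∀ k < n, (∀ j < m, ¬owner n m S g j = i) ∨ ∃ j < m, owner n m S g j = i ∧
    costWithout n m S g i j * (p k * q i) ≤ bundleCost n m S g i k * (p i * q k)

/-- No closed walk through `n` chores improves the allocation of the guess `g`: handing each chore to
the owner of the preceding one does not decrease the product of the costs. The numbers below `m ^ n`
encode the walks. -/
def CycleTest (n m : ℕ) (S : ℕ → ℕ → ℕ) (g : ℕ) : Prop :=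
  ∀ h < m ^ n, ∏ t ∈ Finset.range n, S (owner n m S g (digit m n t h)) (digit m n t h) ≤
    ∏ t ∈ Finset.range n, S (owner n m S g (digit m n t h)) (digit m n ((t + 1) % n) h)

/-- The first guess whose allocation passes both tests. -/
noncomputable def bestGuess (n m : ℕ) (S : ℕ → ℕ → ℕ) (p q : ℕ → ℕ) : ℕ :=
  firstBelow ((m + 1) ^ (n * n)) fun g => FairTest n m S p q g ∧ CycleTest n m S g

/-- The computed allocation, as the number with digits `owner _ j` in base `n`. -/
noncomputable def answer (n m : ℕ) (S : ℕ → ℕ → ℕ) (p q : ℕ → ℕ) : ℕ :=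
  ∑ j ∈ Finset.range m, owner n m S (bestGuess n m S p q) j *
    ∏ l ∈ Finset.range m, if l < j then n else 1

end Search

/-! ### The search is expressible -/

namespace RAM

/-- The numerators of the entitlements in the input. -/
def entNum (d : ℕ → ℕ) (i : ℕ) : ℕ := d (1 + 2 * i)

/-- The denominators of the entitlements in the input. -/
def entDen (d : ℕ → ℕ) (i : ℕ) : ℕ := d (2 + 2 * i)

/-- The numerators of the costs in the input. -/
def costNum (n : ℕ) (d : ℕ → ℕ) (i j : ℕ) : ℕ := d (1 + 2 * n + 2 * (j * n + i))

/-- The denominators of the costs in the input. -/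
def costDen (n : ℕ) (d : ℕ → ℕ) (i j : ℕ) : ℕ := d (2 + 2 * n + 2 * (j * n + i))

/-- A common denominator of all costs. -/
def denProd (n : ℕ) (d : ℕ → ℕ) : ℕ :=
  ∏ i ∈ Finset.range n, ∏ j ∈ Finset.range (d 0), costDen n d i j

/-- The costs, multiplied by the common denominator. -/
def scaledCost (n : ℕ) (d : ℕ → ℕ) (i j : ℕ) : ℕ :=
  costNum n d i j * (denProd n d / costDen n d i j)

section Expressible

variable {Γ : Type} {C : Ctx Γ} {g h i j k l : Γ → ℕ} (n : ℕ)

theorem expressible_length : Expressible C fun γ => C.inp γ 0 := .input (.const 0)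

theorem expressible_entNum (hi : Expressible C i) :
    Expressible C fun γ => entNum (C.inp γ) (i γ) :=
  .input (.add (.const 1) (.mul (.const 2) hi))

theorem expressible_entDen (hi : Expressible C i) :
    Expressible C fun γ => entDen (C.inp γ) (i γ) :=
  .input (.add (.const 2) (.mul (.const 2) hi))

theorem expressible_costNum (hi : Expressible C i) (hj : Expressible C j) :
    Expressible C fun γ => costNum n (C.inp γ) (i γ) (j γ) :=
  .input (.add (.const (1 + 2 * n)) (.mul (.const 2) (.add (.mul hj (.const n)) hi)))

theorem expressible_costDen (hi : Expressible C i) (hj : Expressible C j) :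
    Expressible C fun γ => costDen n (C.inp γ) (i γ) (j γ) :=
  .input (.add (.const (2 + 2 * n)) (.mul (.const 2) (.add (.mul hj (.const n)) hi)))

theorem expressible_denProd : Expressible C fun γ => denProd n (C.inp γ) :=
  .prod (.const n) (.prod .length (expressible_costDen n Expressible.last.weaken .last))

theorem expressible_scaledCost (hi : Expressible C i) (hj : Expressible C j) :
    Expressible C fun γ => scaledCost n (C.inp γ) (i γ) (j γ) :=
  .mul (expressible_costNum n hi hj) (.div (expressible_denProd n) (expressible_costDen n hi hj))

/-- The body of the sum binds two variables, so `P` has to be decided below both. -/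
theorem expressible_firstBelow {L : Γ → ℕ} {P : Γ → ℕ → Prop} (hL : IsLimit C L)
    (hP : Decides C.ext.ext fun p => P p.1.1 p.2) :
    Expressible C fun γ => firstBelow (L γ) (P γ) :=
  .sum hL (.ite (.forall_lt (R := fun p i => i ≤ p.2 → ¬P p.1 i) hL.weaken
    (.imp (.le .last Expressible.last.weaken) hP.not)) (.const 1) (.const 0))

theorem expressible_digit {b : Γ → ℕ} (K : ℕ) (hb : Expressible C b) (hj : Expressible C j)
    (hg : Expressible C g) : Expressible C fun γ => digit (b γ) K (j γ) (g γ) :=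
  .mod (.div hg (.prod (.const K) (.ite (.lt .last hj.weaken) hb.weaken (.const 1)))) hb

theorem decides_prefers (hg : Expressible C g) (hi : Expressible C i) (hk : Expressible C k)
    (hj : Expressible C j) : Decides C fun γ =>
      Prefers n (C.inp γ 0) (scaledCost n (C.inp γ)) (g γ) (i γ) (k γ) (j γ) := by
  have ht : Expressible C fun γ => digit (C.inp γ 0 + 1) (n * n) (i γ * n + k γ) (g γ) :=
    expressible_digit (n * n) (.add expressible_length (.const 1)) (.add (.mul hi (.const n)) hk) hg
  have h1 := (expressible_scaledCost n hk ht).mul (expressible_scaledCost n hi hj)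
  have h2 := (expressible_scaledCost n hk hj).mul (expressible_scaledCost n hi ht)
  exact (ht.lt expressible_length).and ((h1.lt h2).or ((h1.eq h2).and (ht.le hj)))

theorem decides_admissible (hg : Expressible C g) (hj : Expressible C j) (hi : Expressible C i) :
    Decides C fun γ => Admissible n (C.inp γ 0) (scaledCost n (C.inp γ)) (g γ) (j γ) (i γ) :=
  .or (.eq (expressible_scaledCost n hi hj) (.const 0))
    (.and (.forall_lt (.const n) (.not (.eq (expressible_scaledCost n .last hj.weaken) (.const 0))))
      (.forall_lt (.const n)
        (.and (.imp (.lt hi.weaken .last) (decides_prefers n hg.weaken hi.weaken .last hj.weaken))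
          (.imp (.lt .last hi.weaken)
            (.not (decides_prefers n hg.weaken .last hi.weaken hj.weaken))))))

theorem expressible_owner (hg : Expressible C g) (hj : Expressible C j) :
    Expressible C fun γ => owner n (C.inp γ 0) (scaledCost n (C.inp γ)) (g γ) (j γ) :=
  .mod (expressible_firstBelow (.const n)
    (decides_admissible n hg.weaken.weaken hj.weaken.weaken .last)) (.const n)

theorem expressible_bundleCost (hg : Expressible C g) (hi : Expressible C i)
    (hk : Expressible C k) : Expressible C fun γ =>
      bundleCost n (C.inp γ 0) (scaledCost n (C.inp γ)) (g γ) (i γ) (k γ) :=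
  .sum .length (.ite (.eq (expressible_owner n hg.weaken .last) hk.weaken)
    (expressible_scaledCost n hi.weaken .last) (.const 0))

theorem expressible_costWithout (hg : Expressible C g) (hi : Expressible C i)
    (hj : Expressible C j) : Expressible C fun γ =>
      costWithout n (C.inp γ 0) (scaledCost n (C.inp γ)) (g γ) (i γ) (j γ) :=
  .sum .length (.ite (.and (.eq (expressible_owner n hg.weaken .last) hi.weaken)
    (.not (.eq .last hj.weaken))) (expressible_scaledCost n hi.weaken .last) (.const 0))

theorem decides_fairTest (hg : Expressible C g) : Decides C fun γ =>
    FairTest n (C.inp γ 0) (scaledCost n (C.inp γ)) (entNum (C.inp γ)) (entDen (C.inp γ)) (g γ) := by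
  refine .forall_lt (.const n) (.forall_lt (.const n) (.or (.forall_lt .length
    (.not (.eq (expressible_owner n hg.weaken.weaken.weaken .last)
      Expressible.last.weaken.weaken))) (.exists_lt .length (.and
        (.eq (expressible_owner n hg.weaken.weaken.weaken .last) Expressible.last.weaken.weaken)
        (.le (.mul (expressible_costWithout n hg.weaken.weaken.weaken Expressible.last.weaken.weaken
            .last) (.mul (expressible_entNum Expressible.last.weaken)
              (expressible_entDen Expressible.last.weaken.weaken)))
          (.mul (expressible_bundleCost n hg.weaken.weaken.weaken Expressible.last.weaken.weaken
            Expressible.last.weaken) (.mul (expressible_entNum Expressible.last.weaken.weaken)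
              (expressible_entDen Expressible.last.weaken))))))))

theorem decides_cycleTest (hg : Expressible C g) : Decides C fun γ =>
    CycleTest n (C.inp γ 0) (scaledCost n (C.inp γ)) (g γ) := by
  have hJ : Expressible C.ext.ext fun p => digit (C.inp p.1.1 0) n p.2 p.1.2 :=
    expressible_digit n expressible_length .last Expressible.last.weaken
  have hJ' : Expressible C.ext.ext fun p => digit (C.inp p.1.1 0) n ((p.2 + 1) % n) p.1.2 :=
    expressible_digit n expressible_length (.mod (.add .last (.const 1)) (.const n))
      Expressible.last.weaken
  exact .forall_lt (.length_pow n) (.le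
    (.prod (.const n) (expressible_scaledCost n (expressible_owner n hg.weaken.weaken hJ) hJ))
    (.prod (.const n) (expressible_scaledCost n (expressible_owner n hg.weaken.weaken hJ) hJ')))

theorem expressible_bestGuess : Expressible C fun γ =>
    bestGuess n (C.inp γ 0) (scaledCost n (C.inp γ)) (entNum (C.inp γ)) (entDen (C.inp γ)) :=
  expressible_firstBelow (.succ_length_pow (n * n))
    (.and (decides_fairTest n .last) (decides_cycleTest n .last))

theorem expressible_answer : Expressible C fun γ =>
    answer n (C.inp γ 0) (scaledCost n (C.inp γ)) (entNum (C.inp γ)) (entDen (C.inp γ)) :=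
  .sum .length (.mul (expressible_owner n (expressible_bestGuess n) .last)
    (.prod .length (.ite (.lt .last Expressible.last.weaken) (.const n) (.const 1))))

/-- The search is computed by a term. -/
theorem exists_term_answer (n : ℕ) : ∃ e : Term, ∀ d ρ,
    e.eval d ρ = answer n (d 0) (scaledCost n d) (entNum d) (entDen d) := by
  obtain ⟨e, he⟩ := expressible_answer (C := ⟨0, fun _ _ => 0, fun d : ℕ → ℕ => d⟩) n
  exact ⟨e, fun d ρ => he d ρ fun v hv => absurd hv (Nat.not_lt_zero v)⟩

end Expressible

end RAM

/-! ### The search succeeds -/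

section Search

theorem firstBelow_spec {R : ℕ} {P : ℕ → Prop} (h : ∃ i, i < R ∧ P i) :
    firstBelow R P < R ∧ P (firstBelow R P) := by
  classical
  have hs := Nat.find_spec h
  have : firstBelow R P = Nat.find h := by
    rw [firstBelow, Finset.sum_boole, Nat.cast_id]
    conv_rhs => rw [← Finset.card_range (Nat.find h)]
    congr 1
    ext i
    simp only [Finset.mem_filter, Finset.mem_range]
    constructor
    · rintro ⟨hi, hP⟩
      by_contra hlt
      exact hP _ hs.1 (not_lt.1 hlt) hs.2
    · intro hi
      refine ⟨hi.trans hs.1, fun i' hi' hle hP => ?_⟩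
      exact Nat.find_min h (hle.trans_lt hi) ⟨hi', hP⟩
  rwa [this]

theorem prod_ite_lt (b : ℕ) {K q : ℕ} (hq : q ≤ K) :
    (∏ l ∈ Finset.range K, if l < q then b else 1) = b ^ q := by
  rw [Finset.prod_ite, Finset.prod_const, Finset.prod_const_one, mul_one]
  congr 1
  conv_rhs => rw [← Finset.card_range q]
  congr 1
  ext l
  simp only [Finset.mem_filter, Finset.mem_range]
  omega

theorem finFunctionFinEquiv_div_mod {b K : ℕ} (f : Fin K → Fin b) (q : Fin K) :
    (finFunctionFinEquiv f : ℕ) / b ^ (q : ℕ) % b = f q :=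
  congrArg Fin.val (congrFun (finFunctionFinEquiv.symm_apply_apply f) q)

theorem digit_eq (b K : ℕ) (f : Fin K → Fin b) (q : Fin K) :
    digit b K q (finFunctionFinEquiv f) = f q := by
  rw [digit, prod_ite_lt b q.2.le, finFunctionFinEquiv_div_mod]

variable {n m : ℕ} (S : ℕ → ℕ → ℕ) (p q : ℕ → ℕ) (g : ℕ)

theorem cost_owner_eq_zero {j : ℕ} (h : ∃ i < n, S i j = 0) : S (owner n m S g j) j = 0 := by
  obtain ⟨i, hi, hij⟩ := h
  obtain ⟨hlt, hadm⟩ := firstBelow_spec (P := Admissible n m S g j) ⟨i, hi, Or.inl hij⟩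
  rw [owner, Nat.mod_eq_of_lt hlt]
  exact hadm.resolve_right fun h => h.1 i hi hij

/-- The least chore of agent `i` in the allocation `x`, for the order in which the
threshold rule with agent `k` gives the chores to `i`, among those that cost something to everyone;
it is `m` if there is none. -/
theorem exists_threshold (x : Fin m → Fin n) (i k : Fin n) : ∃ t : Fin (m + 1),
    (∀ j : Fin m, (∀ i < n, S i j ≠ 0) → x j = i → (t : ℕ) < m ∧
      (S k t * S i j < S k j * S i t ∨ S k t * S i j = S k j * S i t ∧ (t : ℕ) ≤ j)) ∧
    ((t : ℕ) < m → ∃ j : Fin m, (t : ℕ) = j ∧ (∀ i < n, S i j ≠ 0) ∧ x j = i) := by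
  classical
  let T : Finset (Fin m) := Finset.univ.filter fun j => (∀ i < n, S i j ≠ 0) ∧ x j = i
  have hT : ∀ j, j ∈ T ↔ (∀ i < n, S i j ≠ 0) ∧ x j = i := fun j => by simp [T]
  by_cases hne : T.Nonempty
  · obtain ⟨t, ht, hmin⟩ := T.exists_min_image
      (fun j => toLex ((S k j : ℝ≥0) / (S i j : ℝ≥0), j)) hne
    refine ⟨t.castSucc, fun j hj hji => ⟨t.2, ?_⟩, fun _ => ⟨t, rfl, (hT t).1 ht⟩⟩
    have h1 : (0 : ℝ≥0) < S i t := by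
      exact_mod_cast Nat.pos_of_ne_zero (((hT t).1 ht).1 i i.2)
    have h2 : (0 : ℝ≥0) < S i j := by exact_mod_cast Nat.pos_of_ne_zero (hj i i.2)
    have h := hmin j ((hT j).2 ⟨hj, hji⟩)
    rw [Prod.Lex.toLex_le_toLex, div_lt_div_iff₀ h1 h2, div_eq_div_iff h1.ne' h2.ne'] at h
    exact_mod_cast h
  · refine ⟨Fin.last m, fun j hj hji => absurd ⟨j, (hT j).2 ⟨hj, hji⟩⟩ hne,
      fun h => absurd h (by simp)⟩

variable [NeZero n]

/-- The allocation of the guess `g`. -/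
noncomputable def ownerFin (n m : ℕ) [NeZero n] (S : ℕ → ℕ → ℕ) (g : ℕ) (j : Fin m) : Fin n :=
  ⟨owner n m S g j, Nat.mod_lt _ (NeZero.pos n)⟩

/-- Costs indexed by natural numbers as costs of finitely many chores for finitely many agents. -/
def castCost (n m : ℕ) (S : ℕ → ℕ → ℕ) (i : Fin n) (j : Fin m) : ℝ≥0 := (S i j : ℝ≥0)

/-- The entitlements as quotients. -/
noncomputable def castEnt (n : ℕ) (p q : ℕ → ℕ) (i : Fin n) : ℝ≥0 := (p i : ℝ≥0) / (q i : ℝ≥0)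

theorem load_share_ownerFin (i k : Fin n) :
    load (castCost n m S i) (share (ownerFin n m S g) k) = (bundleCost n m S g i k : ℝ≥0) := by
  rw [bundleCost, load, share, Finset.sum_filter, Finset.sum_range, Nat.cast_sum]
  refine Finset.sum_congr rfl fun l _ => ?_
  simp only [Fin.ext_iff, ownerFin, castCost]
  split_ifs <;> simp

theorem load_erase_ownerFin (i : Fin n) (j : Fin m) :
    load (castCost n m S i) ((share (ownerFin n m S g) i).erase j) =
      (costWithout n m S g i j : ℝ≥0) := by
  rw [costWithout, load, share, ← Finset.filter_ne', Finset.filter_filter, Finset.sum_filter,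
    Finset.sum_range, Nat.cast_sum]
  refine Finset.sum_congr rfl fun l _ => ?_
  simp only [Fin.ext_iff, ownerFin, castCost, ne_eq]
  split_ifs <;> simp

theorem fairTest_iff (hp : ∀ i < n, 0 < p i) :
    FairTest n m S p q g ↔
      EnvyFreeUpToOne (castCost n m S) (castEnt n p q) (ownerFin n m S g) := by
  have key : ∀ (i k : Fin n) (a b : ℕ),
      (a : ℝ≥0) / castEnt n p q i ≤ (b : ℝ≥0) / castEnt n p q k ↔
        a * (p k * q i) ≤ b * (p i * q k) := by
    intro i k a b
    have h1 : (0 : ℝ≥0) < p i := by exact_mod_cast hp i i.2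
    have h2 : (0 : ℝ≥0) < p k := by exact_mod_cast hp k k.2
    rw [castEnt, castEnt, div_div_eq_mul_div, div_div_eq_mul_div, div_le_div_iff₀ h1 h2,
      ← Nat.cast_le (α := ℝ≥0)]
    push_cast
    rw [mul_right_comm, mul_assoc, mul_assoc, mul_comm (q k : ℝ≥0)]
  constructor
  · intro h i k ⟨j₀, hj₀⟩
    have hj₀' := congrArg Fin.val (mem_share.1 hj₀)
    rcases h i i.2 k k.2 with h | ⟨j, hj, hji, hle⟩
    · exact absurd hj₀' (h j₀ j₀.2)
    · refine ⟨⟨j, hj⟩, mem_share.2 (Fin.ext hji), ?_⟩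
      rw [load_erase_ownerFin, load_share_ownerFin, key]
      exact hle
  · intro h i hi k hk
    by_cases hne : (share (ownerFin n m S g) ⟨i, hi⟩).Nonempty
    · obtain ⟨j, hj, hle⟩ := h ⟨i, hi⟩ ⟨k, hk⟩ hne
      rw [load_erase_ownerFin, load_share_ownerFin, key] at hle
      exact Or.inr ⟨j, j.2, congrArg Fin.val (mem_share.1 hj), hle⟩
    · exact Or.inl fun j hj hji => hne ⟨⟨j, hj⟩, mem_share.2 (Fin.ext hji)⟩

theorem cycleTest_iff : CycleTest n m S g ↔ ∀ J : Fin n → Fin m,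
    ∏ t, castCost n m S (ownerFin n m S g (J t)) (J t) ≤
      ∏ t, castCost n m S (ownerFin n m S g (J t)) (J (t + 1)) := by
  have key : ∀ J : Fin n → Fin m, (∏ t, castCost n m S (ownerFin n m S g (J t)) (J t) ≤
      ∏ t, castCost n m S (ownerFin n m S g (J t)) (J (t + 1))) ↔
        ∏ t ∈ Finset.range n, S (owner n m S g (digit m n t (finFunctionFinEquiv J)))
            (digit m n t (finFunctionFinEquiv J)) ≤
          ∏ t ∈ Finset.range n, S (owner n m S g (digit m n t (finFunctionFinEquiv J)))
            (digit m n ((t + 1) % n) (finFunctionFinEquiv J)) := by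
    intro J
    rw [Finset.prod_range, Finset.prod_range, ← Nat.cast_le (α := ℝ≥0), Nat.cast_prod,
      Nat.cast_prod]
    have h1 : ∀ t : Fin n, ((t : ℕ) + 1) % n = ((t + 1 : Fin n) : ℕ) := fun t => by
      rw [Fin.val_add, Fin.val_one', Nat.add_mod_mod]
    simp only [h1, digit_eq]
    rfl
  constructor
  · intro h J
    exact (key J).2 (h _ (finFunctionFinEquiv J).2)
  · intro h N hN
    have := (key (finFunctionFinEquiv.symm ⟨N, hN⟩)).1 (h _)
    rwa [Equiv.apply_symm_apply] at this

/-- Some guess passes both tests, since the threshold rule recovers an allocation from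
`exists_envyFree` on the chores that cost something to everyone. -/
theorem bestGuess_spec (hp : ∀ i < n, 0 < p i) :
    FairTest n m S p q (bestGuess n m S p q) ∧ CycleTest n m S (bestGuess n m S p q) := by
  have hpos : ∀ j : Fin m, (∀ i, 0 < castCost n m S i j) ↔ ∀ i < n, S i j ≠ 0 := fun j => by
    simp only [castCost, Nat.cast_pos, Nat.pos_iff_ne_zero]
    exact ⟨fun h i hi => h ⟨i, hi⟩, fun h i => h i i.2⟩
  obtain ⟨x₀, hsep, hx₀⟩ := exists_envyFree (castCost n m S) (castEnt n p q)
  choose thr hthr1 hthr2 using exists_threshold S x₀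
  have hn := NeZero.pos n
  -- the guess whose digits are the thresholds
  let f : Fin (n * n) → Fin (m + 1) := fun r => thr (finProdFinEquiv.symm r).1
    (finProdFinEquiv.symm r).2
  let g : ℕ := finFunctionFinEquiv f
  have hdig : ∀ i k : Fin n, digit (m + 1) (n * n) (i * n + k) g = thr i k := by
    intro i k
    have h1 : ((finProdFinEquiv (i, k) : Fin (n * n)) : ℕ) = i * n + k := by
      simp [finProdFinEquiv]; ring
    rw [← h1, digit_eq]
    simp only [f, Equiv.symm_apply_apply]
  -- the rule follows `x₀`: thresholds are minimal, and `x₀` separates the chores of two agents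
  have hpref : ∀ i k : Fin n, ∀ j : Fin m, (∀ i < n, S i j ≠ 0) → x₀ j = i →
      Prefers n m S g i k j := by
    intro i k j hj hji
    unfold Prefers
    rw [hdig]
    exact hthr1 i k j hj hji
  have hnpref : ∀ i k : Fin n, i < k → ∀ j : Fin m, (∀ i < n, S i j ≠ 0) → x₀ j = k →
      ¬Prefers n m S g i k j := by
    intro i k hik j hj hjk h
    unfold Prefers at h
    rw [hdig] at h
    obtain ⟨j', hj', hpos', hx'⟩ := hthr2 i k h.1
    rw [hj'] at h
    have hs := hsep i k hik j' j ((hpos j').2 hpos') ((hpos j).2 hj) hx' hjk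
    simp only [castCost, ← Nat.cast_mul, Nat.cast_lt, Nat.cast_inj, Fin.lt_def] at hs
    omega
  have hg : ∀ j : Fin m, (∀ i, 0 < castCost n m S i j) → ownerFin n m S g j = x₀ j := by
    intro j hj
    rw [hpos] at hj
    have hadm : Admissible n m S g j (x₀ j) := Or.inr ⟨hj, fun k hk =>
      ⟨fun _ => hpref (x₀ j) ⟨k, hk⟩ j hj rfl, fun hlt => hnpref ⟨k, hk⟩ (x₀ j) hlt j hj rfl⟩⟩
    obtain ⟨hlt, hadm'⟩ := firstBelow_spec (P := Admissible n m S g j) ⟨x₀ j, (x₀ j).2, hadm⟩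
    refine Fin.ext ?_
    change firstBelow n (Admissible n m S g j) % n = _
    rw [Nat.mod_eq_of_lt hlt]
    set o := firstBelow n (Admissible n m S g j)
    have hadm'' := (hadm'.resolve_left (hj o hlt)).2 (x₀ j) (x₀ j).2
    rcases lt_trichotomy o (x₀ j) with h | h | h
    · exact absurd (hadm''.1 h) (hnpref ⟨o, hlt⟩ (x₀ j) h j hj rfl)
    · exact h
    · exact absurd (hpref (x₀ j) ⟨o, hlt⟩ j hj rfl) (hadm''.2 h)
  obtain ⟨hfair, w, hw, htied⟩ := hx₀ (ownerFin n m S g) hg fun j ⟨i, hi⟩ => by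
    have h := cost_owner_eq_zero (m := m) S g (j := j) ⟨i, i.2, by simpa [castCost] using hi⟩
    exact Nat.cast_eq_zero.2 h
  exact (firstBelow_spec (P := fun g => FairTest n m S p q g ∧ CycleTest n m S g)
    ⟨g, (finFunctionFinEquiv f).2, (fairTest_iff S p q g hp).2 hfair,
      (cycleTest_iff S g).2 fun J => cycle_test_of_weights _ _ hw htied J⟩).2

/-- The allocation that the search finds is fair and efficient. -/
theorem search_spec (hp : ∀ i < n, 0 < p i) :
    EnvyFreeUpToOne (castCost n m S) (castEnt n p q) (ownerFin n m S (bestGuess n m S p q)) ∧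
      ∃ w : Fin n → ℝ≥0, (∀ i, 0 < w i) ∧
        ∀ j, Tied (castCost n m S) w (ownerFin n m S (bestGuess n m S p q) j) j := by
  obtain ⟨h1, h2⟩ := bestGuess_spec (m := m) S p q hp
  refine ⟨(fairTest_iff S p q _ hp).1 h1, exists_weights_of_cycle_test' _ _ ?_
    ((cycleTest_iff S _).1 h2)⟩
  rintro j ⟨i, hi⟩
  have h := cost_owner_eq_zero (m := m) S (bestGuess n m S p q) (j := j)
    ⟨i, i.2, by simpa [castCost] using hi⟩
  exact Nat.cast_eq_zero.2 h

theorem answer_eq : answer n m S p q =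
    finFunctionFinEquiv (ownerFin n m S (bestGuess n m S p q)) := by
  rw [finFunctionFinEquiv_apply, answer, Finset.sum_range]
  refine Finset.sum_congr rfl fun j _ => ?_
  rw [prod_ite_lt n j.2.le]
  rfl

end Search

/-! ### Reading the input -/

section Input

theorem getD_flatMap_finRange {K L : ℕ} (f : Fin K → List ℕ) (hf : ∀ i, (f i).length = L)
    (l : List ℕ) (i : Fin K) {r : ℕ} (hr : r < L) :
    ((List.finRange K).flatMap f ++ l).getD (L * i + r) 0 = (f i).getD r 0 := by
  induction K with
  | zero => exact i.elim0
  | succ K ih =>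
    rw [List.finRange_succ, List.flatMap_cons, List.flatMap_map, List.append_assoc]
    refine Fin.cases ?_ (fun i => ?_) i
    · rw [List.getD_append _ _ _ _ (by simp [hf, hr])]
      simp
    · rw [List.getD_append_right _ _ _ _ (by rw [hf, Fin.val_succ, mul_add]; omega), hf,
        show L * (i.succ : ℕ) + r - L = L * i + r by rw [Fin.val_succ, mul_add]; omega]
      exact ih (fun i => f i.succ) (fun i => hf _) i

theorem length_flatMap_finRange {K L : ℕ} (f : Fin K → List ℕ) (hf : ∀ i, (f i).length = L) :
    ((List.finRange K).flatMap f).length = K * L := by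
  simp [List.length_flatMap, hf]

theorem length_encodeRat (q : ℚ≥0) : (encodeRat q).length = 2 := rfl

variable {n m : ℕ} (I : RatInstance n m)

/-- The memory that holds the word of a rational instance. -/
def RatInstance.memory (k : ℕ) : ℕ := (RatInstance.encode ⟨m, I⟩).getD k 0

theorem memory_zero : I.memory 0 = m := rfl

theorem memory_ent (i : Fin n) {r : ℕ} (hr : r < 2) :
    I.memory (1 + (2 * i + r)) = (encodeRat (I.α i)).getD r 0 := by
  rw [RatInstance.memory, RatInstance.encode, List.append_assoc,
    List.getD_append_right _ _ _ _ (by simp)]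
  simp only [List.length_singleton, Nat.add_sub_cancel_left]
  exact getD_flatMap_finRange _ (fun _ => length_encodeRat _) _ i hr

theorem length_costs (j : Fin m) :
    ((List.finRange n).flatMap fun i => encodeRat (I.c i j)).length = n * 2 :=
  length_flatMap_finRange _ fun _ => length_encodeRat _

theorem memory_cost (i : Fin n) (j : Fin m) {r : ℕ} (hr : r < 2) :
    I.memory (1 + 2 * n + (2 * (j * n + i) + r)) = (encodeRat (I.c i j)).getD r 0 := by
  have hlen : ([m] ++ (List.finRange n).flatMap fun i => encodeRat (I.α i)).length = 1 + 2 * n := by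
    rw [List.length_append, length_flatMap_finRange _ fun i => length_encodeRat (I.α i)]
    simp [mul_comm]
  have hlt : 2 * (i : ℕ) + r < n * 2 := by omega
  rw [RatInstance.memory, RatInstance.encode,
    List.getD_append_right _ _ _ _ (by simp only [hlen]; omega)]
  simp only [hlen, Nat.add_sub_cancel_left]
  rw [show 2 * ((j : ℕ) * n + i) + r = n * 2 * j + (2 * i + r) by ring]
  rw [← List.append_nil (List.flatMap _ (List.finRange m)),
    getD_flatMap_finRange _ (length_costs I) _ j hlt,
    ← List.append_nil (List.flatMap _ (List.finRange n)),
    getD_flatMap_finRange _ (fun _ => length_encodeRat _) _ i hr]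

theorem length_encode : (RatInstance.encode ⟨m, I⟩).length = 1 + 2 * n + 2 * (m * n) := by
  rw [RatInstance.encode, List.length_append, List.length_append,
    length_flatMap_finRange _ fun i => length_encodeRat (I.α i),
    length_flatMap_finRange _ (length_costs I)]
  simp only [List.length_singleton]
  ring

open RAM

theorem entNum_memory (i : Fin n) : entNum I.memory i = (I.α i).num :=
  memory_ent I i (r := 0) (by norm_num)

theorem entDen_memory (i : Fin n) : entDen I.memory i = (I.α i).den := by
  rw [entDen, show 2 + 2 * (i : ℕ) = 1 + (2 * i + 1) by ring]
  exact memory_ent I i (by norm_num)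

theorem costNum_memory (i : Fin n) (j : Fin m) : costNum n I.memory i j = (I.c i j).num :=
  memory_cost I i j (r := 0) (by norm_num)

theorem costDen_memory (i : Fin n) (j : Fin m) : costDen n I.memory i j = (I.c i j).den := by
  rw [costDen, show 2 + 2 * n + 2 * ((j : ℕ) * n + i) = 1 + 2 * n + (2 * (j * n + i) + 1) by ring]
  exact memory_cost I i j (by norm_num)

theorem denProd_pos : 0 < denProd n I.memory := by
  refine Finset.prod_pos fun i hi => Finset.prod_pos fun j hj => ?_
  rw [memory_zero, Finset.mem_range] at hj
  rw [costDen_memory I ⟨i, Finset.mem_range.1 hi⟩ ⟨j, hj⟩]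
  exact NNRat.den_pos _

theorem costDen_dvd_denProd (i : Fin n) (j : Fin m) :
    costDen n I.memory i j ∣ denProd n I.memory :=
  (Finset.dvd_prod_of_mem (fun j => costDen n I.memory i j)
    (Finset.mem_range.2 (by rw [memory_zero]; exact j.2))).trans
    (Finset.dvd_prod_of_mem _ (Finset.mem_range.2 i.2))

theorem castCost_memory (i : Fin n) (j : Fin m) : castCost n m (scaledCost n I.memory) i j =
    (denProd n I.memory : ℝ≥0) * I.toInstance.costNN i j := by
  have hden : ((I.c i j).den : ℝ) ≠ 0 := Nat.cast_ne_zero.2 (NNRat.den_ne_zero _)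
  refine NNReal.coe_injective ?_
  change ((scaledCost n I.memory i j : ℕ) : ℝ) = ((denProd n I.memory : ℕ) : ℝ) * ((I.c i j : ℚ≥0) : ℝ)
  rw [scaledCost, Nat.cast_mul, Nat.cast_div (costDen_dvd_denProd I i j)
    (by rw [costDen_memory]; exact hden), costDen_memory, costNum_memory, NNRat.cast_def (K := ℝ)]
  ring

theorem castEnt_memory (i : Fin n) :
    castEnt n (entNum I.memory) (entDen I.memory) i = I.toInstance.entNN i := by
  refine NNReal.coe_injective ?_
  rw [castEnt, entNum_memory, entDen_memory]
  change _ = ((I.α i : ℚ≥0) : ℝ)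
  rw [NNRat.cast_def (K := ℝ)]
  simp

/-- The search on the word of a rational instance finds a fair and efficient allocation. -/
theorem isWEF1_and_isPO_ownerFin [NeZero n] :
    let x : Allocation n m := ownerFin n m (scaledCost n I.memory)
      (bestGuess n m (scaledCost n I.memory) (entNum I.memory) (entDen I.memory))
    I.toInstance.IsWEF1 x ∧ I.toInstance.IsPO x := by
  intro x
  have hD : (0 : ℝ≥0) < denProd n I.memory := Nat.cast_pos.2 (denProd_pos I)
  obtain ⟨hfair, w, hw, htied⟩ := search_spec (n := n) (m := m) (scaledCost n I.memory)
    (entNum I.memory) (entDen I.memory) fun i hi => by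
      rw [entNum_memory I ⟨i, hi⟩]
      exact NNRat.num_pos.2 (I.α_pos _)
  have hload : ∀ i B, load (castCost n m (scaledCost n I.memory) i) B =
      (denProd n I.memory : ℝ≥0) * load (I.toInstance.costNN i) B := fun i B => by
    rw [load, load, Finset.mul_sum]
    exact Finset.sum_congr rfl fun j _ => castCost_memory I i j
  constructor
  · refine I.toInstance.isWEF1_of_envyFree fun i k hne => ?_
    obtain ⟨j, hj, hle⟩ := hfair i k hne
    refine ⟨j, hj, ?_⟩
    rw [hload, hload, castEnt_memory, castEnt_memory, mul_div_assoc, mul_div_assoc] at hle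
    exact le_of_mul_le_mul_left hle hD
  · refine (I.toInstance.isFPO_of_tied hw fun j k => ?_).isPO
    have h := htied j k
    rw [castCost_memory, castCost_memory, mul_left_comm, mul_left_comm (w k)] at h
    exact le_of_mul_le_mul_left h hD

theorem length_le_wordSize (w : List ℕ) : w.length ≤ wordSize w := by
  induction w with
  | nil => exact le_rfl
  | cons a w ih =>
    simp only [wordSize, List.length_cons, List.map_cons, List.sum_cons] at ih ⊢
    omega

theorem size_getD_le_wordSize (w : List ℕ) (k : ℕ) : (w.getD k 0).size ≤ wordSize w := by
  induction w generalizing k with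
  | nil => simp
  | cons a w ih =>
    simp only [wordSize, List.map_cons, List.sum_cons] at ih ⊢
    cases k with
    | zero => simp only [List.getD_cons_zero]; omega
    | succ k => rw [List.getD_cons_succ]; have := ih k; omega

end Input

/-! ### Writing the output -/

namespace RAM

/-- The loop that writes the digits in base `n` of the number in register `1`. Register `3` counts
down, register `5` holds `n`, register `7` the address of the next digit, and register `9` the
number `1`. -/
def writeLoop : Prog :=
  .loop 3 (Prog.after [.div 13 1 5, .mul 13 13 5, .sub 13 1 13, .store 7 13, .add 7 7 9,
    .div 1 1 5] (.op (.sub 3 3 9)))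

/-- The program that writes the `m` digits in base `n` of the number in register `1` to the memory,
where `m` is the first entry of the memory. -/
def writeDigits (n : ℕ) : Prog :=
  Prog.after [.const 3 0, .load 3 3, .const 9 0, .add 0 3 9, .const 5 n, .const 7 0, .const 9 1]
    writeLoop

theorem exec_writeLoop (n m Y r : ℕ) (hr : r ≤ m) (s : State) (h1 : s.reg 1 = Y / n ^ (m - r))
    (h3 : s.reg 3 = r) (h5 : s.reg 5 = n) (h7 : s.reg 7 = m - r) (h9 : s.reg 9 = 1)
    (hmem : ∀ k < m - r, s.mem k = Y / n ^ k % n) :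
    ∃ (s' : State) (τ : ℕ), Exec writeLoop s s' τ ∧
      τ ≤ r * (12 + 4 * m + 6 * Y.size + 3 * n.size) + 1 ∧ s'.reg 0 = s.reg 0 ∧
      ∀ k < m, s'.mem k = Y / n ^ k % n := by
  induction r generalizing s with
  | zero =>
    refine ⟨s, _, Exec.loop_done h3, ?_, rfl, by simpa using hmem⟩
    rw [h3]; simp
  | succ r ih =>
    have hmr : m - (r + 1) + 1 = m - r := by omega
    set a := m - (r + 1) with ha
    set q := Y / n ^ a with hq
    have hqn : Y / n ^ (m - r) = q / n := by
      rw [← hmr, pow_succ, hq, Nat.div_div_eq_div_mul]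
    let l : List Op := [.div 13 1 5, .mul 13 13 5, .sub 13 1 13, .store 7 13, .add 7 7 9,
      .div 1 1 5]
    let s2 : State := (Op.sub 3 3 9).run (runOps l s)
    have hs2 : s2 = ⟨Function.update (Function.update (Function.update (Function.update s.reg
        13 (q - q / n * n)) 7 (m - r)) 1 (q / n)) 3 r, Function.update s.mem a (q - q / n * n)⟩ := by
      simp only [s2, l, runOps, Op.run]
      simp [h1, h3, h5, h7, h9, hmr]
    have hex : Exec (Prog.after l (.op (.sub 3 3 9))) s s2 _ := Exec.after l (Exec.op _ _)
    have hmod : q - q / n * n = q % n := by rw [Nat.mod_def, mul_comm]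
    have hcost : costOps l s + (Op.sub 3 3 9).cost (runOps l s) ≤
        10 + 3 * m + 6 * Y.size + 3 * n.size := by
      have e1 : q.size ≤ Y.size := Nat.size_le_size (Nat.div_le_self _ _)
      have e2 : (q / n).size ≤ Y.size := (Nat.size_le_size (Nat.div_le_self _ _)).trans e1
      have e3 : (q / n * n).size ≤ Y.size := (Nat.size_le_size (Nat.div_mul_le_self _ _)).trans e1
      have e4 : (q - q / n * n).size ≤ Y.size := (Nat.size_le_size (Nat.sub_le _ _)).trans e1
      have e5 := size_le_self a
      have e6 := size_le_self (r + 1)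
      have e7 : Nat.size 1 = 1 := rfl
      simp only [l, runOps, costOps, Op.run, Op.cost]
      simp [h1, h3, h5, h7, h9]
      omega
    obtain ⟨s', τ, hex', hτ, h0, hout⟩ := ih (by omega) s2 (by rw [hs2, hqn]; simp)
      (by rw [hs2]; simp) (by rw [hs2]; simp [h5]) (by rw [hs2]; simp) (by rw [hs2]; simp [h9])
      (fun k hk => by
        rw [hs2]
        by_cases hka : k = a
        · rw [hka, ← hq, ← hmod]; simp
        · simp only [Function.update_of_ne hka]
          exact hmem k (by omega))
    refine ⟨s', _, Exec.loop_step (by omega) hex hex', ?_, by rw [h0, hs2]; simp, hout⟩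
    have e6 := size_le_self (r + 1)
    rw [h3, add_mul]
    omega

theorem exec_writeDigits (n m : ℕ) (s : State) (hm : s.mem 0 = m) :
    ∃ (s' : State) (τ : ℕ), Exec (writeDigits n) s s' τ ∧
      τ ≤ m * (12 + 4 * m + 6 * (s.reg 1).size + 3 * n.size) + (12 + 2 * m + n.size) ∧
      s'.reg 0 = m ∧ ∀ k < m, s'.mem k = s.reg 1 / n ^ k % n := by
  let l : List Op := [.const 3 0, .load 3 3, .const 9 0, .add 0 3 9, .const 5 n, .const 7 0,
    .const 9 1]
  obtain ⟨s', τ, hex, hτ, h0, hout⟩ := exec_writeLoop n m (s.reg 1) m le_rfl (runOps l s)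
    (by simp [l, runOps, Op.run]) (by simp [l, runOps, Op.run, hm]) (by simp [l, runOps, Op.run])
    (by simp [l, runOps, Op.run]) (by simp [l, runOps, Op.run]) (by simp)
  refine ⟨s', _, Exec.after l hex, ?_, by rw [h0]; simp [l, runOps, Op.run, hm], hout⟩
  have hc : costOps l s ≤ 11 + 2 * m + n.size := by
    have e1 := size_le_self m
    have e2 : Nat.size 1 = 1 := rfl
    simp [l, costOps, Op.run, Op.cost, hm]
    omega
  omega

end RAM

open RAM in
/-- The term for the search, followed by the output of its digits, is a polynomial-time program. -/
theorem solvableInPolyTime (n : ℕ) (hn : 1 ≤ n) :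
    SolvableInPolyTime (RatInstance.encode (n := n)) fun I w => ∃ x : Allocation n I.1,
      w = x.encode ∧ I.2.toInstance.IsWEF1 x ∧ I.2.toInstance.IsPO x := by
  have : NeZero n := ⟨by omega⟩
  obtain ⟨e, he⟩ := exists_term_answer n
  have hpoly : IsPoly fun B => e.bound B +
      (B * (12 + 4 * B + 6 * e.bound B + 3 * n.size) + (12 + 2 * B + n.size)) :=
    .add e.isPoly_bound (.add (.mul .id (.add (.add (.add (.const _) (.mul (.const _) .id))
      (.mul (.const _) e.isPoly_bound)) (.const _)))
        (.add (.add (.const _) (.mul (.const _) .id)) (.const _)))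
  obtain ⟨p, hp⟩ := hpoly
  refine ⟨.seq (e.compile 0) (writeDigits n), p, ?_⟩
  rintro ⟨m, I⟩
  set w := RatInstance.encode ⟨m, I⟩ with hw
  set B := wordSize w with hB
  have hlen : w.length ≤ B := length_le_wordSize w
  have hmB : m ≤ B := by
    refine le_trans ?_ hlen
    rw [length_encode]
    have : m * 1 ≤ m * n := Nat.mul_le_mul_left m hn
    omega
  obtain ⟨hsize, s1, τ1, hex1, hτ1, hmem1, hval1, -⟩ := e.correct (d := I.memory) (B := B)
    (fun k => size_getD_le_wordSize w k) hmB 0 (State.init w) rfl fun v => by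
      simp only [State.init]
      split_ifs
      · exact (size_le_self _).trans hlen
      · simp
  set x : Allocation n m := ownerFin n m (scaledCost n I.memory)
    (bestGuess n m (scaledCost n I.memory) (entNum I.memory) (entDen I.memory)) with hx
  have hans : (e.eval I.memory fun v => (State.init w).reg (2 * v)) = finFunctionFinEquiv x := by
    rw [he, memory_zero, answer_eq]
  obtain ⟨s2, τ2, hex2, hτ2, h0, hout⟩ := exec_writeDigits n m s1 (by rw [hmem1]; rfl)
  refine ⟨s2, _, Exec.seq hex1 hex2, ?_, x, ?_, isWEF1_and_isPO_ownerFin I⟩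
  · rw [← hp]
    have hs1 : (s1.reg 1).size ≤ e.bound B := by
      have h : s1.reg 1 = _ := hval1
      rw [h]
      exact hsize
    refine Nat.add_le_add hτ1 (hτ2.trans (Nat.add_le_add (Nat.mul_le_mul hmB ?_) ?_)) <;> omega
  · rw [State.output, h0, Allocation.encode]
    refine List.ext_getElem (by simp) fun k hk hk' => ?_
    have hkm : k < m := by simpa using hk
    have h : s1.reg 1 = _ := hval1
    simp only [List.getElem_map, List.getElem_range, List.getElem_ofFn]
    rw [hout k hkm, h, hans]
    exact finFunctionFinEquiv_div_mod x ⟨k, hkm⟩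

end ChoreDivision

theorem theorem4 :
    -- a wEF1 and PO allocation always exists
    (∀ (n m : ℕ), 1 ≤ n → ∀ I : ChoreDivision.Instance n m,
      ∃ x : ChoreDivision.Allocation n m, I.IsWEF1 x ∧ I.IsPO x) ∧
    -- a wEF1 and fPO allocation always exists
    (∀ (n m : ℕ), 1 ≤ n → ∀ I : ChoreDivision.Instance n m,
      ∃ x : ChoreDivision.Allocation n m, I.IsWEF1 x ∧ I.IsFPO x) ∧
    -- for each fixed number of agents, a wEF1 and PO allocation is found in polynomial time
    (∀ n : ℕ, 1 ≤ n →
      ChoreDivision.RAM.SolvableInPolyTime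
        (ChoreDivision.RatInstance.encode (n := n))
        (fun I w => ∃ x : ChoreDivision.Allocation n I.1,
          w = x.encode ∧ I.2.toInstance.IsWEF1 x ∧ I.2.toInstance.IsPO x)) := by
  refine ⟨fun n m hn I => ?_, fun n m hn I => I.exists_isWEF1_isFPO hn,
    fun n hn => ChoreDivision.solvableInPolyTime n hn⟩
  obtain ⟨x, hx, hx'⟩ := I.exists_isWEF1_isFPO hn
  exact ⟨x, hx, hx'.isPO⟩
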